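/- Let $M$ be a connected closed $n$-dimensional smooth manifold, let $t_0<t_1$, and let $g(t)$, $t\in[t_0,t_1]$, be a smooth solution of the Ricci flow $\frac{\partial g}{\partial t}=-2\operatorname{Ric}$ on $M$. Let $\rho,\phi\in C^\infty([t_0,t_1]\times M)$ with $\rho>0$ and $\int_M\rho(t)\operatorname{dvol}_M=1$ for every $t$, where $\operatorname{dvol}_M$ is the Riemannian density of $g(t)$. Suppose that the transport equation $$\frac{\partial\rho}{\partial t}=-\nabla^i(\rho\nabla_i\phi)+R\rho$$ and the Hamilton–Jacobi equation $$\frac{\partial\phi}{\partial t}=-\frac12|\nabla\phi|^2+\frac12R$$ hold on $[t_0,t_1]\times M$, where $\nabla$, $|\cdot|$, $\operatorname{Ric}$, $\operatorname{Hess}$ and the scalar curvature $R$ at time $t$ are those of $g(t)$. Then, for all $t\in[t_0,t_1]$ (with one-sided derivatives at the endpoints), $$\frac{d^2}{dt^2}\int_M\rho\log(\rho)\operatorname{dvol}_M=\int_M\left(|\operatorname{Ric}-\operatorname{Hess}\phi|^2+\frac12H(\nabla\phi)\right)\rho\operatorname{dvol}_M,$$ where $H(X)=R_t+2\langle\nabla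 R,X\rangle+2\operatorname{Ric}(X,X)$ is Hamilton's trace Harnack expression. Also, $$\frac{d^2}{dt^2}\int_M\left(\rho\log(\rho)-\phi\rho\right)\operatorname{dvol}_M=\int_M|\operatorname{Ric}-\operatorname{Hess}\phi|^2\,\rho\operatorname{dvol}_M.$$ In particular, $\int_M(\rho\log(\rho)-\phi\rho)\operatorname{dvol}_M$ is convex in $t\in[t_0,t_1]$. -/

import Mathlib

open scoped Manifold ContDiff

namespace RicciTransport

noncomputable section

/-- A smooth Riemannian metric on the `n`-manifold `M`. -/
abbrev Metric (n : ℕ) (M : Type*) [TopologicalSpace M] [ChartedSpace (EuclideanSpace ℝ (Fin n)) M]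
    [IsManifold (𝓡 n) ∞ M] : Type _ :=
  Bundle.ContMDiffRiemannianMetric (𝓡 n) ∞ (EuclideanSpace ℝ (Fin n))
    (fun x : M => TangentSpace (𝓡 n) x)

/-- The partial derivative `∂ᵢ f` of a function on `ℝⁿ`. -/
def pd {n : ℕ} (i : Fin n) (f : EuclideanSpace ℝ (Fin n) → ℝ) (y : EuclideanSpace ℝ (Fin n)) : ℝ :=
  fderiv ℝ f y (EuclideanSpace.single i 1)

section Local

/-! Local expressions in the preferred chart around a base point `a`; `y` is a point of the target
of that chart. -/

variable {n : ℕ} {M : Type*} [TopologicalSpace M] [ChartedSpace (EuclideanSpace ℝ (Fin n)) M]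

/-- The expression of a function in the chart around `a`. -/
def localFun (a : M) (f : M → ℝ) (y : EuclideanSpace ℝ (Fin n)) : ℝ :=
  f ((extChartAt (𝓡 n) a).symm y)

/-- The coordinate vector `∂ᵢ` of the chart around `a`, at the point with coordinates `y`. -/
def frame (a : M) (y : EuclideanSpace ℝ (Fin n)) (i : Fin n) :
    TangentSpace (𝓡 n) ((extChartAt (𝓡 n) a).symm y) :=
  mfderiv 𝓘(ℝ, EuclideanSpace ℝ (Fin n)) (𝓡 n) (extChartAt (𝓡 n) a).symm y
    (EuclideanSpace.single i (1 : ℝ) : EuclideanSpace ℝ (Fin n))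

/-- The `i`-th component, in the chart around `a`, of a tangent vector at `x`. -/
def comp (a : M) {x : M} (X : TangentSpace (𝓡 n) x) (i : Fin n) : ℝ :=
  let v : EuclideanSpace ℝ (Fin n) :=
    mfderiv (𝓡 n) 𝓘(ℝ, EuclideanSpace ℝ (Fin n)) (extChartAt (𝓡 n) a) x X
  v i

variable [IsManifold (𝓡 n) ∞ M]

/-- The matrix `g_ij`. -/
def gram (g : Metric n M) (a : M) (y : EuclideanSpace ℝ (Fin n)) : Matrix (Fin n) (Fin n) ℝ :=
  Matrix.of fun i j => g.inner ((extChartAt (𝓡 n) a).symm y) (frame a y i) (frame a y j)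

/-- The inverse matrix `g^ij`. -/
def gramInv (g : Metric n M) (a : M) (y : EuclideanSpace ℝ (Fin n)) : Matrix (Fin n) (Fin n) ℝ :=
  (gram g a y)⁻¹

/-- The Christoffel symbol `Γ^k_ij` of the Levi-Civita connection. -/
def christoffel (g : Metric n M) (a : M) (k i j : Fin n) (y : EuclideanSpace ℝ (Fin n)) : ℝ :=
  (1 / 2) * ∑ l, gramInv g a y k l *
    (pd i (fun z => gram g a z j l) y + pd j (fun z => gram g a z i l) y
      - pd l (fun z => gram g a z i j) y)

/-- The components `R_ij` of the Ricci tensor. -/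
def ricciLocal (g : Metric n M) (a : M) (y : EuclideanSpace ℝ (Fin n)) (i j : Fin n) : ℝ :=
  ∑ k, pd k (christoffel g a k i j) y - ∑ k, pd j (christoffel g a k i k) y
    + ∑ k, ∑ l, (christoffel g a k k l y * christoffel g a l i j y
      - christoffel g a k j l y * christoffel g a l i k y)

/-- The components `∂ᵢ∂ⱼ f - Γ^k_ij ∂ₖ f` of the Hessian of `f`. -/
def hessLocal (g : Metric n M) (f : M → ℝ) (a : M) (y : EuclideanSpace ℝ (Fin n))
    (i j : Fin n) : ℝ :=
  pd i (pd j (localFun a f)) y - ∑ k, christoffel g a k i j y * pd k (localFun a f) y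

end Local

section Global

/-! Tensors on the manifold; their value at `x` is computed in the preferred chart around `x`. -/

variable {n : ℕ} {M : Type*} [TopologicalSpace M] [ChartedSpace (EuclideanSpace ℝ (Fin n)) M]
  [IsManifold (𝓡 n) ∞ M]

/-- The gradient vector `∇f`, with components `g^ij ∂ⱼ f`. -/
def grad (g : Metric n M) (f : M → ℝ) (x : M) : TangentSpace (𝓡 n) x :=
  let y := extChartAt (𝓡 n) x x
  ∑ i, (∑ j, gramInv g x y i j * pd j (localFun x f) y) •
    (mfderiv 𝓘(ℝ, EuclideanSpace ℝ (Fin n)) (𝓡 n) (extChartAt (𝓡 n) x).symm y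
      (EuclideanSpace.single i (1 : ℝ) : EuclideanSpace ℝ (Fin n)) : EuclideanSpace ℝ (Fin n))

/-- The divergence `∇ᵢ Vⁱ = ∂ᵢ Vⁱ + Γⁱ_ij Vʲ` of a vector field. -/
def divergence (g : Metric n M) (V : ∀ x : M, TangentSpace (𝓡 n) x) (x : M) : ℝ :=
  let y := extChartAt (𝓡 n) x x
  ∑ i, pd i (fun z => comp x (V ((extChartAt (𝓡 n) x).symm z)) i) y
    + ∑ i, ∑ j, christoffel g x i i j y * comp x (V x) j

/-- The Ricci tensor `Ric(X, Y)`. -/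
def ricci (g : Metric n M) (x : M) (X Y : TangentSpace (𝓡 n) x) : ℝ :=
  ∑ i, ∑ j, ricciLocal g x (extChartAt (𝓡 n) x x) i j * comp x X i * comp x Y j

/-- The scalar curvature `R = g^ij R_ij`. -/
def scalar (g : Metric n M) (x : M) : ℝ :=
  let y := extChartAt (𝓡 n) x x
  ∑ i, ∑ j, gramInv g x y i j * ricciLocal g x y i j

/-- The squared norm `|Ric - Hess f|² = g^ik g^jl T_ij T_kl`, where `T = Ric - Hess f`. -/
def normSqRicciSubHess (g : Metric n M) (f : M → ℝ) (x : M) : ℝ :=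
  let y := extChartAt (𝓡 n) x x
  let T := fun i j => ricciLocal g x y i j - hessLocal g f x y i j
  ∑ i, ∑ j, ∑ k, ∑ l, gramInv g x y i k * gramInv g x y j l * T i j * T k l

/-- A smooth partition of unity on `M` subordinate to the domains of the preferred charts. -/
def partition (n : ℕ) (M : Type*) [TopologicalSpace M] [ChartedSpace (EuclideanSpace ℝ (Fin n)) M]
    [IsManifold (𝓡 n) ∞ M] [T2Space M] [SigmaCompactSpace M] :
    SmoothPartitionOfUnity M (𝓡 n) M :=
  (SmoothPartitionOfUnity.exists_isSubordinate_chartAt_source (𝓡 n) M).choose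

/-- The Riemannian density `dvol`: the sum over the charts `a`, weighted by the partition of unity,
of the measures with density `√det(g_ij)` with respect to Lebesgue measure in the chart. (By the
change of variables formula it does not depend on the partition of unity.) -/
def dvol [T2Space M] [SigmaCompactSpace M] [MeasurableSpace M] (g : Metric n M) :
    MeasureTheory.Measure M :=
  MeasureTheory.Measure.sum fun a : M =>
    ((MeasureTheory.volume.restrict (extChartAt (𝓡 n) a).target).withDensity fun y =>
      ENNReal.ofReal (partition n M a ((extChartAt (𝓡 n) a).symm y)
        * Real.sqrt (gram g a y).det)).map (extChartAt (𝓡 n) a).symm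

/-- The family `g` of Riemannian metrics is smooth on `J × M`. -/
def SmoothMetricFamily (g : ℝ → Metric n M) (J : Set ℝ) : Prop :=
  ContMDiffOn (𝓘(ℝ, ℝ).prod (𝓡 n))
    ((𝓡 n).prod 𝓘(ℝ, EuclideanSpace ℝ (Fin n) →L[ℝ] EuclideanSpace ℝ (Fin n) →L[ℝ] ℝ)) ∞
    (fun p : ℝ × M => Bundle.TotalSpace.mk'
      (EuclideanSpace ℝ (Fin n) →L[ℝ] EuclideanSpace ℝ (Fin n) →L[ℝ] ℝ)
      (E := fun x : M => TangentSpace (𝓡 n) x →L[ℝ] TangentSpace (𝓡 n) x →L[ℝ] ℝ)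
      p.2 ((g p.1).inner p.2))
    (J ×ˢ Set.univ)

/-- The family `u` of functions is smooth on `J × M`. -/
def SmoothFunFamily (n : ℕ) {M : Type*} [TopologicalSpace M]
    [ChartedSpace (EuclideanSpace ℝ (Fin n)) M] (u : ℝ → M → ℝ) (J : Set ℝ) : Prop :=
  ContMDiffOn (𝓘(ℝ, ℝ).prod (𝓡 n)) 𝓘(ℝ, ℝ) ∞ (fun p : ℝ × M => u p.1 p.2) (J ×ˢ Set.univ)

/-- `g` is a (smooth) solution of the Ricci flow `∂g/∂t = -2 Ric` on the time interval `J`. -/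
structure IsRicciFlow (g : ℝ → Metric n M) (J : Set ℝ) : Prop where
  smooth : SmoothMetricFamily g J
  flow : ∀ t ∈ J, ∀ (x : M) (X Y : TangentSpace (𝓡 n) x),
    HasDerivWithinAt (fun s => (g s).inner x X Y) (-2 * ricci (g t) x X Y) J t

/-- The transport equation `∂ρ/∂t = -∇ⁱ(ρ ∇ᵢφ) + R ρ`. -/
def TransportEq (g : ℝ → Metric n M) (ρ φ : ℝ → M → ℝ) (J : Set ℝ) : Prop :=
  ∀ t ∈ J, ∀ x : M, HasDerivWithinAt (fun s => ρ s x)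
    (-divergence (g t) (fun z => ρ t z • grad (g t) (φ t) z) x + scalar (g t) x * ρ t x) J t

/-- The Hamilton-Jacobi equation `∂φ/∂t = -|∇φ|²/2 + R/2`. -/
def HamiltonJacobiEq (g : ℝ → Metric n M) (φ : ℝ → M → ℝ) (J : Set ℝ) : Prop :=
  ∀ t ∈ J, ∀ x : M, HasDerivWithinAt (fun s => φ s x)
    (-(1 / 2) * (g t).inner x (grad (g t) (φ t) x) (grad (g t) (φ t) x)
      + (1 / 2) * scalar (g t) x) J t

/-- Hamilton's trace Harnack expression `H(X) = R_t + 2⟨∇R, X⟩ + 2 Ric(X, X)` at time `t`. -/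
def harnack (g : ℝ → Metric n M) (J : Set ℝ) (t : ℝ) (x : M) (X : TangentSpace (𝓡 n) x) : ℝ :=
  derivWithin (fun s => scalar (g s) x) J t
    + 2 * (g t).inner x (grad (g t) (scalar (g t)) x) X + 2 * ricci (g t) x X X

end Global

/-- On `J`, the function `F` is twice differentiable with `F'' = G` (one-sided derivatives at
endpoints of `J`). -/
def HasSecondDerivOn (F G : ℝ → ℝ) (J : Set ℝ) : Prop :=
  ∃ F' : ℝ → ℝ, ∀ t ∈ J, HasDerivWithinAt F (F' t) J t ∧ HasDerivWithinAt F' (G t) J t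

end

end RicciTransport

namespace RicciTransport

/-! ### Riemannian geometry over a commutative algebra with derivations -/

/-! Write D = ∂_t + ⟨∇·,∇φ⟩ for the derivative along the flow of ∇φ. Under the Ricci flow the volume
element changes by -R dvol, and the transport equation says ρ_t - Rρ = -div(ρ∇φ). Green's formula
therefore gives d/dt ∫ fρ = ∫ (Df)ρ for every smooth f (`hasDerivWithinAt_integral_mul`). Everything
follows by applying this four times.

For f = log ρ the integrand becomes (R - Δφ)ρ. For f = R - Δφ one needs the pointwise identity D(R -
Δφ) = |Ric - Hess φ|² + H(∇φ)/2 (`flow_scal_sub_lap`). It combines R_t = ΔR + 2|Ric|², (Δφ)_t =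
Δ(φ_t) + 2⟨Ric, Hess φ⟩, Bochner's formula and the Hamilton–Jacobi equation. For f = φ the integrand
is (|∇φ|² + R)ρ/2, and D of (|∇φ|² + R)/2 is H(∇φ)/2 (`flow_energy`). Subtracting, the Harnack terms
cancel and a nonnegative square remains, which gives convexity.

All tensor calculus takes place in a commutative ℝ-algebra with commuting derivations, so that it
consists of matrix and ring identities without differentiability side conditions. The algebra used
is that of smooth functions on the time interval times a chart domain, where commuting derivatives
and one-sided time derivatives at the endpoints are available. The global tensors are defined at x
in the preferred chart around x, so their derivatives make sense only after independence of the
chart is known. This is obtained from a change of frame inside one algebra (`IsCoordChange`)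
followed by a homomorphism between two algebras (`IsMap`). Integrals against `dvol` are reduced to
chart integrals by the partition of unity. -/

/-- A metric with coefficients in an algebra `A`, on which `d i` play the role of the partial
derivatives. -/
structure CoordMetric (ι A : Type*) [Fintype ι] [DecidableEq ι] [CommRing A] [Algebra ℝ A] where
  /-- The partial derivatives. -/
  d : ι → Derivation ℝ A A
  /-- The metric. -/
  G : Matrix ι ι A
  /-- The inverse metric. -/
  H : Matrix ι ι A
  G_symm : G.transpose = G
  mul_eq_one : G * H = 1

namespace CoordMetric

open Matrix Finset

set_option linter.unusedSectionVars false

variable {ι A : Type*} [Fintype ι] [DecidableEq ι] [CommRing A] [Algebra ℝ A]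

theorem map_mul_derivation (D : Derivation ℝ A A) (M N : Matrix ι ι A) :
    (M * N).map D = M.map D * N + M * N.map D := by
  ext i j
  simp only [map_apply, mul_apply, map_sum, Derivation.leibniz, smul_eq_mul, Matrix.add_apply,
    ← sum_add_distrib]
  exact sum_congr rfl fun k _ => by ring

theorem map_add_derivation (D : Derivation ℝ A A) (M N : Matrix ι ι A) :
    (M + N).map D = M.map D + N.map D := by
  ext i j; simp

theorem map_sub_derivation (D : Derivation ℝ A A) (M N : Matrix ι ι A) :
    (M - N).map D = M.map D - N.map D := by
  ext i j; simp

theorem map_neg_derivation (D : Derivation ℝ A A) (M : Matrix ι ι A) :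
    (-M).map D = -M.map D := by
  ext i j; simp

theorem map_transpose_derivation (D : Derivation ℝ A A) (M : Matrix ι ι A) :
    (Mᵀ).map D = (M.map D)ᵀ := rfl

theorem map_one_derivation (D : Derivation ℝ A A) : (1 : Matrix ι ι A).map D = 0 := by
  ext i j
  by_cases h : i = j <;> simp [h, one_apply]

theorem eq_zero_of_add_self {a : A} (h : a + a = 0) : a = 0 := by
  have h2 : (2 : ℝ) • a = 0 := by rw [two_smul, h]
  simpa using congrArg ((2 : ℝ)⁻¹ • ·) h2

theorem half_smul (a b : A) (h : a = b + b) : (1 / 2 : ℝ) • a = b := by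
  rw [h, ← two_smul ℝ b, smul_smul]; norm_num

theorem half_smul_add_self (a : A) : (1 / 2 : ℝ) • a + (1 / 2 : ℝ) • a = a := by
  rw [← add_smul]; norm_num

variable (m : CoordMetric ι A)

/-- The Christoffel symbols. -/
noncomputable def chr (k i j : ι) : A :=
  (1 / 2 : ℝ) • ∑ l, m.H k l * (m.d i (m.G j l) + m.d j (m.G i l) - m.d l (m.G i j))

/-- The connection matrices `(Γᵢ)ᵏⱼ`. -/
noncomputable def conn (i : ι) : Matrix ι ι A := of fun k j => m.chr k i j

/-- The Ricci tensor. -/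
noncomputable def ric (i j : ι) : A :=
  ∑ k, m.d k (m.chr k i j) - ∑ k, m.d j (m.chr k i k)
    + ∑ k, ∑ l, (m.chr k k l * m.chr l i j - m.chr k j l * m.chr l i k)

/-- The Hessian. -/
noncomputable def hess (f : A) (i j : ι) : A := m.d i (m.d j f) - ∑ k, m.chr k i j * m.d k f

/-- The inner product of the gradients. -/
noncomputable def gm (f h : A) : A := ∑ i, ∑ j, m.H i j * m.d i f * m.d j h

/-- The trace of a bilinear form. -/
noncomputable def tr (T : ι → ι → A) : A := ∑ i, ∑ j, m.H i j * T i j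

/-- The inner product of bilinear forms. -/
noncomputable def ip (S T : ι → ι → A) : A := ∑ i, ∑ j, ∑ k, ∑ l, m.H i k * m.H j l * S i j * T k l

/-- The scalar curvature. -/
noncomputable def scal : A := m.tr m.ric

/-- The Laplacian. -/
noncomputable def lap (f : A) : A := m.tr (m.hess f)

/-- The components of the gradient. -/
noncomputable def nab (f : A) (i : ι) : A := ∑ j, m.H i j * m.d j f

/-- The curvature matrices. -/
noncomputable def curv (i j : ι) : Matrix ι ι A :=
  (m.conn j).map (m.d i) - (m.conn i).map (m.d j) + m.conn i * m.conn j - m.conn j * m.conn i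

theorem G_apply_symm (i j : ι) : m.G i j = m.G j i := congrFun (congrFun m.G_symm j) i

theorem mul_eq_one' : m.H * m.G = 1 := mul_eq_one_comm.mp m.mul_eq_one

theorem H_symm : m.Hᵀ = m.H := by
  have h : m.Hᵀ * m.G = 1 := by
    have := congrArg transpose m.mul_eq_one
    rwa [transpose_mul, m.G_symm, transpose_one] at this
  calc m.Hᵀ = m.Hᵀ * (m.G * m.H) := by rw [m.mul_eq_one, mul_one]
    _ = m.H := by rw [← mul_assoc, h, one_mul]

theorem H_apply_symm (i j : ι) : m.H i j = m.H j i := congrFun (congrFun m.H_symm j) i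

theorem chr_symm (k i j : ι) : m.chr k i j = m.chr k j i := by
  unfold chr
  congr 1
  exact sum_congr rfl fun l _ => by rw [m.G_apply_symm i j]; ring

theorem conn_apply (i k j : ι) : m.conn i k j = m.chr k i j := rfl

/-- These are the Christoffel symbols of the first kind; lowering the index removes the inverse
metric. -/
theorem G_mul_conn_apply (i l j : ι) : (m.G * m.conn i) l j =
    (1 / 2 : ℝ) • (m.d i (m.G j l) + m.d j (m.G i l) - m.d l (m.G i j)) := by
  have : m.conn i = (1 / 2 : ℝ) • (m.H * of fun l j =>
      m.d i (m.G j l) + m.d j (m.G i l) - m.d l (m.G i j)) := by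
    ext k j
    simp [conn, chr, mul_apply]
  rw [this, Matrix.mul_smul, ← Matrix.mul_assoc, m.mul_eq_one, one_mul]
  rfl

/-- The Levi-Civita connection preserves the metric. -/
theorem map_d_G (i : ι) : m.G.map (m.d i) = m.G * m.conn i + (m.conn i)ᵀ * m.G := by
  have h : (m.conn i)ᵀ * m.G = (m.G * m.conn i)ᵀ := by rw [transpose_mul, m.G_symm]
  rw [h]
  ext l j
  rw [Matrix.add_apply, transpose_apply, G_mul_conn_apply, G_mul_conn_apply, ← smul_add, map_apply,
    m.G_apply_symm l j]
  symm
  apply half_smul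
  ring

theorem map_H (D : Derivation ℝ A A) : m.H.map D = -(m.H * m.G.map D * m.H) := by
  have h := congrArg (fun M => M.map D) m.mul_eq_one'
  simp only [map_mul_derivation, map_one_derivation] at h
  calc m.H.map D = m.H.map D * (m.G * m.H) := by rw [m.mul_eq_one, mul_one]
    _ = (m.H.map D * m.G + m.H * m.G.map D) * m.H - m.H * m.G.map D * m.H := by
      noncomm_ring
    _ = _ := by rw [h]; simp

theorem map_d_H (i : ι) : m.H.map (m.d i) = -(m.conn i * m.H + m.H * (m.conn i)ᵀ) := by
  rw [map_H, map_d_G]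
  congr 1
  calc m.H * (m.G * m.conn i + (m.conn i)ᵀ * m.G) * m.H
      = (m.H * m.G) * m.conn i * m.H + m.H * (m.conn i)ᵀ * (m.G * m.H) := by noncomm_ring
    _ = _ := by rw [m.mul_eq_one, m.mul_eq_one']; simp

/-- A torsion-free connection that preserves the metric is the Levi-Civita connection. -/
theorem eq_conn_of_compat (C : ι → Matrix ι ι A) (hs : ∀ k i j, C i k j = C j k i)
    (hG : ∀ i, m.G.map (m.d i) = m.G * C i + (C i)ᵀ * m.G) (i : ι) : m.conn i = C i := by
  set T : ι → ι → ι → A := fun i l j => (m.G * m.conn i) l j - (m.G * C i) l j with hT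
  have hanti : ∀ i l j, T i l j = -T i j l := by
    intro i l j
    have h := congrFun (congrFun ((m.map_d_G i).symm.trans (hG i)) l) j
    have h1 : (m.conn i)ᵀ * m.G = (m.G * m.conn i)ᵀ := by rw [transpose_mul, m.G_symm]
    have h2 : (C i)ᵀ * m.G = (m.G * C i)ᵀ := by rw [transpose_mul, m.G_symm]
    rw [h1, h2] at h
    simp only [Matrix.add_apply, transpose_apply] at h
    simp only [hT]
    linear_combination h
  have hsym : ∀ i l j, T i l j = T j l i := by
    intro i l j
    simp only [hT, mul_apply]
    congr 1
    · exact sum_congr rfl fun k _ => by rw [conn_apply, conn_apply, chr_symm]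
    · exact sum_congr rfl fun k _ => by rw [hs]
  -- T is skew in its last two indices and symmetric in the outer two. Alternating the two
  -- symmetries, six steps in all, leads from T back to -T, so 2T = 0.
  have hzero : ∀ i l j, T i l j = 0 := by
    intro i l j
    apply eq_zero_of_add_self
    have h1 := hanti i l j
    have h2 := hsym i j l
    have h3 := hanti l j i
    have h4 := hsym l i j
    have h5 := hanti j i l
    have h6 := hsym j l i
    linear_combination h1 - h2 - h3 + h4 + h5 - h6
  have h : m.G * m.conn i = m.G * C i := by
    ext l j
    exact sub_eq_zero.mp (hzero i l j)
  calc m.conn i = m.H * (m.G * m.conn i) := by rw [← Matrix.mul_assoc, m.mul_eq_one', one_mul]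
    _ = C i := by rw [h, ← Matrix.mul_assoc, m.mul_eq_one', one_mul]

/-- Fixes the convention: `curv i j` is the endomorphism [∇_i, ∇_j], and Ricci is its trace over the
first form index and the upper index. -/
theorem ric_eq_sum_curv (i j : ι) : m.ric i j = ∑ k, m.curv k j k i := by
  simp only [ric, curv, Matrix.sub_apply, Matrix.add_apply, map_apply, conn_apply, mul_apply,
    sum_add_distrib, sum_sub_distrib, m.chr_symm _ i]
  ring

theorem curv_antisymm (i j : ι) : m.curv i j = -m.curv j i := by
  simp only [curv]; abel

/-- First Bianchi identity. It needs only the symmetry of the Christoffel symbols, not that the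
derivations commute. -/
theorem curv_cyclic (i j l k : ι) : m.curv i j k l + m.curv j l k i + m.curv l i k j = 0 := by
  simp only [curv, Matrix.sub_apply, Matrix.add_apply, map_apply, conn_apply, mul_apply]
  rw [m.chr_symm k j l, m.chr_symm k i l, m.chr_symm k j i]
  simp only [m.chr_symm _ j l, m.chr_symm _ i l, m.chr_symm _ j i]
  ring

variable (hcomm : ∀ i j a, m.d i (m.d j a) = m.d j (m.d i a))

include hcomm

theorem map_d_comm (i j : ι) (M : Matrix ι ι A) :
    (M.map (m.d i)).map (m.d j) = (M.map (m.d j)).map (m.d i) := by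
  ext k l
  exact hcomm j i _

theorem hess_symm (f : A) (i j : ι) : m.hess f i j = m.hess f j i := by
  unfold hess
  rw [hcomm i j]
  congr 1
  exact sum_congr rfl fun k _ => by rw [chr_symm]

/-- Curvature is skew for the metric: differentiating the inverse metric in two orders, with each
derivative given by the connection, leaves exactly this expression. -/
theorem curv_mul_H (i j : ι) : m.curv i j * m.H + m.H * (m.curv i j)ᵀ = 0 := by
  have key := m.map_d_comm hcomm j i m.H
  rw [m.map_d_H, m.map_d_H] at key
  simp only [map_neg_derivation, map_add_derivation, map_mul_derivation,
    map_transpose_derivation, m.map_d_H] at key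
  simp only [curv, transpose_add, transpose_sub, transpose_mul]
  have := sub_eq_zero.mpr key
  rw [← neg_eq_zero, ← this]
  noncomm_ring

/-- The second Bianchi identity. -/
theorem curv_bianchi (a b c : ι) :
    ((m.curv b c).map (m.d a) + m.conn a * m.curv b c - m.curv b c * m.conn a)
    + ((m.curv c a).map (m.d b) + m.conn b * m.curv c a - m.curv c a * m.conn b)
    + ((m.curv a b).map (m.d c) + m.conn c * m.curv a b - m.curv a b * m.conn c) = 0 := by
  simp only [curv, map_sub_derivation, map_add_derivation, map_mul_derivation]
  rw [m.map_d_comm hcomm a b (m.conn c), m.map_d_comm hcomm a c (m.conn b),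
    m.map_d_comm hcomm b c (m.conn a)]
  noncomm_ring

/-- A metric-skew endomorphism has trace zero. -/
theorem sum_curv_diag (i j : ι) : ∑ k, m.curv i j k k = 0 := by
  have h := congrArg (fun M => trace (M * m.G)) (m.curv_mul_H hcomm i j)
  simp only [add_mul, trace_add, Matrix.mul_assoc, m.mul_eq_one', mul_one, zero_mul,
    trace_zero] at h
  rw [trace_mul_comm m.H, Matrix.mul_assoc, m.mul_eq_one, mul_one, trace_transpose] at h
  exact eq_zero_of_add_self h

/-- Trace of the first Bianchi identity: the difference of the two sides is the trace of a curvature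
endomorphism. -/
theorem ric_symm (i j : ι) : m.ric i j = m.ric j i := by
  rw [ric_eq_sum_curv, ric_eq_sum_curv, ← sub_eq_zero, ← sum_sub_distrib,
    ← m.sum_curv_diag hcomm i j]
  refine sum_congr rfl fun k _ => ?_
  have h1 := m.curv_cyclic k j i k
  have h2 := congrFun (congrFun (m.curv_antisymm i k) k) j
  have h3 := congrFun (congrFun (m.curv_antisymm j i) k) k
  simp only [Matrix.neg_apply] at h2 h3
  linear_combination h1 - h2 - h3

end CoordMetric
end RicciTransport

/-! ### Contracted Bianchi, Ricci and Bochner identities. -/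

namespace RicciTransport
namespace CoordMetric

open Matrix Finset

set_option linter.unusedSectionVars false

variable {ι A : Type*} [Fintype ι] [DecidableEq ι] [CommRing A] [Algebra ℝ A]
  (m : CoordMetric ι A)

theorem d_H (c i j : ι) : m.d c (m.H i j) =
    -(∑ k, m.chr i c k * m.H k j + ∑ k, m.H i k * m.chr j c k) :=
  congrFun (congrFun (m.map_d_H c) i) j

/-- The covariant derivative commutes with raising an index. -/
theorem covariant_mul_H (c : ι) (T : Matrix ι ι A) :
    (T.map (m.d c) + m.conn c * T - T * m.conn c) * m.H
      = (T * m.H).map (m.d c) + m.conn c * (T * m.H) + T * m.H * (m.conn c)ᵀ := by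
  rw [map_mul_derivation, m.map_d_H]
  noncomm_ring

/-- The covariant derivative of the gradient. -/
theorem cov_nab (f : A) (i k : ι) :
    m.d i (m.nab f k) + ∑ j, m.chr k i j * m.nab f j = ∑ l, m.H k l * m.hess f i l := by
  have h1 : ∑ l, (∑ a, m.chr k i a * m.H a l) * m.d l f = ∑ j, m.chr k i j * m.nab f j := by
    simp only [nab, mul_sum, sum_mul]
    rw [sum_comm]
    exact sum_congr rfl fun _ _ => sum_congr rfl fun _ _ => by ring
  have h2 : ∑ l, (∑ a, m.H k a * m.chr l i a) * m.d l f
      = ∑ l, m.H k l * ∑ a, m.chr a i l * m.d a f := by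
    simp only [mul_sum, sum_mul]
    rw [sum_comm]
    exact sum_congr rfl fun _ _ => sum_congr rfl fun _ _ => by ring
  rw [← h1]
  simp only [nab, hess, map_sum, Derivation.leibniz, smul_eq_mul, d_H, mul_sub, sum_sub_distrib,
    sum_add_distrib, ← h2]
  rw [add_assoc, sub_eq_add_neg]
  congr 1
  rw [← sum_add_distrib, ← sum_neg_distrib]
  exact sum_congr rfl fun l _ => by ring

/-- The Laplacian is the divergence of the gradient. -/
theorem lap_eq_div (f : A) :
    m.lap f = ∑ i, m.d i (m.nab f i) + ∑ i, ∑ j, m.chr i i j * m.nab f j := by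
  rw [← sum_add_distrib]
  exact (sum_congr rfl fun i _ => m.cov_nab f i i).symm

theorem gm_eq (f h : A) : m.gm f h = ∑ k, m.nab f k * m.d k h := by
  simp only [gm, nab, sum_mul]
  rw [sum_comm]
  exact sum_congr rfl fun _ _ => sum_congr rfl fun _ _ => by rw [m.H_apply_symm]

theorem gm_symm (f h : A) : m.gm f h = m.gm h f := by
  unfold gm
  rw [sum_comm]
  exact sum_congr rfl fun i _ => sum_congr rfl fun j _ => by rw [m.H_apply_symm]; ring

/-- Metric compatibility in the form used below: the connection terms produced by the derivative of
the gradient are absorbed into the two Hessians. -/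
theorem d_gm (f h : A) (i : ι) : m.d i (m.gm f h) =
    ∑ l, m.hess f i l * m.nab h l + ∑ l, m.hess h i l * m.nab f l := by
  have h1 : ∑ l, m.hess f i l * m.nab h l = ∑ k, (∑ l, m.H k l * m.hess f i l) * m.d k h := by
    simp only [nab, sum_mul, mul_sum]
    rw [sum_comm]
    refine sum_congr rfl fun _ _ => sum_congr rfl fun _ _ => ?_
    rw [m.H_apply_symm]; ring
  have h2 : ∑ k, (∑ j, m.chr k i j * m.nab f j) * m.d k h
      = ∑ l, (∑ k, m.chr k i l * m.d k h) * m.nab f l := by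
    simp only [sum_mul]
    rw [sum_comm]
    exact sum_congr rfl fun _ _ => sum_congr rfl fun _ _ => by ring
  rw [h1, gm_eq]
  simp only [← cov_nab, add_mul, sum_add_distrib, h2]
  simp only [hess, sub_mul, sum_add_distrib, sum_sub_distrib, map_sum,
    Derivation.leibniz, smul_eq_mul]
  have h3 : ∑ l, m.d i (m.d l h) * m.nab f l = ∑ l, m.nab f l * m.d i (m.d l h) :=
    sum_congr rfl fun _ _ => mul_comm _ _
  have h4 : ∑ l, m.d l h * m.d i (m.nab f l) = ∑ l, m.d i (m.nab f l) * m.d l h :=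
    sum_congr rfl fun _ _ => mul_comm _ _
  rw [h3, h4]; ring

/-- The product of the Ricci tensor and the inverse metric. -/
noncomputable def ricUp : Matrix ι ι A := of m.ric * m.H

theorem trace_ricUp : ∑ k, m.ricUp k k = m.scal := by
  unfold ricUp scal tr
  simp only [mul_apply, of_apply]
  refine sum_congr rfl fun i _ => sum_congr rfl fun j _ => ?_
  rw [m.H_apply_symm]; ring

theorem tr_add (S T : ι → ι → A) : m.tr (fun i j => S i j + T i j) = m.tr S + m.tr T := by
  simp only [tr, mul_add, sum_add_distrib]

theorem ip_eq (S T : ι → ι → A) :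
    m.ip S T = ∑ j, ∑ k, (∑ i, m.H k i * S i j) * ∑ l, m.H j l * T k l := by
  simp only [ip, sum_mul_sum]
  rw [sum_comm]
  refine sum_congr rfl fun j _ => ?_
  rw [sum_comm]
  refine sum_congr rfl fun k _ => sum_congr rfl fun i _ => sum_congr rfl fun l _ => ?_
  rw [m.H_apply_symm k i]; ring

section Comm

variable (hcomm : ∀ i j a, m.d i (m.d j a) = m.d j (m.d i a))
include hcomm

theorem sum_curv_mul_H (c k : ι) : ∑ j, (m.curv j c * m.H) j k = m.ricUp c k := by
  simp only [ricUp, mul_apply, of_apply]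
  rw [sum_comm]
  refine sum_congr rfl fun i _ => ?_
  rw [← sum_mul, m.ric_symm hcomm, ric_eq_sum_curv]

theorem curv_mul_H_antisymm (i j k l : ι) :
    (m.curv i j * m.H) k l = -(m.curv i j * m.H) l k := by
  have h := congrFun (congrFun (m.curv_mul_H hcomm i j) k) l
  have h2 : m.H * (m.curv i j)ᵀ = (m.curv i j * m.H)ᵀ := by rw [transpose_mul, m.H_symm]
  rw [h2] at h
  exact eq_neg_of_add_eq_zero_left h

theorem curv_mul_H_swap (i j k l : ι) :
    (m.curv i j * m.H) k l = -(m.curv j i * m.H) k l := by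
  rw [m.curv_antisymm i j, neg_mul]; rfl

/-- The contracted Bianchi identity. -/
theorem d_scal (c : ι) : m.d c m.scal = 2 * (∑ k, m.d k (m.ricUp c k)
    + ∑ k, ∑ l, m.chr k k l * m.ricUp c l - ∑ k, ∑ l, m.chr k c l * m.ricUp k l) := by
  -- The second Bianchi identity with one index raised. Since raising commutes with covariant
  -- differentiation, the double contraction is a plain sum over k and j.
  have key : ∀ k j, ((m.curv k j * m.H).map (m.d c) + m.conn c * (m.curv k j * m.H)
      + m.curv k j * m.H * (m.conn c)ᵀ) k j
      + ((m.curv j c * m.H).map (m.d k) + m.conn k * (m.curv j c * m.H)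
      + m.curv j c * m.H * (m.conn k)ᵀ) k j
      + ((m.curv c k * m.H).map (m.d j) + m.conn j * (m.curv c k * m.H)
      + m.curv c k * m.H * (m.conn j)ᵀ) k j = 0 := by
    intro k j
    have h := congrArg (fun M => M * m.H) (m.curv_bianchi hcomm c k j)
    simp only [add_mul _ _ m.H, covariant_mul_H, zero_mul] at h
    exact congrFun (congrFun h k) j
  have key2 : ∑ k, ∑ j, (((m.curv k j * m.H).map (m.d c) + m.conn c * (m.curv k j * m.H)
      + m.curv k j * m.H * (m.conn c)ᵀ) k j
      + ((m.curv j c * m.H).map (m.d k) + m.conn k * (m.curv j c * m.H)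
      + m.curv j c * m.H * (m.conn k)ᵀ) k j
      + ((m.curv c k * m.H).map (m.d j) + m.conn j * (m.curv c k * m.H)
      + m.curv c k * m.H * (m.conn j)ᵀ) k j) = 0 :=
    sum_eq_zero fun k _ => sum_eq_zero fun j _ => key k j
  set P : ι → ι → Matrix ι ι A := fun a b => m.curv a b * m.H with hP
  -- Up to sign there is only one contraction of the raised curvature; `hQ2`, `hQ3` and `hQ4` follow
  -- from its two antisymmetries.
  have hQ : ∀ c k, ∑ j, P j c j k = m.ricUp c k := m.sum_curv_mul_H hcomm
  have hPs : ∀ a b k l, P a b k l = -P b a k l := m.curv_mul_H_swap hcomm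
  have hPa : ∀ a b k l, P a b k l = -P a b l k := m.curv_mul_H_antisymm hcomm
  have hQ2 : ∀ c k, ∑ j, P j c k j = -m.ricUp c k := by
    intro c k
    rw [← hQ, ← sum_neg_distrib]
    exact sum_congr rfl fun j _ => hPa _ _ _ _
  have hQ3 : ∀ c k, ∑ j, P c j j k = -m.ricUp c k := by
    intro c k
    rw [← hQ, ← sum_neg_distrib]
    exact sum_congr rfl fun j _ => hPs _ _ _ _
  have hQ4 : ∀ c k, ∑ j, P c j k j = m.ricUp c k := by
    intro c k
    rw [← neg_neg (m.ricUp c k), ← hQ2, ← sum_neg_distrib]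
    exact sum_congr rfl fun j _ => hPs _ _ _ _
  change ∑ k, ∑ j, (((P k j).map (m.d c) + m.conn c * P k j + P k j * (m.conn c)ᵀ) k j
      + ((P j c).map (m.d k) + m.conn k * P j c + P j c * (m.conn k)ᵀ) k j
      + ((P c k).map (m.d j) + m.conn j * P c k + P c k * (m.conn j)ᵀ) k j) = 0 at key2
  simp only [Matrix.add_apply, map_apply, mul_apply, sum_add_distrib, conn_apply,
    transpose_apply] at key2
  have e1 : ∑ k, ∑ j, m.d c (P k j k j) = m.d c m.scal := by
    rw [← trace_ricUp, map_sum, sum_comm]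
    exact sum_congr rfl fun j _ => by rw [← map_sum, hQ]
  have e2 : ∑ k, ∑ j, ∑ l, m.chr k c l * P k j l j = ∑ k, ∑ l, m.chr k c l * m.ricUp k l := by
    refine sum_congr rfl fun k _ => ?_
    rw [sum_comm]
    exact sum_congr rfl fun l _ => by rw [← mul_sum, hQ4]
  have e3 : ∑ k, ∑ j, ∑ l, P k j k l * m.chr j c l = ∑ k, ∑ l, m.chr k c l * m.ricUp k l := by
    rw [sum_comm]
    refine sum_congr rfl fun k _ => ?_
    rw [sum_comm]
    exact sum_congr rfl fun l _ => by rw [← sum_mul, hQ, mul_comm]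
  have e4 : ∑ k, ∑ j, m.d k (P j c k j) = -∑ k, m.d k (m.ricUp c k) := by
    rw [← sum_neg_distrib]
    exact sum_congr rfl fun j _ => by rw [← map_sum, hQ2, map_neg]
  have e5 : ∑ k, ∑ j, ∑ l, m.chr k k l * P j c l j
      = -∑ k, ∑ l, m.chr k k l * m.ricUp c l := by
    rw [← sum_neg_distrib]
    refine sum_congr rfl fun k _ => ?_
    rw [sum_comm, ← sum_neg_distrib]
    exact sum_congr rfl fun l _ => by rw [← mul_sum, hQ2]; ring
  -- Christoffel symbols, symmetric below, are contracted with a skew pair of curvature indices;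
  -- `e8` vanishes for the same reason.
  have e6 : ∑ k, ∑ j, ∑ l, P j c k l * m.chr j k l = 0 := by
    rw [sum_comm]
    refine sum_eq_zero fun j _ => eq_zero_of_add_self ?_
    nth_rewrite 2 [sum_comm]
    rw [← sum_add_distrib]
    refine sum_eq_zero fun k _ => ?_
    rw [← sum_add_distrib]
    refine sum_eq_zero fun l _ => ?_
    rw [hPa j c l k, m.chr_symm j l k]; ring
  have e7 : ∑ k, ∑ j, m.d j (P c k k j) = -∑ k, m.d k (m.ricUp c k) := by
    rw [sum_comm, ← sum_neg_distrib]
    exact sum_congr rfl fun j _ => by rw [← map_sum, hQ3, map_neg]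
  have e8 : ∑ k, ∑ j, ∑ l, m.chr k j l * P c k l j = 0 := by
    refine sum_eq_zero fun j _ => eq_zero_of_add_self ?_
    nth_rewrite 2 [sum_comm]
    rw [← sum_add_distrib]
    refine sum_eq_zero fun k _ => ?_
    rw [← sum_add_distrib]
    refine sum_eq_zero fun l _ => ?_
    rw [hPa c j l k, m.chr_symm j l k]; ring
  have e9 : ∑ k, ∑ j, ∑ l, P c k k l * m.chr j j l
      = -∑ k, ∑ l, m.chr k k l * m.ricUp c l := by
    rw [sum_comm, ← sum_neg_distrib]
    refine sum_congr rfl fun k _ => ?_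
    rw [sum_comm, ← sum_neg_distrib]
    exact sum_congr rfl fun l _ => by rw [← sum_mul, hQ3]; ring
  rw [e1, e2, e3, e4, e5, e6, e7, e8, e9] at key2
  linear_combination key2

/-- The Ricci identity for the gradient. -/
theorem ricci_identity (V : ι → A) (i l k : ι) :
    m.d i (m.d l (V k) + ∑ a, m.chr k l a * V a)
      + ∑ b, m.chr k i b * (m.d l (V b) + ∑ a, m.chr b l a * V a)
    = m.d l (m.d i (V k) + ∑ a, m.chr k i a * V a)
      + ∑ b, m.chr k l b * (m.d i (V b) + ∑ a, m.chr b i a * V a)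
      + ∑ a, m.curv i l k a * V a := by
  have h1 : ∀ i l, ∑ b, m.chr k i b * ∑ a, m.chr b l a * V a
      = ∑ a, (∑ b, m.chr k i b * m.chr b l a) * V a := by
    intro i l
    simp only [mul_sum, sum_mul]
    rw [sum_comm]
    exact sum_congr rfl fun _ _ => sum_congr rfl fun _ _ => by ring
  simp only [curv, map_add, mul_add, sum_add_distrib, h1, map_sum, Derivation.leibniz,
    smul_eq_mul, Matrix.sub_apply, Matrix.add_apply, map_apply, conn_apply, mul_apply, add_mul,
    sub_mul, sum_sub_distrib]
  rw [hcomm i l]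
  have h2 : ∀ i l, ∑ a, V a * m.d i (m.chr k l a) = ∑ a, m.d i (m.chr k l a) * V a := fun i l =>
    sum_congr rfl fun _ _ => mul_comm _ _
  rw [h2, h2]
  ring

/-- Bochner's formula. -/
theorem bochner (f : A) : m.lap (m.gm f f) = 2 * (m.gm f (m.lap f) + m.ip (m.hess f) (m.hess f)
    + ∑ k, ∑ l, m.ric k l * m.nab f k * m.nab f l) := by
  set V := m.nab f with hV
  set S : ι → ι → A := fun i k => ∑ l, m.H k l * m.hess f i l with hS
  have hcov : ∀ i k, m.d i (V k) + ∑ j, m.chr k i j * V j = S i k := m.cov_nab f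
  -- Half the gradient of |∇f|² is the Hessian applied to ∇f, so the Laplacian becomes the
  -- divergence of 2 S V.
  have hdg : ∀ i, m.d i (m.gm f f) = 2 * ∑ l, m.hess f i l * V l := by
    intro i; rw [d_gm]; ring
  have hn : ∀ i, m.nab (m.gm f f) i = 2 * ∑ l, S l i * V l := by
    intro i
    simp only [nab, hdg, hS, mul_sum, sum_mul]
    rw [sum_comm]
    refine sum_congr rfl fun _ _ => sum_congr rfl fun _ _ => ?_
    rw [m.hess_symm hcomm f]; ring
  have hlap : m.lap f = ∑ i, S i i := rfl
  have htwo : ∀ i, m.d i (2 : A) = 0 := fun i => by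
    have := (m.d i).map_natCast 2
    simpa using this
  -- The Ricci identity for V traced over the derivative index and the component: exchanging the two
  -- covariant derivatives costs one Ricci term, and the rest is the gradient of the Laplacian.
  have hR : ∀ l, ∑ i, m.d i (S l i) + ∑ i, ∑ k, m.chr i i k * S l k
      = m.d l (m.lap f) + ∑ i, ∑ k, m.chr i l k * S i k + ∑ k, m.ric k l * V k := by
    intro l
    have h : ∀ i, m.d i (S l i) + ∑ k, m.chr i i k * S l k
        = m.d l (S i i) + ∑ k, m.chr i l k * S i k + ∑ k, m.curv i l i k * V k := by
      intro i
      simp only [← hcov]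
      exact m.ricci_identity hcomm V i l i
    rw [← sum_add_distrib, sum_congr rfl fun i _ => h i, sum_add_distrib, sum_add_distrib,
      hlap, map_sum]
    congr 1
    rw [sum_comm]
    exact sum_congr rfl fun k _ => by rw [← sum_mul, ric_eq_sum_curv]
  have e0 : ∑ i, m.d i (2 * ∑ l, S l i * V l)
      = 2 * (∑ l, V l * ∑ i, m.d i (S l i) + ∑ l, ∑ i, S l i * m.d i (V l)) := by
    have h1 : ∑ l, V l * ∑ i, m.d i (S l i) = ∑ i, ∑ l, V l * m.d i (S l i) := by
      simp only [mul_sum]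
      rw [sum_comm]
    rw [h1, sum_comm (f := fun l i => S l i * m.d i (V l)), ← sum_add_distrib, mul_sum]
    refine sum_congr rfl fun i _ => ?_
    rw [Derivation.leibniz, htwo, map_sum, smul_zero, add_zero, smul_eq_mul, ← sum_add_distrib]
    congr 1
    refine sum_congr rfl fun l _ => ?_
    rw [Derivation.leibniz, smul_eq_mul, smul_eq_mul, add_comm]
  have e1 : ∑ i, ∑ j, m.chr i i j * (2 * ∑ l, S l j * V l)
      = 2 * ∑ l, V l * ∑ i, ∑ k, m.chr i i k * S l k := by
    simp only [mul_sum]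
    rw [sum_comm_cycle]
    exact sum_congr rfl fun _ _ => sum_congr rfl fun _ _ => sum_congr rfl fun _ _ => by ring
  have e2 : ∑ l, V l * ∑ i, ∑ k, m.chr i l k * S i k
      = ∑ l, ∑ i, S l i * ∑ k, m.chr l i k * V k := by
    simp only [mul_sum]
    rw [sum_comm]
    refine sum_congr rfl fun i _ => ?_
    rw [sum_comm]
    refine sum_congr rfl fun k _ => sum_congr rfl fun l _ => ?_
    rw [m.chr_symm i l k]; ring
  have e3 : ∑ l, V l * ∑ k, m.ric k l * V k = ∑ k, ∑ l, m.ric k l * V k * V l := by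
    simp only [mul_sum]
    rw [sum_comm]
    exact sum_congr rfl fun _ _ => sum_congr rfl fun _ _ => by ring
  have e4 : m.ip (m.hess f) (m.hess f)
      = ∑ l, ∑ i, S l i * m.d i (V l) + ∑ l, ∑ i, S l i * ∑ k, m.chr l i k * V k := by
    rw [ip_eq, ← sum_add_distrib]
    refine sum_congr rfl fun j _ => ?_
    rw [← sum_add_distrib]
    refine sum_congr rfl fun k _ => ?_
    rw [← mul_add, hcov, hS]
    congr 1
    exact sum_congr rfl fun i _ => by rw [m.hess_symm hcomm f]
  have e5 : ∑ l, V l * ∑ i, m.d i (S l i) + ∑ l, V l * ∑ i, ∑ k, m.chr i i k * S l k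
      = m.gm f (m.lap f) + ∑ l, V l * (∑ i, ∑ k, m.chr i l k * S i k)
        + ∑ l, V l * ∑ k, m.ric k l * V k := by
    rw [gm_eq, ← sum_add_distrib, ← sum_add_distrib, ← sum_add_distrib]
    refine sum_congr rfl fun l _ => ?_
    rw [← mul_add, hR]; ring
  rw [lap_eq_div]
  simp only [hn]
  rw [e0, e1, e4, ← e2, ← e3]
  linear_combination 2 * e5

end Comm

/-! ### Evolution equations under the Ricci flow. -/

section Flow

variable (hcomm : ∀ i j a, m.d i (m.d j a) = m.d j (m.d i a)) (τ : Derivation ℝ A A)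
  (hτ : ∀ i a, τ (m.d i a) = m.d i (τ a)) (hflow : ∀ i j, τ (m.G i j) = -2 * m.ric i j)

theorem two_mul_derivation (D : Derivation ℝ A A) (a : A) : D (2 * a) = 2 * D a := by
  rw [two_mul, two_mul, map_add]

include hflow in
theorem map_G_flow : m.G.map τ = -2 * of m.ric := by
  ext i j
  rw [map_apply, hflow]
  rw [neg_mul, neg_mul, two_mul, two_mul]; rfl

include hflow in
theorem flow_H (i j : ι) : τ (m.H i j) = 2 * ∑ k, m.H i k * ∑ l, m.ric k l * m.H l j := by
  have h := congrFun (congrFun (m.map_H τ) i) j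
  rw [m.map_G_flow τ hflow] at h
  have h2 : -(m.H * (-2 * of m.ric) * m.H) = m.H * m.ricUp + m.H * m.ricUp := by
    rw [ricUp]; noncomm_ring
  rw [h2] at h
  change τ (m.H i j) = (m.H * m.ricUp) i j + (m.H * m.ricUp) i j at h
  rw [h, ← two_mul]
  rfl

include hflow in
theorem sum_flow_H_mul (T : ι → ι → A) :
    ∑ i, ∑ j, τ (m.H i j) * T i j = 2 * m.ip m.ric T := by
  simp only [m.flow_H τ hflow, ip, mul_sum, sum_mul]
  rw [sum_comm_cycle]
  refine sum_congr rfl fun k _ => ?_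
  rw [sum_comm_cycle]
  refine sum_congr rfl fun l _ => sum_congr rfl fun i _ => sum_congr rfl fun j _ => ?_
  rw [m.H_apply_symm i k]; ring

include hcomm hflow hτ in
/-- The trace of the variation of the Christoffel symbols vanishes. -/
theorem sum_H_flow_chr (k : ι) : ∑ i, ∑ j, m.H i j * τ (m.chr k i j) = 0 := by
  -- With its upper index lowered, the variation of Γ is -(∇_i R_jl + ∇_j R_il - ∇_l R_ij). Its
  -- trace is dR - 2 div Ric, which vanishes by the contracted Bianchi identity `d_scal`.
  have hlow : ∀ l, ∑ k, m.G l k * ∑ i, ∑ j, m.H i j * τ (m.chr k i j) = 0 := by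
    intro l
    have h1 : ∀ i j, ∑ k, m.G l k * τ (m.chr k i j)
        = 2 * ∑ k, m.ric l k * m.chr k i j
          - (m.d i (m.ric j l) + m.d j (m.ric i l) - m.d l (m.ric i j)) := by
      intro i j
      have h := congrArg τ (m.G_mul_conn_apply i l j)
      rw [mul_apply, map_sum, τ.map_smul, half_smul _
        (-(m.d i (m.ric j l) + m.d j (m.ric i l) - m.d l (m.ric i j)))] at h
      · simp only [Derivation.leibniz, smul_eq_mul, conn_apply, sum_add_distrib, hflow] at h
        have h2 : ∑ x, m.chr x i j * (-2 * m.ric l x) = -2 * ∑ k, m.ric l k * m.chr k i j := by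
          rw [mul_sum]
          exact sum_congr rfl fun _ _ => by ring
        rw [h2] at h
        linear_combination h
      · simp only [map_add, map_sub, hτ, hflow, neg_mul, map_neg, two_mul_derivation]
        ring
    have h2 : ∑ i, ∑ j, m.H i j * m.d i (m.ric j l) = ∑ i, m.d i (m.ricUp l i)
        + ∑ i, ∑ k, m.chr i i k * m.ricUp l k
        + ∑ i, ∑ j, m.H i j * ∑ k, m.ric l k * m.chr k i j := by
      rw [← sum_add_distrib, ← sum_add_distrib]
      refine sum_congr rfl fun i _ => ?_
      have e1 : ∑ j, m.H i j * ∑ k, m.ric l k * m.chr k i j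
          = ∑ j, m.ric l j * ∑ k, m.chr j i k * m.H k i := by
        simp only [mul_sum]
        rw [sum_comm]
        refine sum_congr rfl fun _ _ => sum_congr rfl fun a _ => ?_
        rw [m.H_apply_symm a i]; ring
      have e2 : ∑ k, m.chr i i k * m.ricUp l k
          = ∑ j, m.ric l j * ∑ k, m.H j k * m.chr i i k := by
        simp only [ricUp, mul_apply, of_apply, mul_sum]
        rw [sum_comm]
        exact sum_congr rfl fun _ _ => sum_congr rfl fun _ _ => by ring
      rw [e1, e2]
      simp only [ricUp, mul_apply, of_apply, map_sum, Derivation.leibniz, smul_eq_mul, d_H]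
      rw [← sum_add_distrib, ← sum_add_distrib]
      refine sum_congr rfl fun j _ => ?_
      rw [m.H_apply_symm j i, m.ric_symm hcomm j l]; ring
    have h3 : ∑ i, ∑ j, m.H i j * m.d l (m.ric i j) = m.d l m.scal
        + 2 * ∑ i, ∑ k, m.chr i l k * m.ricUp i k := by
      have e1 : ∑ i, ∑ k, m.chr i l k * m.ricUp i k
          = ∑ i, ∑ j, m.ric i j * ∑ k, m.chr i l k * m.H k j := by
        simp only [ricUp, mul_apply, of_apply, mul_sum]
        refine sum_congr rfl fun _ _ => ?_
        rw [sum_comm]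
        refine sum_congr rfl fun a _ => sum_congr rfl fun b _ => ?_
        rw [m.H_apply_symm a b]; ring
      have e2 : ∑ i, ∑ k, m.chr i l k * m.ricUp i k
          = ∑ i, ∑ j, m.ric i j * ∑ k, m.H i k * m.chr j l k := by
        rw [e1, sum_comm]
        refine sum_congr rfl fun i _ => sum_congr rfl fun j _ => ?_
        rw [m.ric_symm hcomm i j]
        congr 1
        exact sum_congr rfl fun k _ => by rw [m.H_apply_symm k i]; ring
      rw [two_mul]
      nth_rewrite 1 [e1]
      rw [e2]
      simp only [scal, tr, map_sum, Derivation.leibniz, smul_eq_mul, d_H]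
      rw [← sum_add_distrib, ← sum_add_distrib]
      refine sum_congr rfl fun i _ => ?_
      rw [← sum_add_distrib, ← sum_add_distrib]
      exact sum_congr rfl fun j _ => by ring
    have h4 : ∑ i, ∑ j, m.H i j * m.d j (m.ric i l) = ∑ i, ∑ j, m.H i j * m.d i (m.ric j l) := by
      rw [sum_comm]
      exact sum_congr rfl fun _ _ => sum_congr rfl fun _ _ => by rw [H_apply_symm]
    have h5 : ∑ k, m.G l k * ∑ i, ∑ j, m.H i j * τ (m.chr k i j)
        = ∑ i, ∑ j, m.H i j * ∑ k, m.G l k * τ (m.chr k i j) := by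
      simp only [mul_sum]
      rw [← sum_comm_cycle]
      exact sum_congr rfl fun _ _ => sum_congr rfl fun _ _ => sum_congr rfl fun _ _ => by ring
    rw [h5]
    simp only [h1, mul_sub, mul_add, sum_sub_distrib, sum_add_distrib]
    rw [h4, h3, h2, d_scal _ hcomm]
    have h6 : ∑ i, ∑ j, m.H i j * (2 * ∑ k, m.ric l k * m.chr k i j)
        = 2 * ∑ i, ∑ j, m.H i j * ∑ k, m.ric l k * m.chr k i j := by
      simp only [mul_sum]
      exact sum_congr rfl fun _ _ => sum_congr rfl fun _ _ => sum_congr rfl fun _ _ => by ring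
    rw [h6]
    ring
  have hG : m.G *ᵥ (fun a => ∑ i, ∑ j, m.H i j * τ (m.chr a i j)) = 0 := funext hlow
  have hH := congrArg (m.H *ᵥ ·) hG
  simp only [mulVec_mulVec, m.mul_eq_one', one_mulVec, mulVec_zero] at hH
  exact congrFun hH k

/-- The trace of metric compatibility. The right side is the logarithmic derivative of det G, which
links the Christoffel symbols to the volume density. -/
theorem two_smul_sum_chr (i : ι) :
    ∑ k, m.chr k i k + ∑ k, m.chr k i k = trace (m.H * m.G.map (m.d i)) := by
  rw [map_d_G, mul_add, trace_add, ← Matrix.mul_assoc, m.mul_eq_one', one_mul,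
    trace_mul_comm m.H, Matrix.mul_assoc, m.mul_eq_one, mul_one, trace_transpose]
  rfl

-- Both sides represent the mixed derivative of log det G, which need not exist in A. The terms
-- coming from the derivative of the inverse agree by cyclicity of the trace.
include hτ in
theorem flow_trace_comm (i : ι) :
    τ (trace (m.H * m.G.map (m.d i))) = m.d i (trace (m.H * m.G.map τ)) := by
  have h1 : ∀ (D : Derivation ℝ A A) (M : Matrix ι ι A), D (trace M) = trace (M.map D) := by
    intro D M
    simp [trace]
  have h2 : (m.G.map (m.d i)).map τ = (m.G.map τ).map (m.d i) := by
    ext a b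
    exact hτ i _
  rw [h1, h1, map_mul_derivation, map_mul_derivation, h2, trace_add, trace_add, m.map_H τ,
    m.map_H (m.d i)]
  congr 1
  rw [neg_mul, neg_mul, trace_neg, trace_neg, Matrix.mul_assoc, trace_mul_comm,
    ← Matrix.mul_assoc]

include hflow in
theorem trace_H_mul_flow : trace (m.H * m.G.map τ) = -2 * m.scal := by
  rw [m.map_G_flow τ hflow, ← trace_ricUp]
  have : m.H * (-2 * of m.ric) = -(m.H * of m.ric + m.H * of m.ric) := by noncomm_ring
  rw [this, trace_neg, trace_add, trace_mul_comm]
  change -(∑ k, m.ricUp k k + ∑ k, m.ricUp k k) = _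
  ring

-- Uses `flow_trace_comm`: the spatial derivative of tr(G⁻¹ τG) = -2R equals twice the variation of
-- Γ^k_ik.
include hτ hflow in
theorem flow_sum_chr (i : ι) : ∑ k, τ (m.chr k i k) = -m.d i m.scal := by
  have h := m.flow_trace_comm τ hτ i
  rw [← two_smul_sum_chr, m.trace_H_mul_flow τ hflow, map_add, neg_mul, map_neg,
    two_mul_derivation, map_sum] at h
  have : (∑ k, τ (m.chr k i k) + m.d i m.scal) + (∑ k, τ (m.chr k i k) + m.d i m.scal) = 0 := by
    linear_combination h
  exact eq_neg_of_add_eq_zero_left (eq_zero_of_add_self this)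

include hcomm hτ hflow in
/-- The variation of the Laplacian under the Ricci flow. -/
theorem flow_lap (f : A) : τ (m.lap f) = m.lap (τ f) + 2 * m.ip m.ric (m.hess f) := by
  have h1 : ∀ i j, τ (m.hess f i j) = m.hess (τ f) i j - ∑ k, τ (m.chr k i j) * m.d k f := by
    intro i j
    simp only [hess, map_sub, map_sum, Derivation.leibniz, hτ, smul_eq_mul, sum_add_distrib]
    rw [sub_sub]
    congr 2
    exact sum_congr rfl fun _ _ => mul_comm _ _
  -- The contribution of the varying connection is a pairing of df with the trace from
  -- `sum_H_flow_chr`, hence zero; only the variation of the inverse metric survives.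
  have h2 : ∑ i, ∑ j, m.H i j * ∑ k, τ (m.chr k i j) * m.d k f = 0 := by
    have : ∀ k, (∑ i, ∑ j, m.H i j * τ (m.chr k i j)) * m.d k f = 0 := fun k => by
      rw [m.sum_H_flow_chr hcomm τ hτ hflow, zero_mul]
    rw [← sum_eq_zero (s := univ) fun k _ => this k]
    simp only [mul_sum, sum_mul]
    rw [sum_comm_cycle]
    exact sum_congr rfl fun _ _ => sum_congr rfl fun _ _ => sum_congr rfl fun _ _ => by ring
  rw [← m.sum_flow_H_mul τ hflow]
  simp only [lap, tr, map_sum, Derivation.leibniz, smul_eq_mul, h1, mul_sub, sum_add_distrib,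
    sum_sub_distrib, h2, sub_zero]
  congr 1
  exact sum_congr rfl fun _ _ => sum_congr rfl fun _ _ => mul_comm _ _

include hcomm hτ hflow in
/-- The evolution of the scalar curvature under the Ricci flow. -/
theorem flow_scal : τ m.scal = m.lap m.scal + 2 * m.ip m.ric m.ric := by
  set X : ι → Matrix ι ι A := fun j => (m.conn j).map τ * m.H with hX
  -- The variation of curvature is the antisymmetrized covariant derivative of the variation X of
  -- the connection. The last two terms come from varying the inverse metric that raises the index.
  have hc : ∀ k j, (m.curv k j * m.H).map τ = (X j).map (m.d k) + m.conn k * X j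
      + X j * (m.conn k)ᵀ - ((X k).map (m.d j) + m.conn j * X k + X k * (m.conn j)ᵀ)
      + (m.curv k j * m.H * m.ricUp + m.curv k j * m.H * m.ricUp) := by
    intro k j
    have hswap : ∀ k j, ((m.conn j).map (m.d k)).map τ = ((m.conn j).map τ).map (m.d k) := by
      intro k j
      ext a b
      exact hτ k _
    have hH : m.H.map τ = m.H * m.ricUp + m.H * m.ricUp := by
      rw [map_H, m.map_G_flow τ hflow, ricUp]; noncomm_ring
    rw [hX]
    simp only [← covariant_mul_H]
    rw [map_mul_derivation, hH, curv]
    simp only [map_sub_derivation, map_add_derivation, map_mul_derivation, hswap]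
    noncomm_ring
  -- The two possible traces of X: one vanishes, the other (`hz`) is -∇R. The divergence of the
  -- second yields the Laplacian of R, and the inverse-metric terms yield 2|Ric|².
  have hw : ∀ k, ∑ j, X j k j = 0 := by
    intro k
    rw [← m.sum_H_flow_chr hcomm τ hτ hflow k]
    refine sum_congr rfl fun i _ => ?_
    simp only [hX, mul_apply, map_apply, conn_apply]
    exact sum_congr rfl fun j _ => by rw [m.H_apply_symm j i, mul_comm]
  have hz : ∀ l, ∑ k, X k k l = -m.nab m.scal l := by
    intro l
    simp only [hX, mul_apply, map_apply, conn_apply, nab]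
    rw [sum_comm, ← sum_neg_distrib]
    refine sum_congr rfl fun j _ => ?_
    rw [← sum_mul, m.H_apply_symm l j, ← neg_eq_iff_eq_neg.mpr (m.flow_sum_chr τ hτ hflow j)]
    simp only [m.chr_symm _ j]
    ring
  have hs : m.scal = ∑ k, ∑ j, (m.curv k j * m.H) k j := by
    rw [← trace_ricUp, sum_comm]
    exact sum_congr rfl fun k _ => (m.sum_curv_mul_H hcomm k k).symm
  have e1 : ∑ k, ∑ j, m.d k (X j k j) = 0 :=
    sum_eq_zero fun k _ => by rw [← map_sum, hw, map_zero]
  have e2 : ∑ k, ∑ j, ∑ l, m.chr k k l * X j l j = 0 := by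
    refine sum_eq_zero fun k _ => ?_
    rw [sum_comm]
    exact sum_eq_zero fun l _ => by rw [← mul_sum, hw, mul_zero]
  have e3 : ∑ k, ∑ j, ∑ l, X j k l * m.chr j k l = ∑ k, ∑ j, ∑ l, m.chr k j l * X k l j := by
    rw [sum_comm]
    refine sum_congr rfl fun j _ => ?_
    rw [sum_comm]
    refine sum_congr rfl fun k _ => sum_congr rfl fun l _ => ?_
    rw [m.chr_symm j k l, mul_comm]
  have e4 : ∑ k, ∑ j, m.d j (X k k j) = -∑ j, m.d j (m.nab m.scal j) := by
    rw [sum_comm, ← sum_neg_distrib]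
    exact sum_congr rfl fun k _ => by rw [← map_sum, hz, map_neg]
  have e5 : ∑ k, ∑ j, ∑ l, X k k l * m.chr j j l
      = -∑ i, ∑ j, m.chr i i j * m.nab m.scal j := by
    rw [sum_comm, ← sum_neg_distrib]
    refine sum_congr rfl fun k _ => ?_
    rw [sum_comm, ← sum_neg_distrib]
    exact sum_congr rfl fun l _ => by rw [← sum_mul, hz]; ring
  have e6 : ∑ k, ∑ j, ∑ l, (m.curv k j * m.H) k l * m.ricUp l j = m.ip m.ric m.ric := by
    rw [ip_eq, sum_comm]
    refine sum_congr rfl fun j _ => ?_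
    rw [sum_comm]
    refine sum_congr rfl fun l _ => ?_
    rw [← sum_mul, m.sum_curv_mul_H hcomm]
    simp only [ricUp, mul_apply, of_apply]
    congr 1
    · exact sum_congr rfl fun i _ => by rw [m.ric_symm hcomm i j, m.H_apply_symm l i, mul_comm]
    · exact sum_congr rfl fun i _ => by rw [m.H_apply_symm j i, mul_comm]
  have hsum : τ m.scal = ∑ k, ∑ j, ((m.curv k j * m.H).map τ) k j := by
    conv_lhs => rw [hs]
    simp only [map_sum, map_apply]
  rw [hsum, lap_eq_div]
  simp only [hc]
  simp only [Matrix.add_apply, Matrix.sub_apply, map_apply, mul_apply, conn_apply,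
    transpose_apply, sum_add_distrib, sum_sub_distrib]
  simp only [mul_apply] at e6
  rw [e1, e2, e3, e4, e5, e6]
  ring

theorem lap_add (u v : A) : m.lap (u + v) = m.lap u + m.lap v := by
  have : m.hess (u + v) = fun i j => m.hess u i j + m.hess v i j := by
    ext i j
    simp only [hess, map_add, mul_add, sum_add_distrib]
    ring
  rw [lap, this, tr_add]; rfl

theorem lap_smul (c : ℝ) (u : A) : m.lap (c • u) = c • m.lap u := by
  simp only [lap, tr, hess, Derivation.map_smul, mul_smul_comm, ← smul_sum, ← smul_sub]

theorem gm_add_left (u v f : A) : m.gm (u + v) f = m.gm u f + m.gm v f := by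
  simp only [gm, map_add, mul_add, add_mul, sum_add_distrib]

theorem gm_smul_left (c : ℝ) (u f : A) : m.gm (c • u) f = c • m.gm u f := by
  simp only [gm, Derivation.map_smul, mul_smul_comm, smul_mul_assoc, ← smul_sum]

theorem gm_sub_left (u v f : A) : m.gm (u - v) f = m.gm u f - m.gm v f := by
  simp only [gm, map_sub, mul_sub, sub_mul, sum_sub_distrib]

theorem ip_symm (S T : ι → ι → A) : m.ip S T = m.ip T S := by
  unfold ip
  rw [sum_comm_cycle]
  refine sum_congr rfl fun k _ => ?_
  rw [sum_comm_cycle]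
  refine sum_congr rfl fun l _ => sum_congr rfl fun i _ => sum_congr rfl fun j _ => ?_
  rw [m.H_apply_symm i k, m.H_apply_symm j l]; ring

theorem ip_sub_self (S T : ι → ι → A) :
    m.ip (fun i j => S i j - T i j) (fun i j => S i j - T i j)
      = m.ip S S - 2 * m.ip S T + m.ip T T := by
  have : m.ip (fun i j => S i j - T i j) (fun i j => S i j - T i j)
      = m.ip S S - m.ip S T - m.ip T S + m.ip T T := by
    simp only [ip, mul_sub, sub_mul, sum_sub_distrib]
    ring
  rw [this, m.ip_symm T S]; ring

include hcomm hτ hflow in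
/-- The second variation identity for the entropy. -/
theorem flow_scal_sub_lap (f : A)
    (hf : τ f = -(1 / 2 : ℝ) • m.gm f f + (1 / 2 : ℝ) • m.scal) :
    τ (m.scal - m.lap f) + m.gm (m.scal - m.lap f) f
      = m.ip (fun i j => m.ric i j - m.hess f i j) (fun i j => m.ric i j - m.hess f i j)
        + ((1 / 2 : ℝ) • τ m.scal + m.gm m.scal f
          + ∑ k, ∑ l, m.ric k l * m.nab f k * m.nab f l) := by
  -- One half of R_t stays in the Harnack expression; the other half absorbs ΔR/2 from Δ(f_t) and
  -- leaves |Ric|², which completes the square with the terms from `flow_lap` and Bochner.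
  have h1 : (1 / 2 : ℝ) • τ m.scal = (1 / 2 : ℝ) • m.lap m.scal + m.ip m.ric m.ric := by
    rw [m.flow_scal hcomm τ hτ hflow, smul_add]
    congr 1
    exact half_smul _ _ (two_mul _)
  have h2 := half_smul_add_self (τ m.scal)
  have h3 : (1 / 2 : ℝ) • m.lap (m.gm f f) = m.gm f (m.lap f) + m.ip (m.hess f) (m.hess f)
    + ∑ k, ∑ l, m.ric k l * m.nab f k * m.nab f l :=
    half_smul _ _ (by rw [m.bochner hcomm, two_mul])
  rw [map_sub, m.flow_lap hcomm τ hτ hflow, hf, lap_add, neg_smul, ← smul_neg, lap_smul,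
    lap_smul, ip_sub_self, gm_sub_left, m.gm_symm (m.lap f)]
  have h4 : m.lap (-m.gm f f) = -m.lap (m.gm f f) := by
    rw [← neg_one_smul ℝ, lap_smul, neg_one_smul]
  rw [h4, smul_neg, h3]
  linear_combination h1 - h2

include hτ hflow in
/-- The variation of the energy density. -/
theorem flow_energy (f : A)
    (hf : τ f = -(1 / 2 : ℝ) • m.gm f f + (1 / 2 : ℝ) • m.scal) :
    (1 / 2 : ℝ) • (τ (m.gm f f + m.scal) + m.gm (m.gm f f + m.scal) f)
      = (1 / 2 : ℝ) • τ m.scal + m.gm m.scal f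
          + ∑ k, ∑ l, m.ric k l * m.nab f k * m.nab f l := by
  have h1 : ∑ i, ∑ j, τ (m.H i j) * (m.d i f * m.d j f)
      = 2 * ∑ k, ∑ l, m.ric k l * m.nab f k * m.nab f l := by
    rw [m.sum_flow_H_mul τ hflow, ip]
    congr 1
    refine sum_congr rfl fun i _ => sum_congr rfl fun j _ => ?_
    rw [nab, nab, mul_assoc, sum_mul_sum, mul_sum]
    refine sum_congr rfl fun k _ => ?_
    rw [mul_sum]
    exact sum_congr rfl fun l _ => by ring
  -- After inserting the Hamilton–Jacobi equation, the term -⟨∇|∇f|², ∇f⟩ hidden in 2⟨∇(τ f), ∇f⟩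
  -- cancels the transport of |∇f|².
  have h2 : τ (m.gm f f) = 2 * (∑ k, ∑ l, m.ric k l * m.nab f k * m.nab f l)
      + 2 * m.gm (τ f) f := by
    rw [← h1, two_mul]
    nth_rewrite 2 [gm_symm]
    simp only [gm, map_sum, Derivation.leibniz, smul_eq_mul, hτ, ← sum_add_distrib]
    exact sum_congr rfl fun _ _ => sum_congr rfl fun _ _ => by ring
  rw [map_add, h2, hf, gm_add_left, gm_add_left, gm_smul_left, gm_smul_left, neg_smul]
  have h3 := half_smul_add_self (m.gm (m.gm f f) f)
  have h4 := half_smul_add_self (m.gm m.scal f)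
  rw [smul_add, smul_add, smul_add]
  have h5 : (1 / 2 : ℝ) • (2 * (∑ k, ∑ l, m.ric k l * m.nab f k * m.nab f l))
    = ∑ k, ∑ l, m.ric k l * m.nab f k * m.nab f l := half_smul _ _ (two_mul _)
  have h6 : ∀ a : A, (1 / 2 : ℝ) • (2 * a) = a := fun a => half_smul _ _ (two_mul _)
  rw [h6, h6, smul_add]
  linear_combination h4

end Flow
end CoordMetric
end RicciTransport

/-! ### Invariance under changes of coordinates and algebra homomorphisms. -/

namespace RicciTransport
namespace CoordMetric

open Matrix Finset

set_option linter.unusedSectionVars false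

variable {ι A : Type*} [Fintype ι] [DecidableEq ι] [CommRing A] [Algebra ℝ A]

/-- A change of coordinates, with Jacobian matrix `J`, from the frame of `m` to that of `m'`. -/
structure IsCoordChange (m m' : CoordMetric ι A) (J K : Matrix ι ι A) : Prop where
  comm : ∀ i j a, m.d i (m.d j a) = m.d j (m.d i a)
  inv : J * K = 1
  d_eq : ∀ i a, m.d i a = ∑ p, J p i * m'.d p a
  G_eq : m.G = Jᵀ * m'.G * J
  closed : ∀ i j p, m.d i (J p j) = m.d j (J p i)

namespace IsCoordChange

variable {m m' : CoordMetric ι A} {J K : Matrix ι ι A} (h : IsCoordChange m m' J K)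
include h

theorem inv' : K * J = 1 := mul_eq_one_comm.mp h.inv

theorem H_eq : m.H = K * m'.H * Kᵀ := by
  have h1 : m.G * (K * m'.H * Kᵀ) = 1 := by
    rw [h.G_eq]
    calc Jᵀ * m'.G * J * (K * m'.H * Kᵀ) = Jᵀ * m'.G * (J * K) * m'.H * Kᵀ := by noncomm_ring
      _ = Jᵀ * (m'.G * m'.H) * Kᵀ := by rw [h.inv]; noncomm_ring
      _ = (K * J)ᵀ := by rw [m'.mul_eq_one, transpose_mul, mul_one]
      _ = 1 := by rw [h.inv', transpose_one]
  calc m.H = m.H * (m.G * (K * m'.H * Kᵀ)) := by rw [h1, mul_one]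
    _ = _ := by rw [← Matrix.mul_assoc, m.mul_eq_one', one_mul]

theorem map_d (i : ι) (M : Matrix ι ι A) : M.map (m.d i) = ∑ p, J p i • M.map (m'.d p) := by
  ext a b
  rw [map_apply, h.d_eq, Matrix.sum_apply]
  rfl

/-- Multiplied by K, the right side is torsion-free, by `closed`, and preserves the metric. The
uniqueness result `eq_conn_of_compat` then applies, so the Christoffel formula itself is never
transformed. -/
theorem conn_eq (i : ι) :
    J * m.conn i = (∑ p, J p i • m'.conn p) * J + J.map (m.d i) := by
  set C : ι → Matrix ι ι A := fun i => K * ((∑ p, J p i • m'.conn p) * J + J.map (m.d i)) with hC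
  have hJC : ∀ i, J * C i = (∑ p, J p i • m'.conn p) * J + J.map (m.d i) := fun i => by
    rw [hC, ← Matrix.mul_assoc, h.inv, one_mul]
  have hs' : ∀ k i j, (J * C i) k j = (J * C j) k i := by
    intro k i j
    rw [hJC, hJC, Matrix.add_apply, Matrix.add_apply, map_apply, map_apply, h.closed]
    congr 1
    simp only [mul_apply, Matrix.sum_apply, Matrix.smul_apply, smul_eq_mul, sum_mul, conn_apply]
    rw [sum_comm]
    exact sum_congr rfl fun _ _ => sum_congr rfl fun _ _ => by rw [m'.chr_symm]; ring
  have hs : ∀ k i j, C i k j = C j k i := by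
    intro k i j
    have : ∀ i, C i = K * (J * C i) := fun i => by rw [← Matrix.mul_assoc, h.inv', one_mul]
    rw [this i, this j, mul_apply, mul_apply]
    exact sum_congr rfl fun _ _ => by rw [hs']
  have hG : ∀ i, m.G.map (m.d i) = m.G * C i + (C i)ᵀ * m.G := by
    intro i
    have h1 : m.G * C i = Jᵀ * m'.G * ((∑ p, J p i • m'.conn p) * J + J.map (m.d i)) := by
      rw [h.G_eq, Matrix.mul_assoc _ J, hJC]
    have h2 : (C i)ᵀ * m.G = (m.G * C i)ᵀ := by rw [transpose_mul m.G, m.G_symm]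
    have h3 : m'.G.map (m.d i) = m'.G * (∑ p, J p i • m'.conn p)
        + (∑ p, J p i • m'.conn p)ᵀ * m'.G := by
      rw [h.map_d]
      simp only [map_d_G, smul_add, sum_add_distrib, Matrix.mul_sum, transpose_sum,
        transpose_smul, Matrix.sum_mul, Matrix.mul_smul, Matrix.smul_mul]
    rw [h2, h1, h.G_eq, map_mul_derivation, map_mul_derivation, h3, transpose_mul, transpose_mul,
      transpose_add, transpose_mul, m'.G_symm, map_transpose_derivation, transpose_transpose]
    noncomm_ring
  rw [m.eq_conn_of_compat C hs hG, hJC]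

/-- The gauge transformation law: with B the pulled-back connection, the inhomogeneous dJ terms
cancel because the derivations commute on J. -/
theorem curv_eq (i j : ι) :
    J * m.curv i j = (∑ q, ∑ p, (J q i * J p j) • m'.curv q p) * J := by
  set B : ι → Matrix ι ι A := fun i => ∑ p, J p i • m'.conn p with hB
  have hJ : ∀ i, J * m.conn i = B i * J + J.map (m.d i) := h.conn_eq
  have hJd : ∀ i j, J * (m.conn j).map (m.d i) = (B j).map (m.d i) * J + B j * J.map (m.d i)
      + (J.map (m.d j)).map (m.d i) - J.map (m.d i) * m.conn j := by
    intro i j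
    have := congrArg (fun M => M.map (m.d i)) (hJ j)
    simp only [map_mul_derivation, map_add_derivation] at this
    rw [eq_sub_iff_add_eq, ← this, add_comm]
  have hBB : ∀ i j, J * m.conn i * m.conn j
      = B i * (B j * J + J.map (m.d j)) + J.map (m.d i) * m.conn j := by
    intro i j
    rw [hJ, add_mul, Matrix.mul_assoc, hJ]
  have h1 : J * m.curv i j
      = ((B j).map (m.d i) - (B i).map (m.d j) + B i * B j - B j * B i) * J := by
    rw [curv, mul_sub, mul_add, mul_sub, hJd, hJd, ← Matrix.mul_assoc, ← Matrix.mul_assoc, hBB,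
      hBB, m.map_d_comm h.comm i j J]
    noncomm_ring
  have h2 : ∀ i j, (B j).map (m.d i) = ∑ p, m.d i (J p j) • m'.conn p
      + ∑ q, ∑ p, (J q i * J p j) • (m'.conn p).map (m'.d q) := by
    intro i j
    ext a b
    simp only [hB, map_apply, Matrix.add_apply, Matrix.sum_apply, Matrix.smul_apply, smul_eq_mul,
      map_sum, Derivation.leibniz, sum_add_distrib]
    rw [add_comm]
    congr 1
    · exact sum_congr rfl fun _ _ => mul_comm _ _
    · rw [sum_comm]
      refine sum_congr rfl fun p _ => ?_
      rw [h.d_eq, mul_sum]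
      exact sum_congr rfl fun _ _ => by ring
  have h3 : ∀ i j, B i * B j = ∑ q, ∑ p, (J q i * J p j) • (m'.conn q * m'.conn p) := by
    intro i j
    simp only [hB, Matrix.sum_mul, Matrix.mul_sum, Matrix.smul_mul, Matrix.mul_smul, smul_sum,
      smul_smul]
    rw [sum_comm]
    exact sum_congr rfl fun _ _ => sum_congr rfl fun _ _ => by rw [mul_comm (J _ i)]
  rw [h1, h2, h2, h3, h3]
  congr 1
  -- The derivatives of the coefficients J in B cancel on antisymmetrization, because the columns of
  -- J are derivatives of the same coordinate functions.
  have h4 : ∑ p, m.d j (J p i) • m'.conn p = ∑ p, m.d i (J p j) • m'.conn p :=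
    sum_congr rfl fun p _ => by rw [h.closed]
  rw [h4, sum_comm (f := fun q p => (J q j * J p i) • (m'.conn p).map (m'.d q)),
    sum_comm (f := fun q p => (J q j * J p i) • (m'.conn q * m'.conn p))]
  simp only [curv, smul_sub, smul_add, sum_add_distrib, sum_sub_distrib, mul_comm (J _ j)]
  abel

/-- The derivative of J in the second derivatives of f cancels the inhomogeneous term of `conn_eq`.
-/
theorem hess_eq (f : A) : of (m.hess f) = Jᵀ * of (m'.hess f) * J := by
  ext i j
  have h1 := fun a => congrFun (congrFun (h.conn_eq i) a) j
  have h2 : ∑ k, m.chr k i j * m.d k f = ∑ a, (J * m.conn i) a j * m'.d a f := by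
    simp only [h.d_eq, mul_apply, conn_apply, mul_sum, sum_mul]
    rw [sum_comm]
    exact sum_congr rfl fun _ _ => sum_congr rfl fun _ _ => by ring
  rw [of_apply, hess, h2, h.d_eq j, map_sum]
  simp only [h1, Derivation.leibniz, smul_eq_mul, Matrix.add_apply, map_apply, add_mul,
    sum_add_distrib]
  have h3 : ∑ x, J x j * m.d i (m'.d x f) = ∑ p, ∑ q, J q i * J p j * m'.d q (m'.d p f) := by
    refine sum_congr rfl fun p _ => ?_
    rw [h.d_eq i, mul_sum]
    exact sum_congr rfl fun _ _ => by ring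
  have h4 : ∑ x, m'.d x f * m.d i (J x j) = ∑ x, m.d i (J x j) * m'.d x f :=
    sum_congr rfl fun _ _ => mul_comm _ _
  have h5 : ∑ x, ((∑ p, J p i • m'.conn p) * J) x j * m'.d x f
      = ∑ p, ∑ q, J q i * J p j * ∑ k, m'.chr k q p * m'.d k f := by
    simp only [mul_apply, Matrix.sum_apply, Matrix.smul_apply, smul_eq_mul, conn_apply, sum_mul,
      mul_sum]
    rw [← sum_comm_cycle]
    exact sum_congr rfl fun _ _ => sum_congr rfl fun _ _ => sum_congr rfl fun _ _ => by ring
  rw [h3, h4, h5]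
  simp only [mul_apply, transpose_apply, of_apply, sum_mul, hess, mul_sub, sub_mul,
    sum_sub_distrib, mul_right_comm _ _ (J _ j)]
  ring

/-- In the trace defining Ricci, the factor J of the form index meets the factor K of the upper
index, leaving J only on the two free indices. -/
theorem ric_eq : of m.ric = Jᵀ * of m'.ric * J := by
  set N : ι → ι → Matrix ι ι A := fun j q => (∑ p, J p j • m'.curv q p) * J with hN
  have hK : ∀ k j, m.curv k j = ∑ q, J q k • (K * N j q) := by
    intro k j
    have h1 : J * m.curv k j = ∑ q, J q k • N j q := by
      rw [h.curv_eq]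
      simp only [hN, Matrix.sum_mul, Matrix.smul_mul, smul_sum, smul_smul]
    calc m.curv k j = K * (J * m.curv k j) := by rw [← Matrix.mul_assoc, h.inv', one_mul]
      _ = _ := by rw [h1]; simp only [Matrix.mul_sum, Matrix.mul_smul]
  ext i j
  have h1 : ∀ q a, ∑ k, J q k * K k a = if q = a then 1 else 0 := by
    intro q a
    rw [← mul_apply, h.inv, one_apply]
  have h2 : ∑ k, m.curv k j k i = ∑ q, ∑ a, (∑ k, J q k * K k a) * N j q a i := by
    simp only [hK, Matrix.sum_apply, Matrix.smul_apply, smul_eq_mul, sum_mul]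
    rw [sum_comm]
    refine sum_congr rfl fun q _ => ?_
    simp only [mul_apply (N := N j q), mul_sum]
    rw [sum_comm]
    exact sum_congr rfl fun _ _ => sum_congr rfl fun _ _ => by ring
  rw [of_apply, ric_eq_sum_curv, h2]
  simp only [h1, ite_mul, one_mul, zero_mul, sum_ite_eq, mem_univ, if_true]
  simp only [hN, mul_apply, Matrix.sum_apply, Matrix.smul_apply, smul_eq_mul, transpose_apply,
    of_apply, ric_eq_sum_curv, sum_mul, mul_sum]
  rw [sum_comm]
  refine sum_congr rfl fun _ _ => ?_
  rw [sum_comm]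
  exact sum_congr rfl fun _ _ => sum_congr rfl fun _ _ => by ring

theorem tr_eq {T T' : ι → ι → A} (hT : of T = Jᵀ * of T' * J) : m.tr T = m'.tr T' := by
  have h1 : ∀ (m : CoordMetric ι A) (T : ι → ι → A), m.tr T = trace (m.H * (of T)ᵀ) := by
    intro m T
    rfl
  rw [h1, h1, hT, h.H_eq]
  simp only [transpose_mul, transpose_transpose]
  calc trace (K * m'.H * Kᵀ * (Jᵀ * ((of T')ᵀ * J)))
      = trace (K * (m'.H * (J * K)ᵀ * (of T')ᵀ * J)) := by
        rw [transpose_mul]; congr 1; noncomm_ring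
    _ = _ := by
        rw [trace_mul_comm, h.inv, transpose_one, mul_one, Matrix.mul_assoc, h.inv, mul_one]

theorem scal_eq : m.scal = m'.scal := h.tr_eq h.ric_eq

theorem lap_eq (f : A) : m.lap f = m'.lap f := h.tr_eq (h.hess_eq f)

theorem gm_eq (f k : A) : m.gm f k = m'.gm f k := by
  have h1 : ∀ (m : CoordMetric ι A), m.gm f k = m.tr (fun i j => m.d i f * m.d j k) := by
    intro m
    simp only [gm, tr, mul_assoc]
  rw [h1, h1]
  apply h.tr_eq
  ext i j
  simp only [of_apply, mul_apply, transpose_apply, sum_mul, h.d_eq, mul_sum]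
  exact sum_congr rfl fun _ _ => sum_congr rfl fun _ _ => by ring

theorem nab_eq (f : A) (p : ι) : ∑ i, J p i * m.nab f i = m'.nab f p := by
  have h1 : ∀ (m : CoordMetric ι A), m.nab f = m.H *ᵥ (fun j => m.d j f) := fun m => rfl
  have h2 : (fun j => m.d j f) = Jᵀ *ᵥ (fun j => m'.d j f) := by
    ext i
    exact h.d_eq i f
  change (J *ᵥ m.nab f) p = _
  rw [h1, h1, h2, h.H_eq, mulVec_mulVec, mulVec_mulVec]
  congr 2
  calc J * (K * m'.H * Kᵀ) * Jᵀ = (J * K) * m'.H * (J * K)ᵀ := by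
        rw [transpose_mul]; noncomm_ring
    _ = _ := by rw [h.inv]; simp

end IsCoordChange

/-- `m'` is the image of `m` under the homomorphism `θ`. -/
structure IsMap {B : Type*} [CommRing B] [Algebra ℝ B] (m : CoordMetric ι A)
    (m' : CoordMetric ι B) (θ : A →ₐ[ℝ] B) : Prop where
  d_eq : ∀ i a, m'.d i (θ a) = θ (m.d i a)
  G_eq : ∀ i j, m'.G i j = θ (m.G i j)

namespace IsMap

variable {B : Type*} [CommRing B] [Algebra ℝ B] {m : CoordMetric ι A}
  {m' : CoordMetric ι B} {θ : A →ₐ[ℝ] B} (h : IsMap m m' θ)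
include h

theorem H_eq (i j : ι) : m'.H i j = θ (m.H i j) := by
  have h1 : m'.G = m.G.map θ := by
    ext i j
    exact h.G_eq i j
  have h2 : m'.G * m.H.map θ = 1 := by
    have := congrArg (fun M => M.map θ) m.mul_eq_one
    simp only [Matrix.map_mul] at this
    rw [h1, this]
    simp
  have h3 : m'.H = m.H.map θ := by
    calc m'.H = m'.H * (m'.G * m.H.map θ) := by rw [h2, mul_one]
      _ = _ := by rw [← Matrix.mul_assoc, m'.mul_eq_one', one_mul]
  rw [h3, map_apply]

theorem chr_eq (k i j : ι) : m'.chr k i j = θ (m.chr k i j) := by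
  simp only [chr, h.H_eq, h.G_eq, h.d_eq, map_smul, map_sum, map_mul, map_add, map_sub]

theorem ric_eq (i j : ι) : m'.ric i j = θ (m.ric i j) := by
  simp only [ric, h.chr_eq, h.d_eq, map_sum, map_mul, map_add, map_sub]

theorem hess_eq (f : A) (i j : ι) : m'.hess (θ f) i j = θ (m.hess f i j) := by
  simp only [hess, h.chr_eq, h.d_eq, map_sum, map_mul, map_sub]

theorem gm_eq (f k : A) : m'.gm (θ f) (θ k) = θ (m.gm f k) := by
  simp only [gm, h.H_eq, h.d_eq, map_sum, map_mul]

theorem scal_eq : m'.scal = θ m.scal := by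
  simp only [scal, tr, h.H_eq, h.ric_eq, map_sum, map_mul]

theorem lap_eq (f : A) : m'.lap (θ f) = θ (m.lap f) := by
  simp only [lap, tr, h.H_eq, h.hess_eq, map_sum, map_mul]

theorem nab_eq (f : A) (i : ι) : m'.nab (θ f) i = θ (m.nab f i) := by
  simp only [nab, h.H_eq, h.d_eq, map_sum, map_mul]

end IsMap
end CoordMetric
end RicciTransport

/-! ### The algebra of smooth functions on a time interval times an open set. -/

namespace RicciTransport

open Set

/-- A product of a time interval and an open set of `ℝⁿ`. -/
structure SpaceTime (n : ℕ) where
  /-- The time interval. -/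
  J : Set ℝ
  /-- The open set. -/
  U : Set (EuclideanSpace ℝ (Fin n))
  convex : Convex ℝ J
  nonempty : (interior J).Nonempty
  isOpen : IsOpen U

namespace SpaceTime

variable {n : ℕ} (D : SpaceTime n)

local notation "E" => EuclideanSpace ℝ (Fin n)

/-- The underlying set. -/
def S : Set (ℝ × E) := D.J ×ˢ D.U

/-- Makes the derivative within the time interval unique, including the one-sided derivative at an
endpoint. -/
theorem uniqueDiffOn_J : UniqueDiffOn ℝ D.J := uniqueDiffOn_convex D.convex D.nonempty

theorem uniqueDiffOn : UniqueDiffOn ℝ D.S := D.uniqueDiffOn_J.prod D.isOpen.uniqueDiffOn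

/-- Symmetry of second derivatives at endpoint times holds by approximation from the interior. -/
theorem subset_closure : D.S ⊆ closure (interior D.S) := by
  rintro ⟨t, y⟩ ⟨ht, hy⟩
  rw [S, interior_prod_eq, closure_prod_eq, D.isOpen.interior_eq]
  rw [D.convex.closure_interior_eq_closure_of_nonempty_interior D.nonempty]
  exact ⟨_root_.subset_closure ht, _root_.subset_closure hy⟩

/-- The extension by zero. -/
noncomputable def ext (f : D.S → ℝ) : ℝ × E → ℝ := Function.extend Subtype.val f 0

theorem ext_apply (f : D.S → ℝ) (p : D.S) : D.ext f p = f p :=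
  Subtype.val_injective.extend_apply _ _ _

theorem ext_restrict_eqOn (F : ℝ × E → ℝ) : EqOn (D.ext fun p => F p) F D.S := fun p hp =>
  D.ext_apply (fun p => F p) ⟨p, hp⟩

/-- The algebra of smooth functions. -/
def smooth : Subalgebra ℝ (D.S → ℝ) where
  carrier := {f | ContDiffOn ℝ ∞ (D.ext f) D.S}
  mul_mem' {f g} hf hg := (hf.mul hg).congr fun p hp => by
    rw [D.ext_apply _ ⟨p, hp⟩, D.ext_apply _ ⟨p, hp⟩, D.ext_apply _ ⟨p, hp⟩]; rfl
  add_mem' {f g} hf hg := (hf.add hg).congr fun p hp => by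
    rw [D.ext_apply _ ⟨p, hp⟩, D.ext_apply _ ⟨p, hp⟩, D.ext_apply _ ⟨p, hp⟩]; rfl
  algebraMap_mem' c := (contDiffOn_const (c := c)).congr fun p hp => by
    rw [D.ext_apply _ ⟨p, hp⟩]; rfl

/-- The element of the algebra given by a smooth function. -/
def ofFun (F : ℝ × E → ℝ) (hF : ContDiffOn ℝ ∞ F D.S) : D.smooth :=
  ⟨fun p => F p, hF.congr (D.ext_restrict_eqOn F)⟩

theorem ofFun_apply (F : ℝ × E → ℝ) (hF : ContDiffOn ℝ ∞ F D.S) (p : D.S) : (D.ofFun F hF).1 p = F p :=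
  rfl

theorem contDiffOn_ext (f : D.smooth) : ContDiffOn ℝ ∞ (D.ext f.1) D.S := f.2

theorem differentiableWithinAt_ext (f : D.smooth) (p : D.S) :
    DifferentiableWithinAt ℝ (D.ext f.1) D.S p :=
  (D.contDiffOn_ext f).differentiableOn (by simp) p p.2

/-- Evaluation at a point. -/
def ev (p : D.S) : D.smooth →ₐ[ℝ] ℝ := (Pi.evalAlgHom ℝ (fun _ : D.S => ℝ) p).comp D.smooth.val

theorem ev_apply (p : D.S) (f : D.smooth) : D.ev p f = f.1 p := rfl

theorem ev_ext {f g : D.smooth} (h : ∀ p, D.ev p f = D.ev p g) : f = g :=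
  Subtype.ext (funext h)

theorem contDiffOn_fderivWithin (f : D.smooth) (v : ℝ × E) :
    ContDiffOn ℝ ∞ (fun p => fderivWithin ℝ (D.ext f.1) D.S p v) D.S :=
  ((D.contDiffOn_ext f).fderivWithin D.uniqueDiffOn (m := ∞) (by simp)).clm_apply contDiffOn_const

/-- The derivative in the direction `v`. -/
noncomputable def deriv (v : ℝ × E) : Derivation ℝ D.smooth D.smooth :=
  Derivation.mk'
    { toFun := fun f => D.ofFun (fun p => fderivWithin ℝ (D.ext f.1) D.S p v)
        (D.contDiffOn_fderivWithin f v)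
      map_add' := fun f g => D.ev_ext fun p => by
        simp only [map_add, ev_apply, ofFun_apply]
        have h : EqOn (D.ext (f + g).1) (D.ext f.1 + D.ext g.1) D.S := fun q hq => by
          rw [Pi.add_apply, D.ext_apply _ ⟨q, hq⟩, D.ext_apply _ ⟨q, hq⟩, D.ext_apply _ ⟨q, hq⟩]
          rfl
        rw [fderivWithin_congr h (h p.2), fderivWithin_add (D.uniqueDiffOn p p.2)
          (D.differentiableWithinAt_ext f p) (D.differentiableWithinAt_ext g p)]
        rfl
      map_smul' := fun c f => D.ev_ext fun p => by
        simp only [map_smul, ev_apply, ofFun_apply, RingHom.id_apply]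
        have h : EqOn (D.ext (c • f).1) (c • D.ext f.1) D.S := fun q hq => by
          rw [Pi.smul_apply, D.ext_apply _ ⟨q, hq⟩, D.ext_apply _ ⟨q, hq⟩]
          rfl
        rw [fderivWithin_congr h (h p.2), fderivWithin_const_smul
          (D.uniqueDiffOn p p.2) (D.differentiableWithinAt_ext f p)]
        rfl }
    fun f g => D.ev_ext fun p => by
      simp only [LinearMap.coe_mk, AddHom.coe_mk, map_add, smul_eq_mul, map_mul, ev_apply, ofFun_apply]
      have h : EqOn (D.ext (f * g).1) (fun q => D.ext f.1 q * D.ext g.1 q) D.S := fun q hq => by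
        simp only []
        rw [D.ext_apply _ ⟨q, hq⟩, D.ext_apply _ ⟨q, hq⟩, D.ext_apply _ ⟨q, hq⟩]
        rfl
      rw [fderivWithin_congr h (h p.2), fderivWithin_fun_mul (D.uniqueDiffOn p p.2)
        (D.differentiableWithinAt_ext f p) (D.differentiableWithinAt_ext g p)]
      simp only [D.ext_apply, add_apply, smul_apply,
        smul_eq_mul]

theorem ev_deriv (v : ℝ × E) (f : D.smooth) (p : D.S) :
    D.ev p (D.deriv v f) = fderivWithin ℝ (D.ext f.1) D.S p v := rfl

theorem ev_deriv_ofFun (v : ℝ × E) (F : ℝ × E → ℝ) (hF : ContDiffOn ℝ ∞ F D.S) (p : D.S) :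
    D.ev p (D.deriv v (D.ofFun F hF)) = fderivWithin ℝ F D.S p v := by
  rw [ev_deriv]
  exact congrArg (fun L : ℝ × E →L[ℝ] ℝ => L v)
    (fderivWithin_congr (D.ext_restrict_eqOn F) (D.ext_restrict_eqOn F p.2))

/-- Supplies at once the commutation of the spatial derivations among themselves and with the time
derivation. -/
theorem deriv_comm (v w : ℝ × E) (f : D.smooth) :
    D.deriv v (D.deriv w f) = D.deriv w (D.deriv v f) := by
  refine D.ev_ext fun p => ?_
  have key : ∀ v w, D.ev p (D.deriv v (D.deriv w f))
      = fderivWithin ℝ (fderivWithin ℝ (D.ext f.1) D.S) D.S p v w := by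
    intro v w
    have h1 : D.deriv w f = D.ofFun (fun p => fderivWithin ℝ (D.ext f.1) D.S p w)
        (D.contDiffOn_fderivWithin f w) := rfl
    rw [h1, ev_deriv_ofFun]
    have h2 : DifferentiableWithinAt ℝ (fderivWithin ℝ (D.ext f.1) D.S) D.S p :=
      ((D.contDiffOn_ext f).fderivWithin D.uniqueDiffOn (m := 1) (by norm_cast)).differentiableOn
        (by simp) p p.2
    rw [fderivWithin_clm_apply (D.uniqueDiffOn p p.2) h2 (differentiableWithinAt_const _)]
    simp
  rw [key, key]
  exact ((D.contDiffOn_ext f p p.2).isSymmSndFDerivWithinAt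
    (by simp only [minSmoothness_of_isRCLikeNormedField]; norm_cast) D.uniqueDiffOn (D.subset_closure p.2) p.2).eq v w

/-- The time derivative. -/
noncomputable def dt : Derivation ℝ D.smooth D.smooth := D.deriv (1, 0)

/-- The partial derivatives. -/
noncomputable def dx (i : Fin n) : Derivation ℝ D.smooth D.smooth :=
  D.deriv (0, EuclideanSpace.single i 1)

theorem hasDerivWithinAt_ev_dt (f : D.smooth) (p : D.S) :
    HasDerivWithinAt (fun s => D.ext f.1 (s, p.1.2)) (D.ev p (D.dt f)) D.J p.1.1 := by
  have h := (D.differentiableWithinAt_ext f p).hasFDerivWithinAt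
  have h2 : HasDerivWithinAt (fun s : ℝ => (s, p.1.2)) ((1 : ℝ), (0 : E)) D.J p.1.1 :=
    (hasDerivWithinAt_id _ _).prodMk (hasDerivWithinAt_const _ _ _)
  exact h.comp_hasDerivWithinAt (f := fun s : ℝ => (s, p.1.2)) p.1.1 h2
    (fun s hs => ⟨hs, p.2.2⟩)

theorem hasDerivWithinAt_ev_dt_ofFun (F : ℝ × E → ℝ) (hF : ContDiffOn ℝ ∞ F D.S) (p : D.S) :
    HasDerivWithinAt (fun s => F (s, p.1.2)) (D.ev p (D.dt (D.ofFun F hF))) D.J p.1.1 :=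
  (D.hasDerivWithinAt_ev_dt (D.ofFun F hF) p).congr
    (fun s hs => (D.ext_restrict_eqOn F (x := (s, p.1.2)) ⟨hs, p.2.2⟩).symm)
    (D.ext_restrict_eqOn F p.2).symm

theorem hasFDerivAt_ext (f : D.smooth) (p : D.S) :
    HasFDerivAt (fun y => D.ext f.1 (p.1.1, y))
      ((fderivWithin ℝ (D.ext f.1) D.S p).comp (ContinuousLinearMap.inr ℝ ℝ E)) p.1.2 := by
  have h := (D.differentiableWithinAt_ext f p).hasFDerivWithinAt
  have h2 : HasFDerivWithinAt (fun y : E => (p.1.1, y)) (ContinuousLinearMap.inr ℝ ℝ E) D.U p.1.2 :=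
    (hasFDerivAt_prodMk_right _ _).hasFDerivWithinAt
  have := h.comp (f := fun y : E => (p.1.1, y)) p.1.2 h2 (fun y hy => ⟨p.2.1, hy⟩)
  exact this.hasFDerivAt (D.isOpen.mem_nhds p.2.2)

theorem ev_dx (i : Fin n) (f : D.smooth) (p : D.S) :
    D.ev p (D.dx i f) = pd i (fun y => D.ext f.1 (p.1.1, y)) p.1.2 := by
  rw [pd, (D.hasFDerivAt_ext f p).fderiv]
  rfl

/-- The bridge to coordinate formulas: as U is open, only the values on the time slice matter, and
the derivative within the set becomes the full derivative in `pd`. -/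
theorem ev_dx_of_eqOn (i : Fin n) (f : D.smooth) (p : D.S) {F : E → ℝ}
    (h : ∀ y (hy : y ∈ D.U), F y = D.ev ⟨(p.1.1, y), p.2.1, hy⟩ f) :
    D.ev p (D.dx i f) = pd i F p.1.2 := by
  rw [ev_dx, pd, pd]
  congr 1
  apply Filter.EventuallyEq.fderiv_eq
  filter_upwards [D.isOpen.mem_nhds p.2.2] with y hy
  rw [h y hy, ev_apply]
  exact D.ext_apply _ ⟨(p.1.1, y), p.2.1, hy⟩

theorem isUnit_of_ne_zero (f : D.smooth) (h : ∀ p, D.ev p f ≠ 0) : IsUnit f := by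
  have hc : ContDiffOn ℝ ∞ (fun p => (D.ext f.1 p)⁻¹) D.S :=
    (D.contDiffOn_ext f).inv fun p hp => by
      rw [D.ext_apply _ ⟨p, hp⟩]
      exact h ⟨p, hp⟩
  refine IsUnit.of_mul_eq_one (D.ofFun _ hc) (D.ev_ext fun p => ?_)
  rw [map_mul, map_one, ev_apply (f := D.ofFun _ hc), ofFun_apply, D.ext_apply]
  exact mul_inv_cancel₀ (h p)

/-- The square root of a positive function. -/
theorem exists_sqrt (f : D.smooth) (h : ∀ p, 0 < D.ev p f) :
    ∃ s : D.smooth, ∀ p, D.ev p s = Real.sqrt (D.ev p f) := by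
  have hc : ContDiffOn ℝ ∞ (fun p => Real.sqrt (D.ext f.1 p)) D.S :=
    (D.contDiffOn_ext f).sqrt fun p hp => by
      rw [D.ext_apply _ ⟨p, hp⟩]
      exact (h ⟨p, hp⟩).ne'
  exact ⟨D.ofFun _ hc, fun p => by rw [ev_apply, ofFun_apply, D.ext_apply]; rfl⟩

end SpaceTime
end RicciTransport

/-! ### Transition maps, coordinate frames and metric coefficients. -/

namespace RicciTransport

open Set

section Charts

variable {n : ℕ} {M : Type*} [TopologicalSpace M] [ChartedSpace (EuclideanSpace ℝ (Fin n)) M]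

local notation "𝔼" => EuclideanSpace ℝ (Fin n)

/-- The transition map from the chart around `a` to the chart around `b`. -/
noncomputable def transition (a b : M) (y : 𝔼) : 𝔼 :=
  extChartAt (𝓡 n) b ((extChartAt (𝓡 n) a).symm y)

/-- The domain of the transition map. -/
def overlap (a b : M) : Set 𝔼 :=
  (extChartAt (𝓡 n) a).target ∩ (extChartAt (𝓡 n) a).symm ⁻¹' (extChartAt (𝓡 n) b).source

theorem isOpen_overlap (a b : M) : IsOpen (overlap (n := n) a b) :=
  (continuousOn_extChartAt_symm a).isOpen_inter_preimage (isOpen_extChartAt_target a)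
    (isOpen_extChartAt_source b)

theorem symm_transition {a b : M} {y : 𝔼} (hy : y ∈ overlap (n := n) a b) :
    (extChartAt (𝓡 n) b).symm (transition a b y) = (extChartAt (𝓡 n) a).symm y :=
  (extChartAt (𝓡 n) b).left_inv hy.2

theorem transition_mem {a b : M} {y : 𝔼} (hy : y ∈ overlap (n := n) a b) :
    transition a b y ∈ (extChartAt (𝓡 n) b).target :=
  (extChartAt (𝓡 n) b).map_source hy.2

variable [IsManifold (𝓡 n) ∞ M]

theorem contDiffOn_transition (a b : M) :
    ContDiffOn ℝ ∞ (transition (n := n) a b) (overlap a b) := by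
  rw [← contMDiffOn_iff_contDiffOn]
  refine (contMDiffOn_extChartAt (I := 𝓡 n) (n := ∞) (x := b)).comp
    ((contMDiffOn_extChartAt_symm a).mono inter_subset_left) ?_
  intro y hy
  rw [← extChartAt_source (𝓡 n)]
  exact hy.2

theorem mdifferentiableAt_symm (a : M) {y : 𝔼} (hy : y ∈ (extChartAt (𝓡 n) a).target) :
    MDifferentiableAt 𝓘(ℝ, 𝔼) (𝓡 n) (extChartAt (𝓡 n) a).symm y :=
  ((contMDiffOn_extChartAt_symm (n := ∞) a).contMDiffAt
    ((isOpen_extChartAt_target a).mem_nhds hy)).mdifferentiableAt (by simp)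

theorem mdifferentiableAt_ext (a : M) {x : M} (hx : x ∈ (extChartAt (𝓡 n) a).source) :
    MDifferentiableAt (𝓡 n) 𝓘(ℝ, 𝔼) (extChartAt (𝓡 n) a) x := by
  rw [extChartAt_source] at hx
  exact (contMDiffAt_extChartAt' (n := ∞) hx).mdifferentiableAt (by simp)

theorem mfderiv_ext_frame {a b : M} {y : 𝔼} (hy : y ∈ overlap (n := n) a b) (v : 𝔼) :
    (mfderiv (𝓡 n) 𝓘(ℝ, 𝔼) (extChartAt (𝓡 n) b) ((extChartAt (𝓡 n) a).symm y)
      (mfderiv 𝓘(ℝ, 𝔼) (𝓡 n) (extChartAt (𝓡 n) a).symm y v) : 𝔼)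
      = fderiv ℝ (transition a b) y v := by
  have h := mfderiv_comp (I := 𝓘(ℝ, 𝔼)) (I' := 𝓡 n) (I'' := 𝓘(ℝ, 𝔼)) y
    (mdifferentiableAt_ext b hy.2) (mdifferentiableAt_symm a hy.1)
  rw [← mfderiv_eq_fderiv]
  exact (congrArg (fun L : 𝔼 →L[ℝ] 𝔼 => L v) h).symm

/-- The entries of the Jacobian of the transition map, by the chain rule for manifold derivatives.
-/
theorem comp_frame {a b : M} {y : 𝔼} (hy : y ∈ overlap (n := n) a b) (i p : Fin n) :
    comp b (frame a y i) p = pd i (fun z => transition a b z p) y := by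
  have hd : DifferentiableAt ℝ (transition a b) y :=
    ((contDiffOn_transition a b).contDiffAt ((isOpen_overlap a b).mem_nhds hy)).differentiableAt
      (by simp)
  have h2 : HasFDerivAt (fun z => transition a b z p)
      ((EuclideanSpace.proj p : 𝔼 →L[ℝ] ℝ).comp (fderiv ℝ (transition a b) y)) y :=
    (EuclideanSpace.proj p : 𝔼 →L[ℝ] ℝ).hasFDerivAt.comp y hd.hasFDerivAt
  rw [pd, h2.fderiv]
  exact congrArg (fun v : 𝔼 => v p) (mfderiv_ext_frame hy _)

omit [IsManifold (𝓡 n) ∞ M] in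
theorem transition_self {a : M} {y : 𝔼} (hy : y ∈ (extChartAt (𝓡 n) a).target) :
    transition a a y = y := (extChartAt (𝓡 n) a).right_inv hy

omit [IsManifold (𝓡 n) ∞ M] in
theorem mem_overlap_self {a : M} {y : 𝔼} (hy : y ∈ (extChartAt (𝓡 n) a).target) :
    y ∈ overlap (n := n) a a := ⟨hy, (extChartAt (𝓡 n) a).map_target hy⟩

theorem mfderiv_ext_symm {a : M} {y : 𝔼} (hy : y ∈ (extChartAt (𝓡 n) a).target) (v : 𝔼) :
    (mfderiv (𝓡 n) 𝓘(ℝ, 𝔼) (extChartAt (𝓡 n) a) ((extChartAt (𝓡 n) a).symm y)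
      (mfderiv 𝓘(ℝ, 𝔼) (𝓡 n) (extChartAt (𝓡 n) a).symm y v) : 𝔼) = v := by
  rw [mfderiv_ext_frame (mem_overlap_self hy)]
  have : transition (n := n) a a =ᶠ[nhds y] id := by
    filter_upwards [(isOpen_extChartAt_target a).mem_nhds hy] with z hz
    exact transition_self hz
  rw [this.fderiv_eq, fderiv_id]
  rfl

theorem mfderiv_symm_ext {a x : M} (hx : x ∈ (extChartAt (𝓡 n) a).source)
    (X : TangentSpace (𝓡 n) x) :
    (mfderiv 𝓘(ℝ, 𝔼) (𝓡 n) (extChartAt (𝓡 n) a).symm (extChartAt (𝓡 n) a x)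
      (mfderiv (𝓡 n) 𝓘(ℝ, 𝔼) (extChartAt (𝓡 n) a) x X) : 𝔼) = X := by
  have hy := (extChartAt (𝓡 n) a).map_source hx
  have h := mfderiv_comp (I := 𝓡 n) (I' := 𝓘(ℝ, 𝔼)) (I'' := 𝓡 n) x
    (mdifferentiableAt_symm a hy) (mdifferentiableAt_ext a hx)
  have h2 : (extChartAt (𝓡 n) a).symm ∘ (extChartAt (𝓡 n) a) =ᶠ[nhds x] id := by
    filter_upwards [(isOpen_extChartAt_source a).mem_nhds hx] with z hz
    exact (extChartAt (𝓡 n) a).left_inv hz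
  rw [h2.mfderiv_eq, mfderiv_id] at h
  exact (congrArg (fun L : 𝔼 →L[ℝ] 𝔼 => L X) h).symm

theorem sum_comp_frame {a x : M} (hx : x ∈ (extChartAt (𝓡 n) a).source)
    (X : TangentSpace (𝓡 n) x) :
    ∑ p, comp a X p • (frame a (extChartAt (𝓡 n) a x) p : 𝔼) = X := by
  have h : ∑ p, comp a X p • (EuclideanSpace.single p (1 : ℝ) : 𝔼)
      = (mfderiv (𝓡 n) 𝓘(ℝ, 𝔼) (extChartAt (𝓡 n) a) x X : 𝔼) := by
    ext q
    simp [comp, Pi.single_apply]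
  conv_rhs => rw [← mfderiv_symm_ext hx X]
  rw [← h]
  exact (map_sum (mfderiv 𝓘(ℝ, 𝔼) (𝓡 n) (extChartAt (𝓡 n) a).symm (extChartAt (𝓡 n) a x) :
    𝔼 →L[ℝ] 𝔼) _ _ |>.trans (Finset.sum_congr rfl fun p _ => map_smul _ _ _)).symm

theorem inner_congr (g : Metric n M) {x x' : M} (h : x = x') (v w : 𝔼) :
    g.inner x v w = g.inner x' v w := by subst h; rfl

theorem inner_sum (g : Metric n M) (x : M) (c d : Fin n → ℝ) (v w : Fin n → 𝔼) :
    g.inner x (∑ p, c p • v p : 𝔼) (∑ q, d q • w q : 𝔼)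
      = ∑ p, ∑ q, c p * d q * g.inner x (v p) (w q) := by
  set B : 𝔼 →L[ℝ] 𝔼 →L[ℝ] ℝ := g.inner x with hB
  change B (∑ p, c p • v p : 𝔼) (∑ q, d q • w q : 𝔼) = ∑ p, ∑ q, c p * d q * B (v p) (w q)
  simp only [map_sum, map_smul, sum_apply, smul_apply,
    smul_eq_mul, Finset.mul_sum]
  rw [Finset.sum_comm]
  exact Finset.sum_congr rfl fun _ _ => Finset.sum_congr rfl fun _ _ => by ring

/-- The inner product in the chart around `a`. -/
theorem inner_eq_sum (g : Metric n M) {a x : M} (hx : x ∈ (extChartAt (𝓡 n) a).source)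
    (X Y : TangentSpace (𝓡 n) x) : g.inner x X Y
      = ∑ p, ∑ q, comp a X p * comp a Y q * gram g a (extChartAt (𝓡 n) a x) p q := by
  have hx' := (extChartAt (𝓡 n) a).left_inv hx
  refine (congrArg₂ (fun v w : 𝔼 => g.inner x v w) (sum_comp_frame hx X)
    (sum_comp_frame hx Y)).symm.trans ((inner_sum g x _ _ _ _).trans ?_)
  exact Finset.sum_congr rfl fun _ _ => Finset.sum_congr rfl fun _ _ =>
    congrArg _ (inner_congr g hx'.symm _ _)

theorem gram_transition (g : Metric n M) {a b : M} {y : 𝔼} (hy : y ∈ overlap (n := n) a b)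
    (i j : Fin n) : gram g a y i j = ∑ p, ∑ q, pd i (fun z => transition a b z p) y
      * pd j (fun z => transition a b z q) y * gram g b (transition a b y) p q := by
  have h := inner_eq_sum g hy.2 (frame a y i) (frame a y j)
  simp only [comp_frame hy] at h
  exact h

theorem gram_symm (g : Metric n M) (a : M) (y : 𝔼) (i j : Fin n) :
    gram g a y i j = gram g a y j i := g.symm _ _ _

theorem gram_posDef (g : Metric n M) {a : M} {y : 𝔼} (hy : y ∈ (extChartAt (𝓡 n) a).target) :
    (gram g a y).PosDef := by
  refine Matrix.PosDef.of_dotProduct_mulVec_pos ?_ ?_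
  · ext i j
    exact gram_symm g a y j i
  · intro c hc
    have h1 : dotProduct (star c) ((gram g a y).mulVec c)
        = g.inner ((extChartAt (𝓡 n) a).symm y) (∑ p, c p • (frame a y p : 𝔼) : 𝔼)
          (∑ p, c p • (frame a y p : 𝔼) : 𝔼) := by
      refine Eq.trans ?_ (inner_sum g _ c c (fun p => frame a y p) (fun p => frame a y p)).symm
      simp only [dotProduct, Matrix.mulVec, Finset.mul_sum]
      refine Finset.sum_congr rfl fun p _ => Finset.sum_congr rfl fun q _ => ?_
      simp only [Pi.star_apply, star_trivial, gram, Matrix.of_apply]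
      ring
    rw [h1]
    apply g.pos
    intro h0
    apply hc
    have h2 : (∑ p, c p • (frame a y p : 𝔼) : 𝔼) = (mfderiv 𝓘(ℝ, 𝔼) (𝓡 n)
        (extChartAt (𝓡 n) a).symm y (∑ p, c p • (EuclideanSpace.single p (1 : ℝ) : 𝔼) : 𝔼) : 𝔼) :=
      (map_sum (mfderiv 𝓘(ℝ, 𝔼) (𝓡 n) (extChartAt (𝓡 n) a).symm y :
        𝔼 →L[ℝ] 𝔼) _ _ |>.trans (Finset.sum_congr rfl fun p _ => map_smul _ _ _)).symm
    -- The derivative of the chart recovers the coefficients c from the frame combination, so a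
    -- vanishing combination forces c = 0.
    have h3 := mfderiv_ext_symm hy (∑ p, c p • (EuclideanSpace.single p (1 : ℝ) : 𝔼))
    rw [← h2, h0] at h3
    erw [map_zero] at h3
    funext q
    have h4 : (0 : 𝔼) q = (∑ p, c p • (EuclideanSpace.single p (1 : ℝ) : 𝔼)) q :=
      congrArg (fun v : 𝔼 => v q) h3
    simpa [Pi.single_apply] using h4.symm

theorem gram_det_pos (g : Metric n M) {a : M} {y : 𝔼} (hy : y ∈ (extChartAt (𝓡 n) a).target) :
    0 < (gram g a y).det := (gram_posDef g hy).det_pos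

theorem contMDiff_const_section {V : Type*} [NormedAddCommGroup V] [NormedSpace ℝ V] (v : V) :
    ContMDiff 𝓘(ℝ, V) 𝓘(ℝ, V).tangent ∞
      (fun y : V => (Bundle.TotalSpace.mk y v : TangentBundle 𝓘(ℝ, V) V)) := by
  exact contMDiff_vectorSpace_iff_contDiff (V := fun _ => v) |>.mpr contDiff_const

/-- The coordinate vector fields are smooth. -/
theorem contMDiffOn_frame (a : M) (i : Fin n) :
    ContMDiffOn 𝓘(ℝ, 𝔼) (𝓡 n).tangent ∞
      (fun y => (⟨(extChartAt (𝓡 n) a).symm y, frame a y i⟩ : TangentBundle (𝓡 n) M))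
      (extChartAt (𝓡 n) a).target := by
  have h1 := (contMDiffOn_extChartAt_symm (I := 𝓡 n) (n := ∞) a).contMDiffOn_tangentMapWithin
    (m := ∞) (by simp) (isOpen_extChartAt_target a).uniqueMDiffOn
  have h2 := contMDiff_const_section (EuclideanSpace.single i (1 : ℝ) : 𝔼)
  refine (h1.comp h2.contMDiffOn (s := (extChartAt (𝓡 n) a).target) fun y hy => hy).congr ?_
  intro y hy
  simp only [Function.comp, tangentMapWithin, frame]
  rw [mfderivWithin_of_mem_nhds ((isOpen_extChartAt_target a).mem_nhds hy)]

/-- The hypothesis concerns a section of the bundle of bilinear forms; applying that section to the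
smooth coordinate frames gives smooth coefficients. -/
theorem contDiffOn_gram {g : ℝ → Metric n M} {J : Set ℝ} (hg : SmoothMetricFamily g J) (a : M)
    (i j : Fin n) : ContDiffOn ℝ ∞ (fun p : ℝ × 𝔼 => gram (g p.1) a p.2 i j)
      (J ×ˢ (extChartAt (𝓡 n) a).target) := by
  rw [← contMDiffOn_iff_contDiffOn]
  have hsnd : ContMDiff 𝓘(ℝ, ℝ × 𝔼) 𝓘(ℝ, 𝔼) ∞ (Prod.snd : ℝ × 𝔼 → 𝔼) := contDiff_snd.contMDiff
  have hfst : ContMDiff 𝓘(ℝ, ℝ × 𝔼) 𝓘(ℝ, ℝ) ∞ (Prod.fst : ℝ × 𝔼 → ℝ) := contDiff_fst.contMDiff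
  have hf : ∀ i, ContMDiffOn 𝓘(ℝ, ℝ × 𝔼) (𝓡 n).tangent ∞
      (fun p : ℝ × 𝔼 => (⟨(extChartAt (𝓡 n) a).symm p.2, frame a p.2 i⟩ : TangentBundle (𝓡 n) M))
      (J ×ˢ (extChartAt (𝓡 n) a).target) := fun i =>
    (contMDiffOn_frame a i).comp hsnd.contMDiffOn fun p hp => hp.2
  have hb : ContMDiffOn 𝓘(ℝ, ℝ × 𝔼) (𝓡 n) ∞ (fun p : ℝ × 𝔼 => (extChartAt (𝓡 n) a).symm p.2)
      (J ×ˢ (extChartAt (𝓡 n) a).target) :=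
    (contMDiffOn_extChartAt_symm a).comp hsnd.contMDiffOn fun p hp => hp.2
  have hG := hg.comp (hfst.contMDiffOn.prodMk hb) (fun p hp => ⟨hp.1, mem_univ _⟩)
  intro p hp
  have h : ContMDiffWithinAt 𝓘(ℝ, ℝ × 𝔼) ((𝓡 n).prod 𝓘(ℝ)) ∞
      (fun p : ℝ × 𝔼 => Bundle.TotalSpace.mk' ℝ (E := Bundle.Trivial M ℝ)
        ((extChartAt (𝓡 n) a).symm p.2) ((g p.1).inner ((extChartAt (𝓡 n) a).symm p.2)
          (frame a p.2 i) (frame a p.2 j))) (J ×ˢ (extChartAt (𝓡 n) a).target) p := by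
    apply ContMDiffWithinAt.clm_bundle_apply₂ (F₁ := 𝔼) (F₂ := 𝔼)
    · exact hG p hp
    · exact hf i p hp
    · exact hf j p hp
  simp only [Bundle.contMDiffWithinAt_totalSpace] at h
  exact h.2

end Charts
end RicciTransport

/-! ### Coordinate formulas as evaluations in the algebra, and their behaviour on overlaps. -/

namespace RicciTransport

open Set

section ChartExpressions

variable {n : ℕ} {M : Type*} [TopologicalSpace M] [ChartedSpace (EuclideanSpace ℝ (Fin n)) M]
  [IsManifold (𝓡 n) ∞ M]

local notation "𝔼" => EuclideanSpace ℝ (Fin n)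

/-- The scalar curvature in the chart around `a`. -/
noncomputable def scalarLocal (g : Metric n M) (a : M) (y : 𝔼) : ℝ :=
  ∑ i, ∑ j, gramInv g a y i j * ricciLocal g a y i j

/-- The Laplacian in the chart around `a`. -/
noncomputable def lapLocal (g : Metric n M) (f : M → ℝ) (a : M) (y : 𝔼) : ℝ :=
  ∑ i, ∑ j, gramInv g a y i j * hessLocal g f a y i j

/-- The inner product of gradients in the chart around `a`. -/
noncomputable def gmLocal (g : Metric n M) (f h : M → ℝ) (a : M) (y : 𝔼) : ℝ :=
  ∑ i, ∑ j, gramInv g a y i j * pd i (localFun a f) y * pd j (localFun a h) y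

/-- The components of the gradient in the chart around `a`. -/
noncomputable def gradLocal (g : Metric n M) (f : M → ℝ) (a : M) (y : 𝔼) (i : Fin n) : ℝ :=
  ∑ j, gramInv g a y i j * pd j (localFun a f) y

/-- The function `|Ric - Hess f|²` in the chart around `a`. -/
noncomputable def nsqLocal (g : Metric n M) (f : M → ℝ) (a : M) (y : 𝔼) : ℝ :=
  ∑ i, ∑ j, ∑ k, ∑ l, gramInv g a y i k * gramInv g a y j l *
    (ricciLocal g a y i j - hessLocal g f a y i j) * (ricciLocal g a y k l - hessLocal g f a y k l)

/-- The functions on `J × M` that are smooth in each chart. -/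
def ChartSmooth (n : ℕ) {M : Type*} [TopologicalSpace M]
    [ChartedSpace (EuclideanSpace ℝ (Fin n)) M] (u : ℝ → M → ℝ) (J : Set ℝ) : Prop :=
  ∀ a : M, ContDiffOn ℝ ∞ (fun p : ℝ × EuclideanSpace ℝ (Fin n) =>
    u p.1 ((extChartAt (𝓡 n) a).symm p.2)) (J ×ˢ (extChartAt (𝓡 n) a).target)

/-- `ChartSmooth` is the working notion of smoothness: it can be read off directly from membership
in the algebra of each chart. -/
theorem SmoothFunFamily.chartSmooth {u : ℝ → M → ℝ} {J : Set ℝ} (hu : SmoothFunFamily n u J) :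
    ChartSmooth n u J := by
  intro a
  rw [← contMDiffOn_iff_contDiffOn]
  have hsnd : ContMDiff 𝓘(ℝ, ℝ × 𝔼) 𝓘(ℝ, 𝔼) ∞ (Prod.snd : ℝ × 𝔼 → 𝔼) := contDiff_snd.contMDiff
  have hfst : ContMDiff 𝓘(ℝ, ℝ × 𝔼) 𝓘(ℝ, ℝ) ∞ (Prod.fst : ℝ × 𝔼 → ℝ) := contDiff_fst.contMDiff
  have hb : ContMDiffOn 𝓘(ℝ, ℝ × 𝔼) (𝓡 n) ∞ (fun p : ℝ × 𝔼 => (extChartAt (𝓡 n) a).symm p.2)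
      (J ×ˢ (extChartAt (𝓡 n) a).target) :=
    (contMDiffOn_extChartAt_symm a).comp hsnd.contMDiffOn fun _ hp => hp.2
  exact hu.comp (hfst.contMDiffOn.prodMk hb) (fun _ hp => ⟨hp.1, mem_univ _⟩)

namespace SpaceTime

variable (D : SpaceTime n) {g : ℝ → Metric n M} (hg : SmoothMetricFamily g D.J) {a : M}
  (hD : D.U ⊆ (extChartAt (𝓡 n) a).target)

/-- The function `u` in the chart around `a`. -/
noncomputable def fn {u : ℝ → M → ℝ} (hu : ChartSmooth n u D.J) : D.smooth :=
  D.ofFun _ ((hu a).mono (prod_mono_right hD))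

omit [IsManifold (𝓡 n) ∞ M] in
theorem ev_fn {u : ℝ → M → ℝ} (hu : ChartSmooth n u D.J) (p : D.S) :
    D.ev p (D.fn hD hu) = u p.1.1 ((extChartAt (𝓡 n) a).symm p.1.2) := rfl

/-- The matrix `g_ij` in the chart around `a`. -/
noncomputable def gramMatrix : Matrix (Fin n) (Fin n) D.smooth := Matrix.of fun i j =>
  D.ofFun _ ((contDiffOn_gram hg a i j).mono (prod_mono_right hD))

theorem map_ev_gramMatrix (p : D.S) :
    (D.gramMatrix hg hD).map (D.ev p) = gram (g p.1.1) a p.1.2 := rfl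

theorem ev_det_gramMatrix (p : D.S) :
    D.ev p (D.gramMatrix hg hD).det = (gram (g p.1.1) a p.1.2).det := by
  rw [← map_ev_gramMatrix D hg hD p]
  exact RingHom.map_det (D.ev p).toRingHom _

theorem isUnit_det_gramMatrix : IsUnit (D.gramMatrix hg hD).det :=
  D.isUnit_of_ne_zero _ fun p => by
    rw [ev_det_gramMatrix]
    exact (gram_det_pos _ (hD p.2.2)).ne'

/-- The metric in the chart around `a`. -/
noncomputable def metric : CoordMetric (Fin n) D.smooth where
  d := D.dx
  G := D.gramMatrix hg hD
  H := (D.gramMatrix hg hD)⁻¹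
  G_symm := Matrix.ext fun i j => D.ev_ext fun p => gram_symm (g p.1.1) a p.1.2 j i
  mul_eq_one := Matrix.mul_nonsing_inv _ (D.isUnit_det_gramMatrix hg hD)

theorem metric_comm (i j : Fin n) (f : D.smooth) :
    (D.metric hg hD).d i ((D.metric hg hD).d j f) = (D.metric hg hD).d j ((D.metric hg hD).d i f) :=
  D.deriv_comm _ _ f

theorem ev_H (p : D.S) (i j : Fin n) :
    D.ev p ((D.metric hg hD).H i j) = gramInv (g p.1.1) a p.1.2 i j := by
  have h : gram (g p.1.1) a p.1.2 * (D.metric hg hD).H.map (D.ev p) = 1 := by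
    have h1 := congrArg (fun N => N.map (D.ev p)) (D.metric hg hD).mul_eq_one
    simp only [Matrix.map_mul] at h1
    rw [← map_ev_gramMatrix D hg hD p]
    refine h1.trans ?_
    simp
  rw [gramInv, Matrix.inv_eq_right_inv h]
  rfl

theorem ev_chr (p : D.S) (k i j : Fin n) :
    D.ev p ((D.metric hg hD).chr k i j) = christoffel (g p.1.1) a k i j p.1.2 := by
  have hG : ∀ c i j, D.ev p ((D.metric hg hD).d c ((D.metric hg hD).G i j))
      = pd c (fun z => gram (g p.1.1) a z i j) p.1.2 := fun c i j =>
    D.ev_dx_of_eqOn c _ p fun _ _ => rfl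
  rw [CoordMetric.chr, map_smul, christoffel, smul_eq_mul, map_sum]
  simp only [map_mul, map_add, map_sub, hG, ev_H]

theorem ev_d_chr (p : D.S) (c k i j : Fin n) :
    D.ev p ((D.metric hg hD).d c ((D.metric hg hD).chr k i j))
      = pd c (christoffel (g p.1.1) a k i j) p.1.2 :=
  D.ev_dx_of_eqOn c _ p fun y hy => (D.ev_chr hg hD ⟨(p.1.1, y), p.2.1, hy⟩ k i j).symm

theorem ev_ric (p : D.S) (i j : Fin n) :
    D.ev p ((D.metric hg hD).ric i j) = ricciLocal (g p.1.1) a p.1.2 i j := by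
  simp only [CoordMetric.ric, map_add, map_sub, map_sum, map_mul, ev_d_chr, ev_chr, ricciLocal]

theorem ev_scal (p : D.S) :
    D.ev p (D.metric hg hD).scal = scalarLocal (g p.1.1) a p.1.2 := by
  simp only [CoordMetric.scal, CoordMetric.tr, map_sum, map_mul, ev_H, ev_ric, scalarLocal]

variable {u v : ℝ → M → ℝ} (hu : ChartSmooth n u D.J) (hv : ChartSmooth n v D.J)

theorem ev_d_fn (p : D.S) (c : Fin n) : D.ev p ((D.metric hg hD).d c (D.fn hD hu))
    = pd c (localFun a (u p.1.1)) p.1.2 :=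
  D.ev_dx_of_eqOn c _ p fun _ _ => rfl

theorem ev_hess (p : D.S) (i j : Fin n) : D.ev p ((D.metric hg hD).hess (D.fn hD hu) i j)
    = hessLocal (g p.1.1) (u p.1.1) a p.1.2 i j := by
  have h : D.ev p ((D.metric hg hD).d i ((D.metric hg hD).d j (D.fn hD hu)))
      = pd i (pd j (localFun a (u p.1.1))) p.1.2 :=
    D.ev_dx_of_eqOn i _ p fun y hy => (D.ev_d_fn hg hD hu ⟨(p.1.1, y), p.2.1, hy⟩ j).symm
  simp only [CoordMetric.hess, map_sub, map_sum, map_mul, ev_chr, ev_d_fn, h, hessLocal]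

theorem ev_lap (p : D.S) : D.ev p ((D.metric hg hD).lap (D.fn hD hu))
    = lapLocal (g p.1.1) (u p.1.1) a p.1.2 := by
  simp only [CoordMetric.lap, CoordMetric.tr, map_sum, map_mul, ev_H, ev_hess, lapLocal]

theorem ev_gm (p : D.S) : D.ev p ((D.metric hg hD).gm (D.fn hD hu) (D.fn hD hv))
    = gmLocal (g p.1.1) (u p.1.1) (v p.1.1) a p.1.2 := by
  simp only [CoordMetric.gm, map_sum, map_mul, ev_H, ev_d_fn, gmLocal]

theorem ev_nab (p : D.S) (i : Fin n) : D.ev p ((D.metric hg hD).nab (D.fn hD hu) i)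
    = gradLocal (g p.1.1) (u p.1.1) a p.1.2 i := by
  simp only [CoordMetric.nab, map_sum, map_mul, ev_H, ev_d_fn, gradLocal]

theorem ev_nsq (p : D.S) : D.ev p ((D.metric hg hD).ip
      (fun i j => (D.metric hg hD).ric i j - (D.metric hg hD).hess (D.fn hD hu) i j)
      (fun i j => (D.metric hg hD).ric i j - (D.metric hg hD).hess (D.fn hD hu) i j))
    = nsqLocal (g p.1.1) (u p.1.1) a p.1.2 := by
  simp only [CoordMetric.ip, map_sum, map_mul, map_sub, ev_H, ev_ric, ev_hess, nsqLocal]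

end SpaceTime

/-- The space-time with the domain of the chart around `a`. -/
abbrev chartDomain (n : ℕ) {M : Type*} [TopologicalSpace M]
    [ChartedSpace (EuclideanSpace ℝ (Fin n)) M] {J : Set ℝ} (hJ : Convex ℝ J)
    (hJ' : (interior J).Nonempty) (a : M) : SpaceTime n :=
  ⟨J, (extChartAt (𝓡 n) a).target, hJ, hJ', isOpen_extChartAt_target a⟩

/-- The space-time with the domain of the transition map from the chart around `a` to that
around `b`. -/
abbrev overlapDomain (n : ℕ) {M : Type*} [TopologicalSpace M]
    [ChartedSpace (EuclideanSpace ℝ (Fin n)) M] {J : Set ℝ} (hJ : Convex ℝ J)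
    (hJ' : (interior J).Nonempty) (a b : M) : SpaceTime n :=
  ⟨J, overlap a b, hJ, hJ', isOpen_overlap a b⟩

omit [IsManifold (𝓡 n) ∞ M] in
theorem overlap_subset (a b : M) : overlap (n := n) a b ⊆ (extChartAt (𝓡 n) a).target :=
  inter_subset_left

section Transition

variable {J : Set ℝ} (hJ : Convex ℝ J) (hJ' : (interior J).Nonempty) (a b : M)

/-- The map of space-times given by the transition map. -/
noncomputable def transitionPoint (p : (overlapDomain n hJ hJ' a b).S) : (chartDomain n hJ hJ' b).S :=
  ⟨(p.1.1, transition a b p.1.2), p.2.1, transition_mem p.2.2⟩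

theorem contDiffOn_comp_transition (f : (chartDomain n hJ hJ' b).smooth) :
    ContDiffOn ℝ ∞ (fun p : ℝ × 𝔼 => (chartDomain n hJ hJ' b).ext f.1 (p.1, transition a b p.2))
      (overlapDomain n hJ hJ' a b).S :=
  ((chartDomain n hJ hJ' b).contDiffOn_ext f).comp
    (contDiffOn_fst.prodMk ((contDiffOn_transition a b).comp contDiffOn_snd fun _ hp => hp.2))
    fun _ hp => ⟨hp.1, transition_mem hp.2⟩

theorem ev_comp_transition (f : (chartDomain n hJ hJ' b).smooth)
    (p : (overlapDomain n hJ hJ' a b).S) : (overlapDomain n hJ hJ' a b).ev p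
      ((overlapDomain n hJ hJ' a b).ofFun _ (contDiffOn_comp_transition hJ hJ' a b f))
      = (chartDomain n hJ hJ' b).ev (transitionPoint hJ hJ' a b p) f :=
  (chartDomain n hJ hJ' b).ext_apply f.1 (transitionPoint hJ hJ' a b p)

/-- Composition with the transition map. -/
noncomputable def transitionHom :
    (chartDomain n hJ hJ' b).smooth →ₐ[ℝ] (overlapDomain n hJ hJ' a b).smooth where
  toFun f := (overlapDomain n hJ hJ' a b).ofFun _ (contDiffOn_comp_transition hJ hJ' a b f)
  map_one' := SpaceTime.ev_ext _ fun p => by rw [ev_comp_transition, map_one, map_one]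
  map_mul' f g := SpaceTime.ev_ext _ fun p => by
    rw [map_mul, ev_comp_transition, ev_comp_transition, ev_comp_transition, map_mul]
  map_zero' := SpaceTime.ev_ext _ fun p => by rw [ev_comp_transition, map_zero, map_zero]
  map_add' f g := SpaceTime.ev_ext _ fun p => by
    rw [map_add, ev_comp_transition, ev_comp_transition, ev_comp_transition, map_add]
  commutes' c := SpaceTime.ev_ext _ fun p => by
    rw [ev_comp_transition, AlgHom.commutes, AlgHom.commutes]

theorem ev_transitionHom (f : (chartDomain n hJ hJ' b).smooth)
    (p : (overlapDomain n hJ hJ' a b).S) : (overlapDomain n hJ hJ' a b).ev p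
      (transitionHom hJ hJ' a b f) = (chartDomain n hJ hJ' b).ev (transitionPoint hJ hJ' a b p) f :=
  ev_comp_transition hJ hJ' a b f p

theorem contDiffOn_transition_coord (q : Fin n) :
    ContDiffOn ℝ ∞ (fun p : ℝ × 𝔼 => transition a b p.2 q) (overlapDomain n hJ hJ' a b).S :=
  (EuclideanSpace.proj q : 𝔼 →L[ℝ] ℝ).contDiff.comp_contDiffOn
    ((contDiffOn_transition a b).comp contDiffOn_snd fun _ hp => hp.2)

/-- The Jacobian matrix of the transition map. -/
noncomputable def jacobian : Matrix (Fin n) (Fin n) (overlapDomain n hJ hJ' a b).smooth :=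
  Matrix.of fun q i => (overlapDomain n hJ hJ' a b).dx i
    ((overlapDomain n hJ hJ' a b).ofFun _ (contDiffOn_transition_coord hJ hJ' a b q))

theorem ev_jacobian (p : (overlapDomain n hJ hJ' a b).S) (q i : Fin n) :
    (overlapDomain n hJ hJ' a b).ev p (jacobian hJ hJ' a b q i)
      = pd i (fun z => transition a b z q) p.1.2 :=
  SpaceTime.ev_dx_of_eqOn _ i _ p fun _ _ => rfl

/-- The chain rule, after expanding the derivative of the transition map in the standard basis. -/
theorem dx_transitionHom (f : (chartDomain n hJ hJ' b).smooth) (i : Fin n) :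
    (overlapDomain n hJ hJ' a b).dx i (transitionHom hJ hJ' a b f)
      = ∑ q, jacobian hJ hJ' a b q i
        * transitionHom hJ hJ' a b ((chartDomain n hJ hJ' b).dx q f) := by
  refine SpaceTime.ev_ext _ fun p => ?_
  have hd : DifferentiableAt ℝ (transition a b) p.1.2 :=
    ((contDiffOn_transition a b).contDiffAt ((isOpen_overlap a b).mem_nhds p.2.2)).differentiableAt
      (by simp)
  have hc : ∀ q, pd i (fun z => transition a b z q) p.1.2
      = fderiv ℝ (transition a b) p.1.2 (EuclideanSpace.single i 1) q := by
    intro q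
    have h2 : HasFDerivAt (fun z => transition a b z q)
        ((EuclideanSpace.proj q : 𝔼 →L[ℝ] ℝ).comp (fderiv ℝ (transition a b) p.1.2)) p.1.2 :=
      (EuclideanSpace.proj q : 𝔼 →L[ℝ] ℝ).hasFDerivAt.comp p.1.2 hd.hasFDerivAt
    rw [pd, h2.fderiv]
    rfl
  rw [SpaceTime.ev_dx_of_eqOn _ i _ p (F := fun y => (chartDomain n hJ hJ' b).ext f.1 (p.1.1, transition a b y))
    fun y hy => by
      rw [ev_transitionHom]
      exact (chartDomain n hJ hJ' b).ext_apply f.1 (transitionPoint hJ hJ' a b ⟨(p.1.1, y), p.2.1, hy⟩)]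
  simp only [map_sum, map_mul, ev_transitionHom, ev_jacobian, SpaceTime.ev_dx, hc]
  have h := (chartDomain n hJ hJ' b).hasFDerivAt_ext f (transitionPoint hJ hJ' a b p)
  have h3 := h.comp p.1.2 hd.hasFDerivAt
  have h4 : pd i (fun y => (chartDomain n hJ hJ' b).ext f.1 (p.1.1, transition a b y)) p.1.2
      = _ := congrArg (fun L : 𝔼 →L[ℝ] ℝ => L (EuclideanSpace.single i 1)) h3.fderiv
  rw [h4]
  simp only [pd, h.fderiv]
  set w := fderiv ℝ (transition a b) p.1.2 (EuclideanSpace.single i 1) with hw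
  have hws : w = ∑ q, w q • (EuclideanSpace.single q (1 : ℝ) : 𝔼) := by
    ext q
    simp [Pi.single_apply]
  rw [ContinuousLinearMap.comp_apply (f := fderiv ℝ (transition a b) p.1.2), ← hw]
  conv_lhs => rw [hws]
  simp only [map_sum, map_smul, smul_eq_mul]

variable {g : ℝ → Metric n M} (hg : SmoothMetricFamily g J)

theorem gram_eq_jacobian : (overlapDomain n hJ hJ' a b).gramMatrix hg (overlap_subset a b)
    = (jacobian hJ hJ' a b).transpose
      * ((chartDomain n hJ hJ' b).gramMatrix hg subset_rfl).map (transitionHom hJ hJ' a b)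
      * jacobian hJ hJ' a b := by
  refine Matrix.ext fun i j => SpaceTime.ev_ext _ fun p => ?_
  simp only [Matrix.mul_apply, Matrix.transpose_apply, Matrix.map_apply, Finset.sum_mul, map_sum,
    map_mul, ev_jacobian, ev_transitionHom]
  refine (gram_transition (g p.1.1) p.2.2 i j).trans ?_
  rw [Finset.sum_comm]
  refine Finset.sum_congr rfl fun _ _ => Finset.sum_congr rfl fun _ _ => ?_
  rw [mul_right_comm]
  rfl

-- The determinant of g_ij is a unit and has det J as a factor, so the inverse transition map is not
-- needed here.
include hg in
theorem isUnit_det_jacobian : IsUnit (jacobian (n := n) hJ hJ' a b).det := by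
  have h := congrArg Matrix.det (gram_eq_jacobian hJ hJ' a b hg)
  rw [Matrix.det_mul] at h
  exact isUnit_of_mul_isUnit_right
    (h ▸ (overlapDomain n hJ hJ' a b).isUnit_det_gramMatrix hg (overlap_subset a b))

/-- The metric of the chart around `b`, transported to the chart around `a`. -/
noncomputable def transportedMetric :
    CoordMetric (Fin n) (overlapDomain n hJ hJ' a b).smooth where
  d q := ∑ i, (jacobian hJ hJ' a b)⁻¹ i q • (overlapDomain n hJ hJ' a b).dx i
  G := ((chartDomain n hJ hJ' b).gramMatrix hg subset_rfl).map (transitionHom hJ hJ' a b)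
  H := ((chartDomain n hJ hJ' b).metric hg subset_rfl).H.map (transitionHom hJ hJ' a b)
  G_symm := by
    rw [← Matrix.transpose_map]
    exact congrArg (fun N => Matrix.map N (transitionHom hJ hJ' a b))
      ((chartDomain n hJ hJ' b).metric hg subset_rfl).G_symm
  mul_eq_one := by
    have h1 := congrArg (fun N => N.map (transitionHom hJ hJ' a b))
      ((chartDomain n hJ hJ' b).metric hg subset_rfl).mul_eq_one
    simp only [Matrix.map_mul] at h1
    refine h1.trans ?_
    simp

theorem transportedMetric_d (q : Fin n) (f : (overlapDomain n hJ hJ' a b).smooth) :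
    (transportedMetric hJ hJ' a b hg).d q f
      = ∑ i, (jacobian hJ hJ' a b)⁻¹ i q * (overlapDomain n hJ hJ' a b).dx i f := by
  change (∑ i, (jacobian hJ hJ' a b)⁻¹ i q • (overlapDomain n hJ hJ' a b).dx i) f = _
  have h := congrFun (map_sum (Derivation.coeFnAddMonoidHom (R := ℝ)
    (A := (overlapDomain n hJ hJ' a b).smooth) (M := (overlapDomain n hJ hJ' a b).smooth))
    (fun i => (jacobian hJ hJ' a b)⁻¹ i q • (overlapDomain n hJ hJ' a b).dx i) Finset.univ) f
  rw [Finset.sum_apply] at h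
  exact h

/-- The transported metric is an intermediate object on the overlap: from the metric of chart a it
differs by a change of frame in one algebra, and it is the image of the metric of chart b under a
homomorphism (`isMap_transition`). -/
theorem isCoordChange : CoordMetric.IsCoordChange
    ((overlapDomain n hJ hJ' a b).metric hg (overlap_subset a b)) (transportedMetric hJ hJ' a b hg)
    (jacobian hJ hJ' a b) (jacobian hJ hJ' a b)⁻¹ where
  comm := SpaceTime.metric_comm _ hg (overlap_subset a b)
  inv := Matrix.mul_nonsing_inv _ (isUnit_det_jacobian hJ hJ' a b hg)
  d_eq i f := by
    have h := Matrix.nonsing_inv_mul _ (isUnit_det_jacobian hJ hJ' a b hg)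
    have h2 : ∀ k, ∑ q, (jacobian hJ hJ' a b)⁻¹ k q * jacobian hJ hJ' a b q i
        = if k = i then 1 else 0 := fun k => by
      rw [← Matrix.mul_apply, h, Matrix.one_apply]
    simp only [transportedMetric_d, Finset.mul_sum]
    rw [Finset.sum_comm]
    have h3 : ∀ k, ∑ q, jacobian hJ hJ' a b q i * ((jacobian hJ hJ' a b)⁻¹ k q
        * (overlapDomain n hJ hJ' a b).dx k f)
        = (if k = i then 1 else 0) * (overlapDomain n hJ hJ' a b).dx k f := fun k => by
      rw [← h2, Finset.sum_mul]
      exact Finset.sum_congr rfl fun _ _ => by ring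
    simp only [h3, ite_mul, one_mul, zero_mul, Finset.sum_ite_eq', Finset.mem_univ, if_true]
    rfl
  G_eq := gram_eq_jacobian hJ hJ' a b hg
  closed i j p := SpaceTime.deriv_comm _ _ _ _

theorem isMap_transition : CoordMetric.IsMap ((chartDomain n hJ hJ' b).metric hg subset_rfl)
    (transportedMetric hJ hJ' a b hg) (transitionHom hJ hJ' a b) where
  d_eq q f := by
    have h := Matrix.mul_nonsing_inv _ (isUnit_det_jacobian hJ hJ' a b hg)
    have h2 : ∀ k, ∑ i, jacobian hJ hJ' a b k i * (jacobian hJ hJ' a b)⁻¹ i q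
        = if k = q then 1 else 0 := fun k => by
      rw [← Matrix.mul_apply, h, Matrix.one_apply]
    simp only [transportedMetric_d, dx_transitionHom, Finset.mul_sum]
    rw [Finset.sum_comm]
    have h3 : ∀ k, ∑ i, (jacobian hJ hJ' a b)⁻¹ i q * (jacobian hJ hJ' a b k i
        * transitionHom hJ hJ' a b ((chartDomain n hJ hJ' b).dx k f))
        = (if k = q then 1 else 0) * transitionHom hJ hJ' a b ((chartDomain n hJ hJ' b).dx k f) :=
      fun k => by
      rw [← h2, Finset.sum_mul]
      exact Finset.sum_congr rfl fun _ _ => by ring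
    simp only [h3, ite_mul, one_mul, zero_mul, Finset.sum_ite_eq', Finset.mem_univ, if_true]
    rfl
  G_eq i j := rfl

omit [IsManifold (𝓡 n) ∞ M] in
theorem overlap_of_mem {a b x : M} (ha : x ∈ (extChartAt (𝓡 n) a).source)
    (hb : x ∈ (extChartAt (𝓡 n) b).source) : extChartAt (𝓡 n) a x ∈ overlap (n := n) a b :=
  ⟨(extChartAt (𝓡 n) a).map_source ha, by
    rw [mem_preimage, (extChartAt (𝓡 n) a).left_inv ha]; exact hb⟩

variable {a b} {u v : ℝ → M → ℝ} (hu : ChartSmooth n u J) (hv : ChartSmooth n v J)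

theorem transitionHom_fn :
    transitionHom hJ hJ' a b ((chartDomain n hJ hJ' b).fn subset_rfl hu)
      = (overlapDomain n hJ hJ' a b).fn (overlap_subset a b) hu :=
  SpaceTime.ev_ext _ fun p => by
    rw [ev_transitionHom, SpaceTime.ev_fn, SpaceTime.ev_fn]
    exact congrArg (u p.1.1) (symm_transition p.2.2)

include hJ hJ' hg

theorem scalarLocal_transition {t : ℝ} (ht : t ∈ J) {y : 𝔼}
    (hy : y ∈ overlap (n := n) a b) :
    scalarLocal (g t) a y = scalarLocal (g t) b (transition a b y) := by
  have h := (isCoordChange hJ hJ' a b hg).scal_eq.trans (isMap_transition hJ hJ' a b hg).scal_eq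
  have h2 := congrArg ((overlapDomain n hJ hJ' a b).ev ⟨(t, y), ht, hy⟩) h
  rwa [SpaceTime.ev_scal, ev_transitionHom, SpaceTime.ev_scal] at h2

include hu in
theorem lapLocal_transition {t : ℝ} (ht : t ∈ J) {y : 𝔼}
    (hy : y ∈ overlap (n := n) a b) :
    lapLocal (g t) (u t) a y = lapLocal (g t) (u t) b (transition a b y) := by
  have h := ((isCoordChange hJ hJ' a b hg).lap_eq _).trans ((isMap_transition hJ hJ' a b hg).lap_eq
    ((chartDomain n hJ hJ' b).fn subset_rfl hu))
  have h2 := congrArg ((overlapDomain n hJ hJ' a b).ev ⟨(t, y), ht, hy⟩) h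
  rwa [transitionHom_fn, SpaceTime.ev_lap, ev_transitionHom, SpaceTime.ev_lap] at h2

include hu hv in
theorem gmLocal_transition {t : ℝ} (ht : t ∈ J) {y : 𝔼}
    (hy : y ∈ overlap (n := n) a b) :
    gmLocal (g t) (u t) (v t) a y = gmLocal (g t) (u t) (v t) b (transition a b y) := by
  have h := ((isCoordChange hJ hJ' a b hg).gm_eq _ _).trans ((isMap_transition hJ hJ' a b hg).gm_eq
    ((chartDomain n hJ hJ' b).fn subset_rfl hu) ((chartDomain n hJ hJ' b).fn subset_rfl hv))
  have h2 := congrArg ((overlapDomain n hJ hJ' a b).ev ⟨(t, y), ht, hy⟩) h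
  rwa [transitionHom_fn, transitionHom_fn, SpaceTime.ev_gm, ev_transitionHom,
    SpaceTime.ev_gm] at h2

include hu in
theorem gradLocal_transition {t : ℝ} (ht : t ∈ J) {y : 𝔼}
    (hy : y ∈ overlap (n := n) a b) (q : Fin n) :
    ∑ i, pd i (fun z => transition a b z q) y * gradLocal (g t) (u t) a y i
      = gradLocal (g t) (u t) b (transition a b y) q := by
  have h := ((isCoordChange hJ hJ' a b hg).nab_eq _ q).trans
    ((isMap_transition hJ hJ' a b hg).nab_eq ((chartDomain n hJ hJ' b).fn subset_rfl hu) q)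
  have h2 := congrArg ((overlapDomain n hJ hJ' a b).ev ⟨(t, y), ht, hy⟩) h
  simp only [map_sum, map_mul] at h2
  rw [transitionHom_fn, ev_transitionHom, SpaceTime.ev_nab] at h2
  simp only [SpaceTime.ev_nab, ev_jacobian] at h2
  exact h2

theorem ricciLocal_transition {t : ℝ} (ht : t ∈ J) {y : 𝔼}
    (hy : y ∈ overlap (n := n) a b) (i j : Fin n) : ricciLocal (g t) a y i j
    = ∑ p, ∑ q, pd i (fun z => transition a b z p) y * pd j (fun z => transition a b z q) y
      * ricciLocal (g t) b (transition a b y) p q := by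
  have h := congrFun (congrFun (isCoordChange hJ hJ' a b hg).ric_eq i) j
  have h2 := congrArg ((overlapDomain n hJ hJ' a b).ev ⟨(t, y), ht, hy⟩) h
  simp only [Matrix.mul_apply, Matrix.of_apply, Matrix.transpose_apply, map_sum, map_mul,
    Finset.sum_mul, ev_jacobian, (isMap_transition hJ hJ' a b hg).ric_eq, ev_transitionHom,
    SpaceTime.ev_ric] at h2
  rw [h2, Finset.sum_comm]
  exact Finset.sum_congr rfl fun _ _ => Finset.sum_congr rfl fun _ _ => mul_right_comm _ _ _

end Transition
end ChartExpressions
end RicciTransport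

/-! ### The global operators in an arbitrary fixed chart. -/

namespace RicciTransport

open Set

namespace CoordMetric

variable {ι A : Type*} [Fintype ι] [DecidableEq ι] [CommRing A] [Algebra ℝ A]
  (m : CoordMetric ι A)

theorem sum_G_mul_nab (f : A) (p : ι) : ∑ q, m.G p q * m.nab f q = m.d p f := by
  have h : ∀ j, ∑ q, m.G p q * m.H q j = if p = j then 1 else 0 := fun j => by
    rw [← Matrix.mul_apply, m.mul_eq_one, Matrix.one_apply]
  simp only [nab, Finset.mul_sum, ← mul_assoc]
  rw [Finset.sum_comm]
  simp only [← Finset.sum_mul, h, ite_mul, one_mul, zero_mul, Finset.sum_ite_eq, Finset.mem_univ,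
    if_true]

theorem sum_nab_mul_nab_mul_G (f h : A) :
    ∑ p, ∑ q, m.nab f p * m.nab h q * m.G p q = m.gm f h := by
  rw [gm_eq]
  refine Finset.sum_congr rfl fun p _ => ?_
  rw [← sum_G_mul_nab, Finset.mul_sum]
  exact Finset.sum_congr rfl fun q _ => by ring

theorem div_smul_nab (w f : A) :
    ∑ i, m.d i (w * m.nab f i) + ∑ i, ∑ j, m.chr i i j * (w * m.nab f j)
      = m.gm w f + w * m.lap f := by
  have h1 : ∑ i, m.d i (w * m.nab f i)
      = w * ∑ i, m.d i (m.nab f i) + ∑ i, m.nab f i * m.d i w := by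
    rw [Finset.mul_sum, ← Finset.sum_add_distrib]
    exact Finset.sum_congr rfl fun i _ => by rw [Derivation.leibniz, smul_eq_mul, smul_eq_mul]
  have h2 : ∑ i, ∑ j, m.chr i i j * (w * m.nab f j)
      = w * ∑ i, ∑ j, m.chr i i j * m.nab f j := by
    simp only [Finset.mul_sum]
    exact Finset.sum_congr rfl fun i _ => Finset.sum_congr rfl fun j _ => by ring
  rw [lap_eq_div, gm_symm, gm_eq, h1, h2]
  ring

end CoordMetric

section Global

variable {n : ℕ} {M : Type*} [TopologicalSpace M] [ChartedSpace (EuclideanSpace ℝ (Fin n)) M]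

local notation "𝔼" => EuclideanSpace ℝ (Fin n)

theorem comp_congr (a : M) {x x' : M} (h : x = x') (v : 𝔼) (p : Fin n) :
    comp a (x := x) v p = comp a (x := x') v p := by subst h; rfl

theorem comp_sum (a x : M) (c : Fin n → ℝ) (v : Fin n → 𝔼) (p : Fin n) :
    comp a (x := x) (∑ i, c i • v i : 𝔼) p = ∑ i, c i * comp a (x := x) (v i) p := by
  set B : 𝔼 →L[ℝ] 𝔼 := mfderiv (𝓡 n) 𝓘(ℝ, 𝔼) (extChartAt (𝓡 n) a) x with hB
  change (B (∑ i, c i • v i)) p = ∑ i, c i * (B (v i)) p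
  simp [map_sum, map_smul]

theorem comp_smul (a x : M) (c : ℝ) (v : TangentSpace (𝓡 n) x) (p : Fin n) :
    comp a (c • v) p = c * comp a v p := by
  set B : 𝔼 →L[ℝ] 𝔼 := mfderiv (𝓡 n) 𝓘(ℝ, 𝔼) (extChartAt (𝓡 n) a) x with hB
  exact congrArg (fun w : 𝔼 => w p) (map_smul B c (v : 𝔼))

/-- The time derivative. -/
noncomputable def timeDeriv (J : Set ℝ) (u : ℝ → M → ℝ) (t : ℝ) (x : M) : ℝ :=
  derivWithin (fun s => u s x) J t

variable [IsManifold (𝓡 n) ∞ M]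

/-- The Laplacian. -/
noncomputable def laplacian (g : Metric n M) (f : M → ℝ) (x : M) : ℝ :=
  lapLocal g f x (extChartAt (𝓡 n) x x)

/-- The inner product of the gradients of two functions. -/
noncomputable def gradInner (g : Metric n M) (f h : M → ℝ) (x : M) : ℝ :=
  gmLocal g f h x (extChartAt (𝓡 n) x x)

variable {J : Set ℝ} (hJ : Convex ℝ J) (hJ' : (interior J).Nonempty)
  {g : ℝ → Metric n M} (hg : SmoothMetricFamily g J)

section

omit [IsManifold (𝓡 n) ∞ M]

theorem chartSmooth_of_eq {u : ℝ → M → ℝ} (F : ∀ a : M, (chartDomain n hJ hJ' a).smooth)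
    (h : ∀ (a : M) p, (chartDomain n hJ hJ' a).ev p (F a)
      = u p.1.1 ((extChartAt (𝓡 n) a).symm p.1.2)) : ChartSmooth n u J := fun a =>
  ((chartDomain n hJ hJ' a).contDiffOn_ext (F a)).congr fun p hp =>
    ((h a ⟨p, hp⟩).symm.trans ((chartDomain n hJ hJ' a).ext_apply (F a).1 ⟨p, hp⟩).symm)

theorem ChartSmooth.add {u v : ℝ → M → ℝ} (hu : ChartSmooth n u J) (hv : ChartSmooth n v J) :
    ChartSmooth n (u + v) J := fun a => (hu a).add (hv a)

theorem ChartSmooth.sub {u v : ℝ → M → ℝ} (hu : ChartSmooth n u J) (hv : ChartSmooth n v J) :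
    ChartSmooth n (u - v) J := fun a => (hu a).sub (hv a)

theorem ChartSmooth.mul {u v : ℝ → M → ℝ} (hu : ChartSmooth n u J) (hv : ChartSmooth n v J) :
    ChartSmooth n (u * v) J := fun a => (hu a).mul (hv a)

theorem ChartSmooth.log {u : ℝ → M → ℝ} (hu : ChartSmooth n u J)
    (hpos : ∀ t ∈ J, ∀ x, 0 < u t x) :
    ChartSmooth n (fun t x => Real.log (u t x)) J := fun a =>
  (hu a).log fun p hp => (hpos p.1 hp.1 _).ne'

theorem ChartSmooth.hasDerivWithinAt {u : ℝ → M → ℝ} (hu : ChartSmooth n u J) (hJ : Convex ℝ J)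
    (hJ' : (interior J).Nonempty) {t : ℝ} (ht : t ∈ J) (x : M) :
    HasDerivWithinAt (fun s => u s x) (timeDeriv J u t x) J t := by
  have h := (chartDomain n hJ hJ' x).hasDerivWithinAt_ev_dt_ofFun _ (hu x)
    ⟨(t, extChartAt (𝓡 n) x x), ht, mem_extChartAt_target x⟩
  simp only [extChartAt_to_inv] at h
  exact h.differentiableWithinAt.hasDerivWithinAt

theorem ev_dt_fn {u : ℝ → M → ℝ} (hu : ChartSmooth n u J) (a : M)
    (p : (chartDomain n hJ hJ' a).S) : (chartDomain n hJ hJ' a).ev p ((chartDomain n hJ hJ' a).dt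
      ((chartDomain n hJ hJ' a).fn subset_rfl hu))
      = timeDeriv J u p.1.1 ((extChartAt (𝓡 n) a).symm p.1.2) :=
  (((chartDomain n hJ hJ' a).hasDerivWithinAt_ev_dt_ofFun _ (hu a) p).derivWithin
    ((chartDomain n hJ hJ' a).uniqueDiffOn_J _ p.2.1)).symm

include hJ hJ' in
theorem ChartSmooth.timeDeriv {u : ℝ → M → ℝ} (hu : ChartSmooth n u J) :
    ChartSmooth n (timeDeriv J u) J :=
  chartSmooth_of_eq hJ hJ' _ fun a p => ev_dt_fn hJ hJ' hu a p

end

omit [IsManifold (𝓡 n) ∞ M] in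
theorem transition_ext {a b x : M} (hx : x ∈ (extChartAt (𝓡 n) a).source) :
    transition a b (extChartAt (𝓡 n) a x) = extChartAt (𝓡 n) b x := by
  rw [transition, (extChartAt (𝓡 n) a).left_inv hx]

variable {t : ℝ} (ht : t ∈ J)

include hJ hJ' hg ht

/-- The definition uses a chart that moves with x. Passing to a fixed chart is what allows the
function to be differentiated. -/
theorem scalar_eq_scalarLocal {a x : M} (hx : x ∈ (extChartAt (𝓡 n) a).source) :
    scalar (g t) x = scalarLocal (g t) a (extChartAt (𝓡 n) a x) := by
  rw [scalarLocal_transition hJ hJ' hg ht (overlap_of_mem hx (mem_extChartAt_source x)),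
    transition_ext hx]
  rfl

theorem laplacian_eq_lapLocal {u : ℝ → M → ℝ} (hu : ChartSmooth n u J) {a x : M}
    (hx : x ∈ (extChartAt (𝓡 n) a).source) :
    laplacian (g t) (u t) x = lapLocal (g t) (u t) a (extChartAt (𝓡 n) a x) := by
  rw [lapLocal_transition hJ hJ' hg hu ht (overlap_of_mem hx (mem_extChartAt_source x)),
    transition_ext hx]
  rfl

theorem gradInner_eq_gmLocal {u v : ℝ → M → ℝ} (hu : ChartSmooth n u J) (hv : ChartSmooth n v J)
    {a x : M} (hx : x ∈ (extChartAt (𝓡 n) a).source) :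
    gradInner (g t) (u t) (v t) x = gmLocal (g t) (u t) (v t) a (extChartAt (𝓡 n) a x) := by
  rw [gmLocal_transition hJ hJ' hg hu hv ht (overlap_of_mem hx (mem_extChartAt_source x)),
    transition_ext hx]
  rfl

theorem comp_grad {u : ℝ → M → ℝ} (hu : ChartSmooth n u J) {a x : M}
    (hx : x ∈ (extChartAt (𝓡 n) a).source) (p : Fin n) :
    comp a (grad (g t) (u t) x) p = gradLocal (g t) (u t) a (extChartAt (𝓡 n) a x) p := by
  have hy := overlap_of_mem (n := n) (mem_extChartAt_source (I := 𝓡 n) x) hx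
  have h1 : comp a (grad (g t) (u t) x) p
      = ∑ i, gradLocal (g t) (u t) x (extChartAt (𝓡 n) x x) i
        * comp a (x := x) (frame x (extChartAt (𝓡 n) x x) i : 𝔼) p :=
    comp_sum a x _ (fun i => frame x (extChartAt (𝓡 n) x x) i) p
  have h2 : ∀ i, comp a (x := x) (frame x (extChartAt (𝓡 n) x x) i : 𝔼) p
      = pd i (fun z => transition x a z p) (extChartAt (𝓡 n) x x) := fun i =>
    (comp_congr a (extChartAt_to_inv x).symm _ p).trans (comp_frame hy i p)
  simp only [h1, h2]
  rw [← transition_ext (b := a) (mem_extChartAt_source x),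
    ← gradLocal_transition hJ hJ' hg hu ht hy]
  exact Finset.sum_congr rfl fun i _ => mul_comm _ _

omit ht

/-- The scalar curvature in a chart. -/
theorem ev_scal_eq_scalar (a : M) (p : (chartDomain n hJ hJ' a).S) :
    (chartDomain n hJ hJ' a).ev p ((chartDomain n hJ hJ' a).metric hg subset_rfl).scal
      = scalar (g p.1.1) ((extChartAt (𝓡 n) a).symm p.1.2) := by
  rw [SpaceTime.ev_scal, scalar_eq_scalarLocal hJ hJ' hg p.2.1
    ((extChartAt (𝓡 n) a).map_target p.2.2), (extChartAt (𝓡 n) a).right_inv p.2.2]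

theorem chartSmooth_scalar : ChartSmooth n (fun t => scalar (g t)) J :=
  chartSmooth_of_eq hJ hJ' _ (ev_scal_eq_scalar hJ hJ' hg)

/-- Identifies the global function with the algebraic one, so that its gradient and time derivative
may be computed in the algebra. -/
theorem fn_scalar (hs : ChartSmooth n (fun t => scalar (g t)) J) (a : M) :
    (chartDomain n hJ hJ' a).fn subset_rfl hs
      = ((chartDomain n hJ hJ' a).metric hg subset_rfl).scal :=
  SpaceTime.ev_ext _ fun p => (ev_scal_eq_scalar hJ hJ' hg a p).symm

theorem ev_lap_eq_laplacian {u : ℝ → M → ℝ} (hu : ChartSmooth n u J) (a : M)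
    (p : (chartDomain n hJ hJ' a).S) : (chartDomain n hJ hJ' a).ev p
      (((chartDomain n hJ hJ' a).metric hg subset_rfl).lap
        ((chartDomain n hJ hJ' a).fn subset_rfl hu))
      = laplacian (g p.1.1) (u p.1.1) ((extChartAt (𝓡 n) a).symm p.1.2) := by
  rw [SpaceTime.ev_lap, laplacian_eq_lapLocal hJ hJ' hg p.2.1 hu
    ((extChartAt (𝓡 n) a).map_target p.2.2), (extChartAt (𝓡 n) a).right_inv p.2.2]

theorem ChartSmooth.laplacian {u : ℝ → M → ℝ} (hu : ChartSmooth n u J) :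
    ChartSmooth n (fun t => laplacian (g t) (u t)) J :=
  chartSmooth_of_eq hJ hJ' _ (ev_lap_eq_laplacian hJ hJ' hg hu)

theorem ev_gm_eq_gradInner {u v : ℝ → M → ℝ} (hu : ChartSmooth n u J) (hv : ChartSmooth n v J)
    (a : M) (p : (chartDomain n hJ hJ' a).S) : (chartDomain n hJ hJ' a).ev p
      (((chartDomain n hJ hJ' a).metric hg subset_rfl).gm
        ((chartDomain n hJ hJ' a).fn subset_rfl hu) ((chartDomain n hJ hJ' a).fn subset_rfl hv))
      = gradInner (g p.1.1) (u p.1.1) (v p.1.1) ((extChartAt (𝓡 n) a).symm p.1.2) := by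
  rw [SpaceTime.ev_gm, gradInner_eq_gmLocal hJ hJ' hg p.2.1 hu hv
    ((extChartAt (𝓡 n) a).map_target p.2.2), (extChartAt (𝓡 n) a).right_inv p.2.2]

theorem ChartSmooth.gradInner {u v : ℝ → M → ℝ} (hu : ChartSmooth n u J)
    (hv : ChartSmooth n v J) : ChartSmooth n (fun t => gradInner (g t) (u t) (v t)) J :=
  chartSmooth_of_eq hJ hJ' _ (ev_gm_eq_gradInner hJ hJ' hg hu hv)

include ht

theorem inner_grad {u v : ℝ → M → ℝ} (hu : ChartSmooth n u J) (hv : ChartSmooth n v J) (x : M) :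
    (g t).inner x (grad (g t) (u t) x) (grad (g t) (v t) x)
      = gradInner (g t) (u t) (v t) x := by
  have hx := mem_extChartAt_source (I := 𝓡 n) x
  have h := congrArg ((chartDomain n hJ hJ' x).ev
      ⟨(t, extChartAt (𝓡 n) x x), ht, mem_extChartAt_target x⟩)
    (((chartDomain n hJ hJ' x).metric hg subset_rfl).sum_nab_mul_nab_mul_G
      ((chartDomain n hJ hJ' x).fn subset_rfl hu) ((chartDomain n hJ hJ' x).fn subset_rfl hv))
  rw [SpaceTime.ev_gm] at h
  simp only [map_sum, map_mul, SpaceTime.ev_nab] at h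
  rw [inner_eq_sum (g t) hx]
  simp only [comp_grad hJ hJ' hg ht hu hx, comp_grad hJ hJ' hg ht hv hx]
  exact h

theorem divergence_smul_grad {u v : ℝ → M → ℝ} (hu : ChartSmooth n u J)
    (hv : ChartSmooth n v J) (x : M) :
    divergence (g t) (fun z => u t z • grad (g t) (v t) z) x
      = gradInner (g t) (u t) (v t) x + u t x * laplacian (g t) (v t) x := by
  have hx := mem_extChartAt_source (I := 𝓡 n) x
  set D := chartDomain n hJ hJ' x with hD
  set p : D.S := ⟨(t, extChartAt (𝓡 n) x x), ht, mem_extChartAt_target x⟩ with hp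
  -- The divergence differentiates the components, so they must be known throughout the chart and
  -- not only at x.
  have hcomp : ∀ z (hz : z ∈ (extChartAt (𝓡 n) x).target) (i : Fin n),
      comp x (u t ((extChartAt (𝓡 n) x).symm z) • grad (g t) (v t) ((extChartAt (𝓡 n) x).symm z)) i
      = D.ev ⟨(t, z), ht, hz⟩ (D.fn subset_rfl hu * (D.metric hg subset_rfl).nab
          (D.fn subset_rfl hv) i) := by
    intro z hz i
    rw [comp_smul, comp_grad hJ hJ' hg ht hv ((extChartAt (𝓡 n) x).map_target hz),
      (extChartAt (𝓡 n) x).right_inv hz, map_mul, SpaceTime.ev_nab]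
    rfl
  have h := congrArg (D.ev p) ((D.metric hg subset_rfl).div_smul_nab (D.fn subset_rfl hu)
    (D.fn subset_rfl hv))
  rw [map_add, map_add, map_mul, ev_gm_eq_gradInner, ev_lap_eq_laplacian, map_sum, map_sum,
    SpaceTime.ev_fn] at h
  simp only [map_sum, map_mul, SpaceTime.ev_chr, SpaceTime.ev_nab, SpaceTime.ev_fn] at h
  have hd : ∀ i, D.ev p ((D.metric hg subset_rfl).d i (D.fn subset_rfl hu
      * (D.metric hg subset_rfl).nab (D.fn subset_rfl hv) i))
      = pd i (fun z => comp x (u t ((extChartAt (𝓡 n) x).symm z)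
        • grad (g t) (v t) ((extChartAt (𝓡 n) x).symm z)) i) (extChartAt (𝓡 n) x x) := fun i =>
    D.ev_dx_of_eqOn i _ p fun z hz => hcomp z hz i
  simp only [hd] at h
  rw [show (extChartAt (𝓡 n) x).symm p.1.2 = x from extChartAt_to_inv x] at h
  rw [divergence]
  simp only [comp_smul x x, comp_grad hJ hJ' hg ht hv hx]
  exact h

end Global
end RicciTransport

/-! ### The pointwise identities on the manifold. -/

namespace RicciTransport

open Set

section Flow

variable {n : ℕ} {M : Type*} [TopologicalSpace M] [ChartedSpace (EuclideanSpace ℝ (Fin n)) M]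
  [IsManifold (𝓡 n) ∞ M]

local notation "𝔼" => EuclideanSpace ℝ (Fin n)

variable {J : Set ℝ} (hJ : Convex ℝ J) (hJ' : (interior J).Nonempty)
  {g : ℝ → Metric n M} (hg : IsRicciFlow g J)

-- The flow equation evaluates Ricci in the preferred chart at the point; tensoriality moves it to
-- the fixed chart around a.
include hJ hJ' hg in
theorem hasDerivWithinAt_gram (a : M) {t : ℝ} (ht : t ∈ J) {y : 𝔼}
    (hy : y ∈ (extChartAt (𝓡 n) a).target) (i j : Fin n) :
    HasDerivWithinAt (fun s => gram (g s) a y i j) (-2 * ricciLocal (g t) a y i j) J t := by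
  have h2 := hg.flow t ht ((extChartAt (𝓡 n) a).symm y) (frame a y i) (frame a y j)
  have hx := mem_extChartAt_source (I := 𝓡 n) ((extChartAt (𝓡 n) a).symm y)
  have hy' : y ∈ overlap (n := n) a ((extChartAt (𝓡 n) a).symm y) := ⟨hy, hx⟩
  have h3 : ricci (g t) ((extChartAt (𝓡 n) a).symm y) (frame a y i) (frame a y j)
      = ricciLocal (g t) a y i j := by
    rw [ricciLocal_transition hJ hJ' hg.smooth ht hy' i j, ricci]
    simp only [comp_frame hy']
    refine Finset.sum_congr rfl fun k _ => Finset.sum_congr rfl fun l _ => ?_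
    rw [mul_assoc]
    exact mul_comm _ _
  rw [h3] at h2
  exact h2

theorem dt_G (a : M) (i j : Fin n) : (chartDomain n hJ hJ' a).dt
      (((chartDomain n hJ hJ' a).metric hg.smooth subset_rfl).G i j)
      = -2 * ((chartDomain n hJ hJ' a).metric hg.smooth subset_rfl).ric i j := by
  refine SpaceTime.ev_ext _ fun p => ?_
  have h1 : HasDerivWithinAt (fun s => gram (g s) a p.1.2 i j) ((chartDomain n hJ hJ' a).ev p
      ((chartDomain n hJ hJ' a).dt
        (((chartDomain n hJ hJ' a).metric hg.smooth subset_rfl).G i j))) J p.1.1 :=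
    (chartDomain n hJ hJ' a).hasDerivWithinAt_ev_dt_ofFun _ (contDiffOn_gram hg.smooth a i j) p
  have h2 := hasDerivWithinAt_gram hJ hJ' hg a p.2.1 p.2.2 i j
  have h3 : (chartDomain n hJ hJ' a).ev p
      (-2 * ((chartDomain n hJ hJ' a).metric hg.smooth subset_rfl).ric i j)
      = -2 * ricciLocal (g p.1.1) a p.1.2 i j := by
    rw [map_mul, SpaceTime.ev_ric, map_neg, map_ofNat]
  rw [h3]
  exact ((chartDomain n hJ hJ' a).uniqueDiffOn_J _ p.2.1).eq_deriv _ h1 h2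

variable {φ : ℝ → M → ℝ} (hφ : ChartSmooth n φ J) (hHJ : HamiltonJacobiEq g φ J)
include hJ hJ' hg hφ

include hHJ in
theorem timeDeriv_of_hamiltonJacobi {t : ℝ} (ht : t ∈ J) (x : M) : timeDeriv J φ t x
    = -(1 / 2) * gradInner (g t) (φ t) (φ t) x + (1 / 2) * scalar (g t) x := by
  have h := (hHJ t ht x).derivWithin
    ((uniqueDiffOn_convex hJ hJ') t ht)
  rw [inner_grad hJ hJ' hg.smooth ht hφ hφ] at h
  exact h

theorem timeDeriv_of_transport {ρ : ℝ → M → ℝ} (hρ : ChartSmooth n ρ J)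
    (hT : TransportEq g ρ φ J) {t : ℝ} (ht : t ∈ J) (x : M) : timeDeriv J ρ t x
    = -(gradInner (g t) (ρ t) (φ t) x + ρ t x * laplacian (g t) (φ t) x)
      + scalar (g t) x * ρ t x := by
  have h := (hT t ht x).derivWithin
    ((uniqueDiffOn_convex hJ hJ') t ht)
  rw [divergence_smul_grad hJ hJ' hg.smooth ht hρ hφ] at h
  exact h

/-- The expression on the right is the one produced by both algebraic identities `flow_scal_sub_lap`
and `flow_energy`. -/
theorem half_harnack {t : ℝ} (ht : t ∈ J) (x : M) :
    (1 / 2 : ℝ) * harnack g J t x (grad (g t) (φ t) x)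
      = (chartDomain n hJ hJ' x).ev ⟨(t, extChartAt (𝓡 n) x x), ht, mem_extChartAt_target x⟩
      ((1 / 2 : ℝ) • (chartDomain n hJ hJ' x).dt
          ((chartDomain n hJ hJ' x).metric hg.smooth subset_rfl).scal
        + ((chartDomain n hJ hJ' x).metric hg.smooth subset_rfl).gm
          ((chartDomain n hJ hJ' x).metric hg.smooth subset_rfl).scal
          ((chartDomain n hJ hJ' x).fn subset_rfl hφ)
        + ∑ k, ∑ l, ((chartDomain n hJ hJ' x).metric hg.smooth subset_rfl).ric k l
          * ((chartDomain n hJ hJ' x).metric hg.smooth subset_rfl).nab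
            ((chartDomain n hJ hJ' x).fn subset_rfl hφ) k
          * ((chartDomain n hJ hJ' x).metric hg.smooth subset_rfl).nab
            ((chartDomain n hJ hJ' x).fn subset_rfl hφ) l) := by
  have hs := chartSmooth_scalar hJ hJ' hg.smooth
  have hx := mem_extChartAt_source (I := 𝓡 n) x
  rw [← fn_scalar hJ hJ' hg.smooth hs]
  simp only [map_add, map_smul, map_sum, map_mul, ev_gm_eq_gradInner, ev_dt_fn,
    SpaceTime.ev_ric, SpaceTime.ev_nab, extChartAt_to_inv, smul_eq_mul]
  rw [harnack, inner_grad hJ hJ' hg.smooth ht hs hφ, ricci]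
  simp only [comp_grad hJ hJ' hg.smooth ht hφ hx]
  simp only [timeDeriv]
  ring

include hHJ

theorem dt_fn_of_hamiltonJacobi (a : M) : (chartDomain n hJ hJ' a).dt
      ((chartDomain n hJ hJ' a).fn subset_rfl hφ)
      = -(1 / 2 : ℝ) • ((chartDomain n hJ hJ' a).metric hg.smooth subset_rfl).gm
          ((chartDomain n hJ hJ' a).fn subset_rfl hφ) ((chartDomain n hJ hJ' a).fn subset_rfl hφ)
        + (1 / 2 : ℝ) • ((chartDomain n hJ hJ' a).metric hg.smooth subset_rfl).scal := by
  refine SpaceTime.ev_ext _ fun p => ?_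
  rw [ev_dt_fn, timeDeriv_of_hamiltonJacobi hJ hJ' hg hφ hHJ p.2.1, map_add, map_smul, map_smul,
    ev_gm_eq_gradInner, ev_scal_eq_scalar]
  rfl

/-- The derivative of `R - Δφ` along the flow of `∇φ`. -/
theorem timeDeriv_scalar_sub_laplacian {t : ℝ} (ht : t ∈ J) (x : M) :
    timeDeriv J (fun t => scalar (g t) - laplacian (g t) (φ t)) t x
      + gradInner (g t) (scalar (g t) - laplacian (g t) (φ t)) (φ t) x
      = normSqRicciSubHess (g t) (φ t) x
        + (1 / 2) * harnack g J t x (grad (g t) (φ t) x) := by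
  have hs := chartSmooth_scalar hJ hJ' hg.smooth
  have hl := hφ.laplacian hJ hJ' hg.smooth
  have hfn : (chartDomain n hJ hJ' x).fn subset_rfl (hs.sub hl)
      = ((chartDomain n hJ hJ' x).metric hg.smooth subset_rfl).scal
        - ((chartDomain n hJ hJ' x).metric hg.smooth subset_rfl).lap
          ((chartDomain n hJ hJ' x).fn subset_rfl hφ) := by
    refine SpaceTime.ev_ext _ fun p => ?_
    rw [map_sub, ev_scal_eq_scalar, ev_lap_eq_laplacian]
    rfl
  have h := congrArg ((chartDomain n hJ hJ' x).ev
    ⟨(t, extChartAt (𝓡 n) x x), ht, mem_extChartAt_target x⟩)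
    (((chartDomain n hJ hJ' x).metric hg.smooth subset_rfl).flow_scal_sub_lap
      (SpaceTime.metric_comm _ _ _) (chartDomain n hJ hJ' x).dt
      (fun i f => (chartDomain n hJ hJ' x).deriv_comm _ _ f) (dt_G hJ hJ' hg x) _
      (dt_fn_of_hamiltonJacobi hJ hJ' hg hφ hHJ x))
  rw [map_add, map_add, ← half_harnack hJ hJ' hg hφ ht x, ← hfn, ev_dt_fn,
    ev_gm_eq_gradInner, SpaceTime.ev_nsq] at h
  simp only [extChartAt_to_inv] at h
  exact h

/-- The derivative of `|∇φ|² + R` along the flow of `∇φ`. -/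
theorem timeDeriv_gradInner_add_scalar {t : ℝ} (ht : t ∈ J) (x : M) :
    (1 / 2) * (timeDeriv J (fun t => gradInner (g t) (φ t) (φ t) + scalar (g t)) t x
      + gradInner (g t) (gradInner (g t) (φ t) (φ t) + scalar (g t)) (φ t) x)
      = (1 / 2) * harnack g J t x (grad (g t) (φ t) x) := by
  have hs := chartSmooth_scalar hJ hJ' hg.smooth
  have hl := hφ.gradInner hJ hJ' hg.smooth hφ
  have hfn : (chartDomain n hJ hJ' x).fn subset_rfl (hl.add hs)
      = ((chartDomain n hJ hJ' x).metric hg.smooth subset_rfl).gm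
          ((chartDomain n hJ hJ' x).fn subset_rfl hφ) ((chartDomain n hJ hJ' x).fn subset_rfl hφ)
        + ((chartDomain n hJ hJ' x).metric hg.smooth subset_rfl).scal := by
    refine SpaceTime.ev_ext _ fun p => ?_
    rw [map_add, ev_scal_eq_scalar, ev_gm_eq_gradInner]
    rfl
  have h := congrArg ((chartDomain n hJ hJ' x).ev
    ⟨(t, extChartAt (𝓡 n) x x), ht, mem_extChartAt_target x⟩)
    (((chartDomain n hJ hJ' x).metric hg.smooth subset_rfl).flow_energy
      (chartDomain n hJ hJ' x).dt
      (fun i f => (chartDomain n hJ hJ' x).deriv_comm _ _ f) (dt_G hJ hJ' hg x) _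
      (dt_fn_of_hamiltonJacobi hJ hJ' hg hφ hHJ x))
  rw [← half_harnack hJ hJ' hg hφ ht x, ← hfn, map_smul, map_add, ev_dt_fn,
    ev_gm_eq_gradInner] at h
  simp only [extChartAt_to_inv] at h
  exact h

end Flow
end RicciTransport

/-! ### Derivatives of the determinant and of the volume density. -/

namespace RicciTransport

namespace CoordMetric

open Matrix Finset

variable {ι A : Type*} [Fintype ι] [DecidableEq ι] [CommRing A] [Algebra ℝ A]

omit [Fintype ι] in
theorem derivation_prod (D : Derivation ℝ A A) (s : Finset ι) (f : ι → A) :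
    D (∏ i ∈ s, f i) = ∑ k ∈ s, (∏ i ∈ s.erase k, f i) * D (f k) := by
  induction s using Finset.induction_on with
  | empty => simp
  | insert a s ha ih =>
    rw [prod_insert ha, Derivation.leibniz, sum_insert ha, erase_insert ha, ih, smul_eq_mul,
      smul_eq_mul, add_comm, mul_sum]
    congr 1
    refine sum_congr rfl fun k hk => ?_
    have hne : a ≠ k := fun h => ha (h ▸ hk)
    rw [erase_insert_of_ne hne, prod_insert (fun h => ha (mem_of_mem_erase h)), mul_assoc]

/-- Jacobi's formula. -/
theorem derivation_det (D : Derivation ℝ A A) (N : Matrix ι ι A) :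
    D N.det = trace (N.adjugate * N.map D) := by
  -- The determinant is multilinear in its columns, so it is differentiated one column at a time;
  -- Cramer's rule then brings in the adjugate.
  have h1 : D N.det = ∑ k, (N.updateCol k fun i => D (N i k)).det := by
    simp only [det_apply', map_sum]
    rw [sum_comm]
    refine sum_congr rfl fun σ _ => ?_
    have h2 : D (((Equiv.Perm.sign σ : ℤ) : A)) = 0 := D.map_intCast _
    rw [Derivation.leibniz, h2, smul_zero, add_zero, derivation_prod, smul_eq_mul, mul_sum]
    refine sum_congr rfl fun k _ => ?_
    congr 1
    rw [← Finset.mul_prod_erase univ _ (mem_univ k), updateCol_self, mul_comm]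
    congr 1
    exact prod_congr rfl fun i hi => by rw [updateCol_ne (ne_of_mem_erase hi)]
  rw [h1, trace]
  refine sum_congr rfl fun k _ => ?_
  rw [← cramer_apply, cramer_eq_adjugate_mulVec]
  rfl

variable (m : CoordMetric ι A)

theorem derivation_det_metric (D : Derivation ℝ A A) :
    D m.G.det = m.G.det * trace (m.H * m.G.map D) := by
  have h : m.G.adjugate = m.G.det • m.H := by
    calc m.G.adjugate = m.G.adjugate * (m.G * m.H) := by rw [m.mul_eq_one, mul_one]
      _ = m.G.det • m.H := by rw [← Matrix.mul_assoc, adjugate_mul, smul_mul, one_mul]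
  rw [derivation_det, h, smul_mul, trace_smul, smul_eq_mul]

variable {s : A} (hs : IsUnit s) (hs2 : s * s = m.G.det)

include hs hs2

/-- Here s plays the role of √det g; one factor s is cancelled from the derivative of s². -/
theorem two_mul_derivation_sqrt_det (D : Derivation ℝ A A) :
    D s + D s = s * trace (m.H * m.G.map D) := by
  have h := m.derivation_det_metric D
  rw [← hs2, Derivation.leibniz, smul_eq_mul, mul_assoc, ← mul_add] at h
  exact hs.mul_left_cancel h

/-- The algebraic form of ∂_t dvol = -R dvol. -/
theorem flow_sqrt_det (τ : Derivation ℝ A A) (hflow : ∀ i j, τ (m.G i j) = -2 * m.ric i j) :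
    τ s = -(m.scal * s) := by
  have h := m.two_mul_derivation_sqrt_det hs hs2 τ
  rw [m.trace_H_mul_flow τ hflow] at h
  refine sub_eq_zero.mp (eq_zero_of_add_self ?_)
  linear_combination h

theorem d_sqrt_det (i : ι) : m.d i s = s * ∑ k, m.chr k i k := by
  have h := m.two_mul_derivation_sqrt_det hs hs2 (m.d i)
  rw [← m.two_smul_sum_chr] at h
  refine sub_eq_zero.mp (eq_zero_of_add_self ?_)
  linear_combination h

/-- The divergence of `w ∇f`, times the volume density. -/
theorem sum_d_mul_sqrt_det (w f : A) :
    ∑ i, m.d i (w * m.nab f i * s) = (m.gm w f + w * m.lap f) * s := by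
  have h : ∀ i, m.d i (w * m.nab f i * s)
      = m.d i (w * m.nab f i) * s + (∑ k, m.chr k k i * (w * m.nab f i)) * s := fun i => by
    rw [Derivation.leibniz, m.d_sqrt_det hs hs2, smul_eq_mul, smul_eq_mul, ← sum_mul]
    simp only [m.chr_symm _ i]
    ring
  rw [sum_congr rfl fun i _ => h i, sum_add_distrib, ← sum_mul, ← sum_mul, ← add_mul,
    ← m.div_smul_nab]
  congr 2
  rw [sum_comm]

end CoordMetric

end RicciTransport

/-! ### The Riemannian measure through charts. -/

namespace RicciTransport

open Set MeasureTheory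

theorem integrableOn_of_eq_zero_off_compact {E : Type*} [TopologicalSpace E] [T2Space E]
    [MeasurableSpace E] [BorelSpace E] {μ : Measure E} [IsFiniteMeasureOnCompacts μ] {F : E → ℝ}
    {U K : Set E} (hU : MeasurableSet U) (hF : ContinuousOn F U) (hK : IsCompact K) (hKU : K ⊆ U)
    (h0 : ∀ y ∈ U \ K, F y = 0) : IntegrableOn F U μ :=
  ((hF.mono hKU).integrableOn_compact' hK hK.measurableSet).of_forall_sdiff_eq_zero hU h0

section Volume

variable {n : ℕ} {M : Type*} [TopologicalSpace M] [ChartedSpace (EuclideanSpace ℝ (Fin n)) M]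
  [IsManifold (𝓡 n) ∞ M]

local notation "𝔼" => EuclideanSpace ℝ (Fin n)

/-- The volume density in the chart around `a`. -/
noncomputable def density (g : Metric n M) (a : M) (y : 𝔼) : ℝ := Real.sqrt (gram g a y).det

omit [IsManifold (𝓡 n) ∞ M] in
theorem injOn_transition (a b : M) : InjOn (transition (n := n) a b) (overlap a b) := by
  intro y hy z hz h
  have := congrArg (extChartAt (𝓡 n) b).symm h
  rw [symm_transition hy, symm_transition hz] at this
  exact (extChartAt (𝓡 n) a).symm.injOn hy.1 hz.1 this

omit [IsManifold (𝓡 n) ∞ M] in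
theorem transition_mem_overlap {a b : M} {y : 𝔼} (hy : y ∈ overlap (n := n) a b) :
    transition a b y ∈ overlap (n := n) b a :=
  ⟨transition_mem hy, by
    rw [mem_preimage, symm_transition hy]; exact (extChartAt (𝓡 n) a).map_target hy.1⟩

omit [IsManifold (𝓡 n) ∞ M] in
theorem image_transition (a b : M) :
    transition (n := n) a b '' overlap a b = overlap b a := by
  refine Subset.antisymm (image_subset_iff.mpr fun y hy => transition_mem_overlap hy) ?_
  intro z hz
  refine ⟨transition b a z, transition_mem_overlap hz, ?_⟩
  rw [transition, symm_transition hz]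
  exact (extChartAt (𝓡 n) b).right_inv hz.1

theorem hasFDerivAt_transition {a b : M} {y : 𝔼} (hy : y ∈ overlap (n := n) a b) :
    HasFDerivAt (transition a b) (fderiv ℝ (transition a b) y) y :=
  (((contDiffOn_transition a b).contDiffAt
    ((isOpen_overlap a b).mem_nhds hy)).differentiableAt (by simp)).hasFDerivAt

theorem pd_transition {a b : M} {y : 𝔼} (hy : y ∈ overlap (n := n) a b) (i q : Fin n) :
    pd i (fun z => transition a b z q) y
      = fderiv ℝ (transition a b) y (EuclideanSpace.single i 1) q := by
  have h2 : HasFDerivAt (fun z => transition a b z q)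
      ((EuclideanSpace.proj q : 𝔼 →L[ℝ] ℝ).comp (fderiv ℝ (transition a b) y)) y :=
    (EuclideanSpace.proj q : 𝔼 →L[ℝ] ℝ).hasFDerivAt.comp y (hasFDerivAt_transition hy)
  rw [pd, h2.fderiv]
  rfl

/-- The determinant of Nᵀ g N is det g times a square, whose root is the absolute value of the
Jacobian. -/
theorem density_transition (g : Metric n M) {a b : M} {y : 𝔼} (hy : y ∈ overlap (n := n) a b) :
    density g a y = |(fderiv ℝ (transition a b) y).det| * density g b (transition a b y) := by
  set N : Matrix (Fin n) (Fin n) ℝ :=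
    Matrix.of fun q i => pd i (fun z => transition a b z q) y with hN
  have h1 : (fderiv ℝ (transition a b) y).det = N.det := by
    rw [ContinuousLinearMap.det,
      ← LinearMap.det_toMatrix (EuclideanSpace.basisFun (Fin n) ℝ).toBasis]
    congr 1
    ext q i
    rw [LinearMap.toMatrix_apply, hN, Matrix.of_apply, pd_transition hy]
    simp
  have h2 : gram g a y = N.transpose * gram g b (transition a b y) * N := by
    ext i j
    rw [gram_transition g hy]
    simp only [Matrix.mul_apply, Matrix.transpose_apply, Finset.sum_mul, hN, Matrix.of_apply]
    rw [Finset.sum_comm]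
    exact Finset.sum_congr rfl fun _ _ => Finset.sum_congr rfl fun _ _ => by ring
  rw [density, density, h1, h2, Matrix.det_mul, Matrix.det_mul, Matrix.det_transpose,
    mul_right_comm, Real.sqrt_mul (mul_self_nonneg _), Real.sqrt_mul_self_eq_abs]

theorem setIntegral_overlap (g : Metric n M) (a b : M) (f : M → ℝ) :
    ∫ y in overlap (n := n) a b, density g a y * f ((extChartAt (𝓡 n) a).symm y)
      = ∫ y in overlap (n := n) b a, density g b y * f ((extChartAt (𝓡 n) b).symm y) := by
  rw [← image_transition a b, integral_image_eq_integral_abs_det_fderiv_smul volume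
    (isOpen_overlap a b).measurableSet (fun y hy => (hasFDerivAt_transition hy).hasFDerivWithinAt)
    (injOn_transition a b)]
  refine setIntegral_congr_fun (isOpen_overlap a b).measurableSet fun y hy => ?_
  rw [density_transition g hy, symm_transition hy, smul_eq_mul, mul_assoc]

/-- The image in the chart around `a` of a set. -/
def chartImage (n : ℕ) {M : Type*} [TopologicalSpace M]
    [ChartedSpace (EuclideanSpace ℝ (Fin n)) M] (a : M) (C : Set M) :
    Set (EuclideanSpace ℝ (Fin n)) :=
  extChartAt (𝓡 n) a '' C

omit [IsManifold (𝓡 n) ∞ M] in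
theorem chartImage_subset {a : M} {C : Set M} (hC : C ⊆ (extChartAt (𝓡 n) a).source) :
    chartImage n a C ⊆ (extChartAt (𝓡 n) a).target :=
  image_subset_iff.mpr fun _ hx => (extChartAt (𝓡 n) a).map_source (hC hx)

omit [IsManifold (𝓡 n) ∞ M] in
theorem isCompact_chartImage {a : M} {C : Set M} (hC : C ⊆ (extChartAt (𝓡 n) a).source)
    (hc : IsCompact C) : IsCompact (chartImage n a C) :=
  hc.image_of_continuousOn ((continuousOn_extChartAt a).mono hC)

omit [IsManifold (𝓡 n) ∞ M] in
theorem symm_notMem {a : M} {C : Set M} {y : 𝔼}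
    (hy : y ∈ (extChartAt (𝓡 n) a).target \ chartImage n a C) :
    (extChartAt (𝓡 n) a).symm y ∉ C := fun h =>
  hy.2 ⟨_, h, (extChartAt (𝓡 n) a).right_inv hy.1⟩

variable [T2Space M] [CompactSpace M]

theorem continuous_partition (a : M) : Continuous (partition n M a) :=
  (partition n M a).2.continuous

theorem tsupport_partition_subset (a : M) :
    tsupport (partition n M a) ⊆ (extChartAt (𝓡 n) a).source := by
  rw [extChartAt_source]
  exact (SmoothPartitionOfUnity.exists_isSubordinate_chartAt_source (𝓡 n) M).choose_spec a

/-- The charts that contribute to the volume. -/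
noncomputable def chartIndex (n : ℕ) (M : Type*) [TopologicalSpace M]
    [ChartedSpace (EuclideanSpace ℝ (Fin n)) M] [IsManifold (𝓡 n) ∞ M] [T2Space M]
    [CompactSpace M] : Finset M :=
  ((partition n M).locallyFinite.finite_nonempty_of_compact).toFinset

theorem partition_eq_zero {a : M} (ha : a ∉ chartIndex n M) (x : M) : partition n M a x = 0 := by
  by_contra h
  exact ha ((Set.Finite.mem_toFinset _).mpr ⟨x, h⟩)

theorem sum_partition (x : M) : ∑ a ∈ chartIndex n M, partition n M a x = 1 := by
  rw [← (partition n M).sum_eq_one (mem_univ x), finsum_eq_sum_of_support_subset]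
  intro a ha
  by_contra h
  exact ha (partition_eq_zero h x)

theorem partition_eq_zero_of_notMem_source {a x : M} (hx : x ∉ (extChartAt (𝓡 n) a).source) :
    partition n M a x = 0 :=
  image_eq_zero_of_notMem_tsupport fun h => hx (tsupport_partition_subset a h)

section FixedMetric

variable {g : Metric n M}
  (hg : ∀ a : M, ContinuousOn (density g a) (extChartAt (𝓡 n) a).target)

omit [T2Space M] [CompactSpace M] in
theorem continuousOn_integrand (hg : ∀ a : M, ContinuousOn (density g a)
      (extChartAt (𝓡 n) a).target) {f h : M → ℝ} (hf : Continuous f) (hh : Continuous h) (a : M) :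
    ContinuousOn (fun y => density g a y * (h ((extChartAt (𝓡 n) a).symm y)
      * f ((extChartAt (𝓡 n) a).symm y))) (extChartAt (𝓡 n) a).target :=
  (hg a).mul ((hh.comp_continuousOn (continuousOn_extChartAt_symm a)).mul
    (hf.comp_continuousOn (continuousOn_extChartAt_symm a)))

include hg

theorem integrableOn_target {f : M → ℝ} (hf : Continuous f) (a : M) :
    IntegrableOn (fun y => density g a y * (partition n M a ((extChartAt (𝓡 n) a).symm y)
      * f ((extChartAt (𝓡 n) a).symm y))) (extChartAt (𝓡 n) a).target := by
  have hs := tsupport_partition_subset (n := n) a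
  refine integrableOn_of_eq_zero_off_compact (isOpen_extChartAt_target a).measurableSet
    (continuousOn_integrand hg hf (continuous_partition a) a)
    (isCompact_chartImage hs (isClosed_tsupport _).isCompact) (chartImage_subset hs) ?_
  intro y hy
  rw [image_eq_zero_of_notMem_tsupport (symm_notMem hy), zero_mul, mul_zero]

variable [MeasurableSpace M] [BorelSpace M]

omit [T2Space M] [CompactSpace M] [IsManifold (𝓡 n) ∞ M] hg in
theorem aemeasurable_symm (a : M) : AEMeasurable (extChartAt (𝓡 n) a).symm
    (volume.restrict (extChartAt (𝓡 n) a).target) :=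
  (continuousOn_extChartAt_symm a).aemeasurable (isOpen_extChartAt_target a).measurableSet

omit [MeasurableSpace M] [BorelSpace M] in
theorem aemeasurable_weight (a : M) : AEMeasurable (fun y => ENNReal.ofReal
      (partition n M a ((extChartAt (𝓡 n) a).symm y) * Real.sqrt (gram g a y).det))
    (volume.restrict (extChartAt (𝓡 n) a).target) :=
  ((((continuous_partition a).comp_continuousOn (continuousOn_extChartAt_symm a)).mul
    (hg a)).aemeasurable (isOpen_extChartAt_target a).measurableSet).ennreal_ofReal

-- On a compact manifold a locally finite partition of unity has only finitely many nonzero members.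
omit hg [BorelSpace M] in
theorem dvol_eq_sum : dvol g = ∑ a ∈ chartIndex n M,
    ((volume.restrict (extChartAt (𝓡 n) a).target).withDensity fun y =>
      ENNReal.ofReal (partition n M a ((extChartAt (𝓡 n) a).symm y)
        * Real.sqrt (gram g a y).det)).map (extChartAt (𝓡 n) a).symm := by
  refine Measure.ext fun A hA => ?_
  rw [dvol, Measure.sum_apply _ hA, Measure.finsetSum_apply, tsum_eq_sum]
  intro a ha
  have h0 : (fun y : 𝔼 => ENNReal.ofReal (partition n M a ((extChartAt (𝓡 n) a).symm y)
      * Real.sqrt (gram g a y).det)) = 0 := by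
    funext y
    simp [partition_eq_zero ha]
  rw [h0, withDensity_zero, Measure.map_zero]
  rfl

theorem integrable_chart_measure {f : M → ℝ} (hf : Continuous f) (a : M) : Integrable f
    (((volume.restrict (extChartAt (𝓡 n) a).target).withDensity fun y =>
      ENNReal.ofReal (partition n M a ((extChartAt (𝓡 n) a).symm y)
        * Real.sqrt (gram g a y).det)).map (extChartAt (𝓡 n) a).symm) := by
  rw [integrable_map_measure hf.aestronglyMeasurable
    ((aemeasurable_symm a).mono_ac (withDensity_absolutelyContinuous _ _)),
    integrable_withDensity_iff_integrable_smul₀' (aemeasurable_weight hg a)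
    (Filter.Eventually.of_forall fun y => ENNReal.ofReal_lt_top)]
  refine (integrableOn_target hg hf a).congr (Filter.Eventually.of_forall fun y => ?_)
  simp only [Function.comp, smul_eq_mul]
  rw [ENNReal.toReal_ofReal (mul_nonneg ((partition n M).nonneg a _) (Real.sqrt_nonneg _)),
    density]
  ring

theorem integrable_dvol {f : M → ℝ} (hf : Continuous f) : Integrable f (dvol g) := by
  rw [dvol_eq_sum, integrable_finsetSum_measure]
  exact fun a _ => integrable_chart_measure hg hf a

theorem integral_dvol {f : M → ℝ} (hf : Continuous f) : ∫ x, f x ∂(dvol g)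
    = ∑ a ∈ chartIndex n M, ∫ y in (extChartAt (𝓡 n) a).target, density g a y
      * (partition n M a ((extChartAt (𝓡 n) a).symm y) * f ((extChartAt (𝓡 n) a).symm y)) := by
  rw [dvol_eq_sum, integral_finsetSum_measure fun a _ => integrable_chart_measure hg hf a]
  refine Finset.sum_congr rfl fun a _ => ?_
  rw [integral_map ((aemeasurable_symm a).mono_ac (withDensity_absolutelyContinuous _ _))
    hf.aestronglyMeasurable, integral_withDensity_eq_integral_toReal_smul₀
    (aemeasurable_weight hg a) (Filter.Eventually.of_forall fun y => ENNReal.ofReal_lt_top)]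
  refine integral_congr_ae (Filter.Eventually.of_forall fun y => ?_)
  simp only [smul_eq_mul]
  rw [ENNReal.toReal_ofReal (mul_nonneg ((partition n M).nonneg a _) (Real.sqrt_nonneg _)),
    density]
  ring

/-- The integral of a function supported in the domain of a chart. -/
theorem integral_dvol_of_support {f : M → ℝ} (hf : Continuous f) {b : M} {C : Set M}
    (hC : IsClosed C) (hCb : C ⊆ (extChartAt (𝓡 n) b).source) (h0 : ∀ x ∉ C, f x = 0) :
    ∫ x, f x ∂(dvol g)
      = ∫ y in (extChartAt (𝓡 n) b).target, density g b y * f ((extChartAt (𝓡 n) b).symm y) := by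
  have hsub : ∀ a b : M, overlap (n := n) a b ⊆ (extChartAt (𝓡 n) a).target := overlap_subset
  -- Both integrals live on the overlap: in chart a because f is supported in the domain of b, in
  -- chart b because the weight is supported in the domain of a. There the change of variables
  -- applies, and the weights then sum to 1.
  have hterm : ∀ a : M, ∫ y in (extChartAt (𝓡 n) a).target, density g a y
      * (partition n M a ((extChartAt (𝓡 n) a).symm y) * f ((extChartAt (𝓡 n) a).symm y))
      = ∫ y in (extChartAt (𝓡 n) b).target, density g b y
      * (partition n M a ((extChartAt (𝓡 n) b).symm y) * f ((extChartAt (𝓡 n) b).symm y)) := by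
    intro a
    rw [setIntegral_eq_of_subset_of_forall_sdiff_eq_zero
      (isOpen_extChartAt_target a).measurableSet (hsub a b) (fun y hy => ?_),
      setIntegral_eq_of_subset_of_forall_sdiff_eq_zero
      (isOpen_extChartAt_target b).measurableSet (hsub b a) (fun y hy => ?_)]
    · exact setIntegral_overlap g a b fun x => partition n M a x * f x
    · rw [partition_eq_zero_of_notMem_source fun h => hy.2 ⟨hy.1, h⟩, zero_mul, mul_zero]
    · rw [h0 _ fun h => hy.2 ⟨hy.1, hCb h⟩, mul_zero, mul_zero]
  rw [integral_dvol hg hf, Finset.sum_congr rfl fun a _ => hterm a, ← integral_finsetSum]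
  · refine setIntegral_congr_fun (isOpen_extChartAt_target b).measurableSet fun y hy => ?_
    rw [← Finset.mul_sum, ← Finset.sum_mul, sum_partition, one_mul]
  · intro a _
    refine integrableOn_of_eq_zero_off_compact (isOpen_extChartAt_target b).measurableSet
      (continuousOn_integrand hg hf (continuous_partition a) b)
      (isCompact_chartImage hCb hC.isCompact) (chartImage_subset hCb) ?_
    intro y hy
    rw [h0 _ (symm_notMem hy), mul_zero, mul_zero]

end FixedMetric
end Volume
end RicciTransport

/-! ### Differentiation under the integral sign and Green's formula. -/

namespace RicciTransport

open Set MeasureTheory Filter Topology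

/-- Differentiation under the integral sign, on a compact interval (one-sided at the endpoints) and
over a compact set. -/
theorem hasDerivWithinAt_setIntegral {E : Type*} [TopologicalSpace E] [T2Space E]
    [MeasurableSpace E] [BorelSpace E] {μ : Measure E} [IsFiniteMeasureOnCompacts μ]
    {t₀ t₁ : ℝ} {K : Set E} (hK : IsCompact K) {F F' : ℝ → E → ℝ}
    (hF : ∀ t ∈ Icc t₀ t₁, ContinuousOn (F t) K)
    (hF' : ContinuousOn (fun p : ℝ × E => F' p.1 p.2) (Icc t₀ t₁ ×ˢ K))
    (hd : ∀ t ∈ Icc t₀ t₁, ∀ y ∈ K,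
      HasDerivWithinAt (fun s => F s y) (F' t y) (Icc t₀ t₁) t)
    {t : ℝ} (ht : t ∈ Icc t₀ t₁) :
    HasDerivWithinAt (fun s => ∫ y in K, F s y ∂μ) (∫ y in K, F' t y ∂μ) (Icc t₀ t₁) t := by
  obtain ⟨C, hC⟩ := (isCompact_Icc.prod hK).exists_bound_of_continuousOn hF'
  have hint : ∀ s ∈ Icc t₀ t₁, Integrable (F s) (μ.restrict K) := fun s hs =>
    (hF s hs).integrableOn_compact' hK hK.measurableSet
  have hmem : ∀ᶠ s in 𝓝[Icc t₀ t₁ \ {t}] t, s ∈ Icc t₀ t₁ := by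
    filter_upwards [self_mem_nhdsWithin] with s hs using hs.1
  have hfin : IsFiniteMeasure (μ.restrict K) := ⟨by
    rw [Measure.restrict_apply_univ]; exact hK.measure_lt_top⟩
  rw [hasDerivWithinAt_iff_tendsto_slope]
  have hlim : Tendsto (fun s => ∫ y in K, slope (fun s => F s y) t s ∂μ) (𝓝[Icc t₀ t₁ \ {t}] t)
      (𝓝 (∫ y in K, F' t y ∂μ)) := by
    refine tendsto_integral_filter_of_dominated_convergence (fun _ => C) ?_ ?_
      (integrable_const _) ?_
    · filter_upwards [hmem] with s hs
      exact (((hint s hs).sub (hint t ht)).const_mul (s - t)⁻¹).aestronglyMeasurable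
    · filter_upwards [self_mem_nhdsWithin] with s hs
      filter_upwards [ae_restrict_mem hK.measurableSet] with y hy
      -- The mean value inequality on the interval bounds every difference quotient by the maximum C
      -- of the derivative on the compact product, so C serves as the dominating function.
      have h := (convex_Icc t₀ t₁).norm_image_sub_le_of_norm_hasDerivWithin_le
        (fun r hr => hd r hr y hy) (fun r hr => hC (r, y) ⟨hr, hy⟩) ht hs.1
      rw [slope_def_field, norm_div, div_le_iff₀ (norm_pos_iff.mpr (sub_ne_zero.mpr hs.2))]
      exact h
    · filter_upwards [ae_restrict_mem hK.measurableSet] with y hy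
      exact hasDerivWithinAt_iff_tendsto_slope.mp (hd t ht y hy)
  refine hlim.congr' ?_
  filter_upwards [hmem] with s hs
  simp only [slope_def_field]
  rw [integral_div, integral_sub (hint s hs) (hint t ht)]

section Green

variable {n : ℕ}

local notation "𝔼" => EuclideanSpace ℝ (Fin n)

/-- Extended by zero, f is C¹ with compact support on the whole space; integration by parts against
the constant 1 gives the result. -/
theorem integral_pd_eq_zero {U K : Set 𝔼} (hU : IsOpen U) (hK : IsCompact K) (hKU : K ⊆ U)
    {f : 𝔼 → ℝ} (hf : ContDiffOn ℝ 1 f U) (h0 : ∀ y ∈ U \ K, f y = 0) (i : Fin n) :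
    IntegrableOn (pd i f) U ∧ ∫ y in U, pd i f y = 0 := by
  set F : 𝔼 → ℝ := U.indicator f with hFdef
  have hFU : ∀ y ∈ U, F =ᶠ[𝓝 y] f := fun y hy => by
    filter_upwards [hU.mem_nhds hy] with z hz using indicator_of_mem hz f
  have hFK : ∀ y ∉ K, F y = 0 := fun y hy => by
    by_cases h : y ∈ U
    · rw [hFdef, indicator_of_mem h, h0 y ⟨h, hy⟩]
    · exact indicator_of_notMem h f
  have hFC : ContDiff ℝ 1 F := by
    rw [contDiff_iff_contDiffAt]
    intro y
    by_cases h : y ∈ U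
    · exact (hf.contDiffAt (hU.mem_nhds h)).congr_of_eventuallyEq (hFU y h)
    · have : F =ᶠ[𝓝 y] fun _ => 0 := by
        filter_upwards [hK.isClosed.isOpen_compl.mem_nhds fun hk => h (hKU hk)] with z hz
          using hFK z hz
      exact contDiffAt_const.congr_of_eventuallyEq this
  have hFs : HasCompactSupport F := HasCompactSupport.intro hK hFK
  have hder : ∀ y ∈ U, pd i f y = fderiv ℝ F y (EuclideanSpace.single i 1) := fun y hy => by
    rw [(hFU y hy).fderiv_eq, pd]
  have hint : Integrable (fun y => fderiv ℝ F y (EuclideanSpace.single i 1)) :=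
    ((hFC.continuous_fderiv (by simp)).clm_apply continuous_const).integrable_of_hasCompactSupport
      (hFs.fderiv_apply ℝ _)
  refine ⟨(hint.integrableOn).congr_fun (fun y hy => (hder y hy).symm) hU.measurableSet, ?_⟩
  rw [setIntegral_congr_fun hU.measurableSet hder, setIntegral_eq_integral_of_forall_compl_eq_zero]
  · have h := integral_mul_fderiv_eq_neg_fderiv_mul_of_integrable (μ := volume)
      (f := fun _ : 𝔼 => (1 : ℝ)) (g := F) (v := EuclideanSpace.single i 1)
      (by simp) (by simpa using hint)
      (by simpa using hFC.continuous.integrable_of_hasCompactSupport hFs)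
      (fun _ _ => differentiableAt_const _) (fun y _ => hFC.differentiable (by simp) y)
    simpa using h
  · intro y hy
    have : F =ᶠ[𝓝 y] fun _ => 0 := by
      filter_upwards [hK.isClosed.isOpen_compl.mem_nhds fun hk => hy (hKU hk)] with z hz
        using hFK z hz
    rw [this.fderiv_eq]
    simp

end Green

section

variable {n : ℕ} {M : Type*} [TopologicalSpace M] [ChartedSpace (EuclideanSpace ℝ (Fin n)) M]
  [IsManifold (𝓡 n) ∞ M]

local notation "𝔼" => EuclideanSpace ℝ (Fin n)

theorem SpaceTime.contDiffOn_ext_slice (D : SpaceTime n) (f : D.smooth) {t : ℝ} (ht : t ∈ D.J) :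
    ContDiffOn ℝ ∞ (fun y => D.ext f.1 (t, y)) D.U :=
  (D.contDiffOn_ext f).comp (contDiffOn_const.prodMk contDiffOn_id) fun _ hy => ⟨ht, hy⟩

variable {J : Set ℝ} (hJ : Convex ℝ J) (hJ' : (interior J).Nonempty) {g : ℝ → Metric n M}

omit [IsManifold (𝓡 n) ∞ M] in
theorem ChartSmooth.continuous {u : ℝ → M → ℝ} (hu : ChartSmooth n u J) {t : ℝ} (ht : t ∈ J) :
    Continuous (u t) := by
  rw [continuous_iff_continuousAt]
  intro x
  have h1 : ContinuousOn (fun y => u t ((extChartAt (𝓡 n) x).symm y))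
      (extChartAt (𝓡 n) x).target :=
    (hu x).continuousOn.comp (continuousOn_const.prodMk continuousOn_id) fun _ hy => ⟨ht, hy⟩
  have h2 := (h1.continuousAt (extChartAt_target_mem_nhds x)).comp (continuousAt_extChartAt x)
  refine h2.congr ?_
  filter_upwards [extChartAt_source_mem_nhds (I := 𝓡 n) x] with z hz
  exact congrArg (u t) ((extChartAt (𝓡 n) x).left_inv hz)

/-- Places √det g inside the algebra, as the element s required by the density formulas. -/
theorem exists_density (hg : SmoothMetricFamily g J) (a : M) :
    ∃ s : (chartDomain n hJ hJ' a).smooth, IsUnit s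
      ∧ s * s = ((chartDomain n hJ hJ' a).metric hg subset_rfl).G.det
      ∧ ∀ p, (chartDomain n hJ hJ' a).ev p s = density (g p.1.1) a p.1.2 := by
  have hdet : ∀ p, (chartDomain n hJ hJ' a).ev p
      ((chartDomain n hJ hJ' a).metric hg subset_rfl).G.det = (gram (g p.1.1) a p.1.2).det :=
    fun p => SpaceTime.ev_det_gramMatrix _ hg subset_rfl p
  have hpos : ∀ p : (chartDomain n hJ hJ' a).S, 0 < (gram (g p.1.1) a p.1.2).det := fun p =>
    gram_det_pos _ p.2.2
  obtain ⟨s, hs⟩ := (chartDomain n hJ hJ' a).exists_sqrt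
    ((chartDomain n hJ hJ' a).metric hg subset_rfl).G.det fun p => by
      rw [hdet]; exact hpos p
  refine ⟨s, SpaceTime.isUnit_of_ne_zero _ s fun p => ?_, SpaceTime.ev_ext _ fun p => ?_,
    fun p => by rw [hs, hdet]; rfl⟩
  · rw [hs, hdet]
    exact (Real.sqrt_pos.mpr (hpos p)).ne'
  · rw [map_mul, hs, hdet]
    exact Real.mul_self_sqrt (hpos p).le

include hJ hJ' in
theorem continuousOn_density (hg : SmoothMetricFamily g J) {t : ℝ} (ht : t ∈ J) (a : M) :
    ContinuousOn (density (g t) a) (extChartAt (𝓡 n) a).target := by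
  obtain ⟨s, -, -, hs⟩ := exists_density hJ hJ' hg a
  refine ((chartDomain n hJ hJ' a).contDiffOn_ext_slice s ht).continuousOn.congr fun y hy => ?_
  exact (hs ⟨(t, y), ht, hy⟩).symm.trans
    ((chartDomain n hJ hJ' a).ext_apply s.1 ⟨(t, y), ht, hy⟩).symm

variable (hg : SmoothMetricFamily g J) {w φ : ℝ → M → ℝ} (hw : ChartSmooth n w J)
  (hφ : ChartSmooth n φ J) {t : ℝ} (ht : t ∈ J)

include hJ hJ' hg hw hφ ht

/-- Green's formula in a chart. -/
theorem setIntegral_divergence {b : M} {C : Set M} (hC : IsCompact C)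
    (hCb : C ⊆ (extChartAt (𝓡 n) b).source) (h0 : ∀ x ∉ C, w t x = 0) :
    ∫ y in (extChartAt (𝓡 n) b).target, density (g t) b y
      * (gradInner (g t) (w t) (φ t) ((extChartAt (𝓡 n) b).symm y)
        + w t ((extChartAt (𝓡 n) b).symm y)
          * laplacian (g t) (φ t) ((extChartAt (𝓡 n) b).symm y)) = 0 := by
  set D := chartDomain n hJ hJ' b with hD
  set m := D.metric hg subset_rfl with hm
  obtain ⟨s, hsu, hss, hs⟩ := exists_density hJ hJ' hg b
  -- The vector density √g w∇φ: its ordinary coordinate divergence is √g times the Riemannian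
  -- divergence of w∇φ, so the Euclidean result applies componentwise.
  set V : Fin n → D.smooth := fun i => D.fn subset_rfl hw * m.nab (D.fn subset_rfl hφ) i * s
    with hV
  have h1 : ∀ i, IntegrableOn (pd i fun y => D.ext (V i).1 (t, y)) (extChartAt (𝓡 n) b).target ∧
      ∫ y in (extChartAt (𝓡 n) b).target, pd i (fun y => D.ext (V i).1 (t, y)) y = 0 := fun i => by
    refine integral_pd_eq_zero (isOpen_extChartAt_target b) (isCompact_chartImage hCb hC)
      (chartImage_subset hCb) ((D.contDiffOn_ext_slice (V i) ht).of_le (by simp)) ?_ i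
    intro y hy
    rw [D.ext_apply (V i).1 ⟨(t, y), ht, hy.1⟩]
    change D.ev ⟨(t, y), ht, hy.1⟩ (V i) = 0
    rw [hV, map_mul, map_mul, SpaceTime.ev_fn, h0 _ (symm_notMem hy), zero_mul, zero_mul]
  have h2 : ∫ y in (extChartAt (𝓡 n) b).target, ∑ i, pd i (fun y => D.ext (V i).1 (t, y)) y = 0 := by
    rw [integral_finsetSum _ fun i _ => (h1 i).1]
    exact Finset.sum_eq_zero fun i _ => (h1 i).2
  rw [← h2]
  refine setIntegral_congr_fun (isOpen_extChartAt_target b).measurableSet fun y hy => ?_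
  have h3 := congrArg (D.ev ⟨(t, y), ht, hy⟩)
    (m.sum_d_mul_sqrt_det hsu hss (D.fn subset_rfl hw) (D.fn subset_rfl hφ))
  rw [map_sum, map_mul, map_add, map_mul, ev_gm_eq_gradInner, ev_lap_eq_laplacian,
    SpaceTime.ev_fn, hs] at h3
  refine (mul_comm _ _).trans (h3.symm.trans (Finset.sum_congr rfl fun i _ => ?_))
  exact D.ev_dx i (V i) ⟨(t, y), ht, hy⟩

omit hw hφ in
theorem gradInner_mul {u v : ℝ → M → ℝ} (hu : ChartSmooth n u J) (hv : ChartSmooth n v J)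
    (hφ : ChartSmooth n φ J) (x : M) :
    gradInner (g t) (u t * v t) (φ t) x
      = u t x * gradInner (g t) (v t) (φ t) x + v t x * gradInner (g t) (u t) (φ t) x := by
  set D := chartDomain n hJ hJ' x with hD
  set m := D.metric hg subset_rfl with hm
  have h : m.gm (D.fn subset_rfl (hu.mul hv)) (D.fn subset_rfl hφ)
      = D.fn subset_rfl hu * m.gm (D.fn subset_rfl hv) (D.fn subset_rfl hφ)
        + D.fn subset_rfl hv * m.gm (D.fn subset_rfl hu) (D.fn subset_rfl hφ) := by
    have hfn : D.fn subset_rfl (hu.mul hv) = D.fn subset_rfl hu * D.fn subset_rfl hv := rfl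
    rw [hfn]
    simp only [CoordMetric.gm, Derivation.leibniz, smul_eq_mul, Finset.mul_sum,
      ← Finset.sum_add_distrib]
    exact Finset.sum_congr rfl fun _ _ => Finset.sum_congr rfl fun _ _ => by ring
  have h2 := congrArg (D.ev ⟨(t, extChartAt (𝓡 n) x x), ht, mem_extChartAt_target x⟩) h
  rw [map_add, map_mul, map_mul, ev_gm_eq_gradInner, ev_gm_eq_gradInner, ev_gm_eq_gradInner,
    SpaceTime.ev_fn, SpaceTime.ev_fn] at h2
  simp only [extChartAt_to_inv] at h2
  exact h2

variable [T2Space M] [CompactSpace M]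

omit hJ hJ' hg hw hφ ht in
theorem chartSmooth_partition (b : M) : ChartSmooth n (fun _ => partition n M b) J :=
  SmoothFunFamily.chartSmooth
    ((partition n M b).2.comp contMDiff_snd).contMDiffOn

/-- Additivity in the first argument; no gradient of a partition function has to be isolated. -/
theorem gradInner_eq_sum_partition (x : M) : gradInner (g t) (w t) (φ t) x
    = ∑ b ∈ chartIndex n M, gradInner (g t) (⇑(partition n M b) * w t) (φ t) x := by
  set D := chartDomain n hJ hJ' x with hD
  set m := D.metric hg subset_rfl with hm
  set W : M → D.smooth := fun b => D.fn subset_rfl ((chartSmooth_partition (J := J) b).mul hw)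
    with hW
  have hfn : D.fn subset_rfl hw = ∑ b ∈ chartIndex n M, W b := by
    refine D.ev_ext fun p => ?_
    rw [map_sum, SpaceTime.ev_fn]
    simp only [hW, SpaceTime.ev_fn, Pi.mul_apply]
    rw [← Finset.sum_mul, sum_partition, one_mul]
  have h : m.gm (D.fn subset_rfl hw) (D.fn subset_rfl hφ)
      = ∑ b ∈ chartIndex n M, m.gm (W b) (D.fn subset_rfl hφ) := by
    rw [hfn, m.gm_symm, m.gm_eq]
    simp only [map_sum, Finset.mul_sum]
    rw [Finset.sum_comm]
    exact Finset.sum_congr rfl fun b _ => by rw [m.gm_symm, m.gm_eq]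
  have h2 := congrArg (D.ev ⟨(t, extChartAt (𝓡 n) x x), ht, mem_extChartAt_target x⟩) h
  rw [map_sum, ev_gm_eq_gradInner] at h2
  simp only [extChartAt_to_inv] at h2
  refine h2.trans (Finset.sum_congr rfl fun b _ => ?_)
  refine (ev_gm_eq_gradInner hJ hJ' hg ((chartSmooth_partition b).mul hw) hφ x _).trans ?_
  rw [extChartAt_to_inv]
  rfl

omit hJ hJ' hg hw hφ ht [T2Space M] [CompactSpace M] in
theorem gradInner_eq_zero (h : Metric n M) (u v : M → ℝ) {x : M} (hx : x ∉ tsupport u) :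
    gradInner h u v x = 0 := by
  have h1 : localFun x u =ᶠ[𝓝 (extChartAt (𝓡 n) x x)] fun _ => 0 := by
    have h2 : ∀ᶠ z in 𝓝 ((extChartAt (𝓡 n) x).symm (extChartAt (𝓡 n) x x)), u z = 0 := by
      rw [extChartAt_to_inv]
      exact notMem_tsupport_iff_eventuallyEq.mp hx
    exact (continuousAt_extChartAt_symm x).eventually h2
  have h3 : ∀ i, pd i (localFun x u) (extChartAt (𝓡 n) x x) = 0 := fun i => by
    rw [pd, h1.fderiv_eq]
    simp
  simp only [gradInner, gmLocal, h3, mul_zero, zero_mul, Finset.sum_const_zero]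

variable [MeasurableSpace M] [BorelSpace M]

/-- Green's formula. -/
theorem integral_divergence :
    ∫ x, (gradInner (g t) (w t) (φ t) x + w t x * laplacian (g t) (φ t) x) ∂(dvol (g t)) = 0 := by
  have hden := continuousOn_density hJ hJ' hg ht
  have hη : ∀ b : M, ChartSmooth n (fun t => ⇑(partition n M b) * w t) J := fun b =>
    (chartSmooth_partition b).mul hw
  have hcont : ∀ b : M, Continuous fun x => gradInner (g t) (⇑(partition n M b) * w t) (φ t) x
      + (partition n M b x * w t x) * laplacian (g t) (φ t) x := fun b =>
    (((hη b).gradInner hJ hJ' hg hφ).add ((hη b).mul (hφ.laplacian hJ hJ' hg))).continuous ht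
  -- Cutting w by the partition of unity reduces the formula to pieces each supported in one chart.
  have h1 : ∀ x, gradInner (g t) (w t) (φ t) x + w t x * laplacian (g t) (φ t) x
      = ∑ b ∈ chartIndex n M, (gradInner (g t) (⇑(partition n M b) * w t) (φ t) x
        + (partition n M b x * w t x) * laplacian (g t) (φ t) x) := fun x => by
    rw [Finset.sum_add_distrib, ← gradInner_eq_sum_partition hJ hJ' hg hw hφ ht, ← Finset.sum_mul,
      ← Finset.sum_mul, sum_partition, one_mul]
  simp only [h1]
  rw [integral_finsetSum _ fun b _ => integrable_dvol hden (hcont b)]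
  refine Finset.sum_eq_zero fun b _ => ?_
  have hzero : ∀ x ∉ tsupport (partition n M b), partition n M b x * w t x = 0 := fun x hx => by
    rw [image_eq_zero_of_notMem_tsupport hx, zero_mul]
  rw [integral_dvol_of_support hden (hcont b) (isClosed_tsupport (partition n M b))
    (tsupport_partition_subset b)]
  · exact setIntegral_divergence hJ hJ' hg (hη b) hφ ht (isClosed_tsupport _).isCompact
      (tsupport_partition_subset b) hzero
  · intro x hx
    rw [hzero x hx, zero_mul, add_zero]
    refine gradInner_eq_zero _ _ _ fun h => hx ?_
    exact closure_mono (Function.support_mul_subset_left _ _) h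

end
end RicciTransport

/-! ### Time derivatives of integrals under the Ricci flow. -/

namespace RicciTransport

open Set MeasureTheory

theorem nonempty_interior_Icc {t₀ t₁ : ℝ} (hlt : t₀ < t₁) : (interior (Icc t₀ t₁)).Nonempty := by
  rw [interior_Icc]
  exact nonempty_Ioo.mpr hlt

section

variable {n : ℕ} {M : Type*} [TopologicalSpace M] [ChartedSpace (EuclideanSpace ℝ (Fin n)) M]
  [IsManifold (𝓡 n) ∞ M]

local notation "𝔼" => EuclideanSpace ℝ (Fin n)

/-- This is the quadratic form of g⁻¹ ⊗ g⁻¹, and a Kronecker product of positive semidefinite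
matrices is positive semidefinite. -/
theorem normSqRicciSubHess_nonneg (g : Metric n M) (f : M → ℝ) (x : M) :
    0 ≤ normSqRicciSubHess g f x := by
  have hpos := (gram_posDef g (mem_extChartAt_target (I := 𝓡 n) x)).inv.posSemidef
  have h := (hpos.kronecker hpos).dotProduct_mulVec_nonneg fun p : Fin n × Fin n =>
    ricciLocal g x (extChartAt (𝓡 n) x x) p.1 p.2 - hessLocal g f x (extChartAt (𝓡 n) x x) p.1 p.2
  refine h.trans_eq ?_
  simp only [dotProduct, Matrix.mulVec, Fintype.sum_prod_type, Finset.mul_sum, Pi.star_apply,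
    star_trivial, Matrix.kroneckerMap_apply, normSqRicciSubHess, gramInv]
  exact Finset.sum_congr rfl fun _ _ => Finset.sum_congr rfl fun _ _ => Finset.sum_congr rfl
    fun _ _ => Finset.sum_congr rfl fun _ _ => by ring

variable [T2Space M] [CompactSpace M] [MeasurableSpace M] [BorelSpace M]
  {t₀ t₁ : ℝ} (hlt : t₀ < t₁) {g : ℝ → Metric n M} (hg : IsRicciFlow g (Icc t₀ t₁))
  {f : ℝ → M → ℝ} (hf : ChartSmooth n f (Icc t₀ t₁)) {t : ℝ} (ht : t ∈ Icc t₀ t₁)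

include hlt hg hf ht

/-- The derivative of an integral under the Ricci flow. -/
theorem hasDerivWithinAt_integral_dvol :
    HasDerivWithinAt (fun s => ∫ x, f s x ∂(dvol (g s)))
      (∫ x, (timeDeriv (Icc t₀ t₁) f t x - scalar (g t) x * f t x) ∂(dvol (g t)))
      (Icc t₀ t₁) t := by
  have hJ : Convex ℝ (Icc t₀ t₁) := convex_Icc t₀ t₁
  have hJ' := nonempty_interior_Icc hlt
  have hden : ∀ s ∈ Icc t₀ t₁, ∀ a : M,
      ContinuousOn (density (g s) a) (extChartAt (𝓡 n) a).target := fun s hs =>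
    continuousOn_density hJ hJ' hg.smooth hs
  have hf' : ChartSmooth n (fun t x => timeDeriv (Icc t₀ t₁) f t x - scalar (g t) x * f t x)
      (Icc t₀ t₁) :=
    (hf.timeDeriv hJ hJ').sub ((chartSmooth_scalar hJ hJ' hg.smooth).mul hf)
  -- Shrinking each chart integral to the compact image of the support makes differentiation under
  -- the integral sign applicable.
  have hK : ∀ (h : M → ℝ) (s : ℝ) (a : M), ∫ y in (extChartAt (𝓡 n) a).target, density (g s) a y
      * (partition n M a ((extChartAt (𝓡 n) a).symm y) * h ((extChartAt (𝓡 n) a).symm y))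
      = ∫ y in chartImage n a (tsupport (partition n M a)), density (g s) a y
      * (partition n M a ((extChartAt (𝓡 n) a).symm y) * h ((extChartAt (𝓡 n) a).symm y)) := by
    intro h s a
    refine setIntegral_eq_of_subset_of_forall_sdiff_eq_zero
      (isOpen_extChartAt_target a).measurableSet (chartImage_subset (tsupport_partition_subset a))
      fun y hy => ?_
    rw [image_eq_zero_of_notMem_tsupport (symm_notMem hy), zero_mul, mul_zero]
  have hint : ∀ u : ℝ → M → ℝ, ChartSmooth n u (Icc t₀ t₁) → ∀ s ∈ Icc t₀ t₁,
      ∫ x, u s x ∂(dvol (g s)) = ∑ a ∈ chartIndex n M,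
        ∫ y in chartImage n a (tsupport (partition n M a)), density (g s) a y
        * (partition n M a ((extChartAt (𝓡 n) a).symm y)
          * u s ((extChartAt (𝓡 n) a).symm y)) := fun u hu s hs => by
    rw [integral_dvol (hden s hs) (hu.continuous hs)]
    exact Finset.sum_congr rfl fun a _ => hK _ _ _
  rw [hint _ hf' t ht]
  refine HasDerivWithinAt.congr ?_ (fun s hs => hint f hf s hs) (hint f hf t ht)
  refine HasDerivWithinAt.fun_sum fun a _ => ?_
  have hsub := chartImage_subset (tsupport_partition_subset (n := n) a)
  set D := chartDomain n hJ hJ' a with hD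
  obtain ⟨s, hsu, hss, hs⟩ := exists_density hJ hJ' hg.smooth a
  have hη := chartSmooth_partition (n := n) (J := Icc t₀ t₁) a
  have hds := (D.metric hg.smooth subset_rfl).flow_sqrt_det hsu hss D.dt (dt_G hJ hJ' hg a)
  have hev : ∀ p : D.S, D.ev p (D.dt (s * (D.fn subset_rfl hη * D.fn subset_rfl hf)))
      = density (g p.1.1) a p.1.2 * (partition n M a ((extChartAt (𝓡 n) a).symm p.1.2)
        * (timeDeriv (Icc t₀ t₁) f p.1.1 ((extChartAt (𝓡 n) a).symm p.1.2)
          - scalar (g p.1.1) ((extChartAt (𝓡 n) a).symm p.1.2)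
            * f p.1.1 ((extChartAt (𝓡 n) a).symm p.1.2))) := fun p => by
    -- The partition functions do not depend on time, so only f and the density contribute.
    have h0 : D.ev p (D.dt (D.fn subset_rfl hη)) = 0 := by
      rw [ev_dt_fn]
      exact congrFun (derivWithin_fun_const _ _) _
    have h1 : D.ev p (D.dt (D.fn subset_rfl hf)) = _ := ev_dt_fn hJ hJ' hf a p
    have h2 : D.ev p (D.metric hg.smooth subset_rfl).scal = _ :=
      ev_scal_eq_scalar hJ hJ' hg.smooth a p
    have h3 : D.ev p s = _ := hs p
    rw [Derivation.leibniz, Derivation.leibniz, hds]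
    simp only [smul_eq_mul, map_add, map_mul, map_neg, h0, SpaceTime.ev_fn, h1, h2, h3]
    ring
  have hdens : ContinuousOn (fun p : ℝ × 𝔼 => density (g p.1) a p.2)
      (Icc t₀ t₁ ×ˢ (extChartAt (𝓡 n) a).target) :=
    (D.contDiffOn_ext s).continuousOn.congr fun p hp =>
      (hs ⟨p, hp⟩).symm.trans (D.ext_apply s.1 ⟨p, hp⟩).symm
  refine hasDerivWithinAt_setIntegral (isCompact_chartImage (tsupport_partition_subset a)
    (isClosed_tsupport _).isCompact) (F' := fun t y => density (g t) a y *
      (partition n M a ((extChartAt (𝓡 n) a).symm y)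
        * (timeDeriv (Icc t₀ t₁) f t ((extChartAt (𝓡 n) a).symm y)
          - scalar (g t) ((extChartAt (𝓡 n) a).symm y) * f t ((extChartAt (𝓡 n) a).symm y))))
    (fun r hr => (continuousOn_integrand (hden r hr) (hf.continuous hr)
      (continuous_partition a) a).mono hsub) ?_ (fun r hr y hy => ?_) ht
  · exact (hdens.mul ((hη a).continuousOn.mul (hf' a).continuousOn)).mono (prod_mono_right hsub)
  · rw [← hev ⟨(r, y), hr, hsub hy⟩]
    refine (D.hasDerivWithinAt_ev_dt _ ⟨(r, y), hr, hsub hy⟩).congr (fun q hq => ?_) ?_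
    · refine Eq.trans ?_ (D.ext_apply _ ⟨(q, y), hq, hsub hy⟩).symm
      exact congrArg (· * _) (hs ⟨(q, y), hq, hsub hy⟩).symm
    · refine Eq.trans ?_ (D.ext_apply _ ⟨(r, y), hr, hsub hy⟩).symm
      exact congrArg (· * _) (hs ⟨(r, y), hr, hsub hy⟩).symm

/-- The derivative of the integral of a function against a transported density. -/
theorem hasDerivWithinAt_integral_mul {ρ φ : ℝ → M → ℝ} (hρ : ChartSmooth n ρ (Icc t₀ t₁))
    (hφ : ChartSmooth n φ (Icc t₀ t₁)) (hT : TransportEq g ρ φ (Icc t₀ t₁)) :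
    HasDerivWithinAt (fun s => ∫ x, f s x * ρ s x ∂(dvol (g s)))
      (∫ x, (timeDeriv (Icc t₀ t₁) f t x + gradInner (g t) (f t) (φ t) x) * ρ t x ∂(dvol (g t)))
      (Icc t₀ t₁) t := by
  have hJ : Convex ℝ (Icc t₀ t₁) := convex_Icc t₀ t₁
  have hJ' := nonempty_interior_Icc hlt
  have hden := continuousOn_density hJ hJ' hg.smooth ht (n := n) (M := M)
  have h := hasDerivWithinAt_integral_dvol hlt hg (hf.mul hρ) ht
  have hgreen := integral_divergence hJ hJ' hg.smooth (hf.mul hρ) hφ ht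
  have hc1 : Continuous fun x => timeDeriv (Icc t₀ t₁) (f * ρ) t x
      - scalar (g t) x * (f * ρ) t x :=
    (((hf.mul hρ).timeDeriv hJ hJ').sub
      ((chartSmooth_scalar hJ hJ' hg.smooth).mul (hf.mul hρ))).continuous ht
  have hc2 : Continuous fun x => gradInner (g t) ((f * ρ) t) (φ t) x
      + (f * ρ) t x * laplacian (g t) (φ t) x :=
    (((hf.mul hρ).gradInner hJ hJ' hg.smooth hφ).add
      ((hf.mul hρ).mul (hφ.laplacian hJ hJ' hg.smooth))).continuous ht
  refine h.congr_deriv ?_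
  -- The added zero is the integral of div(fρ∇φ). With it, the transport equation cancels pointwise
  -- every term containing R, Δφ or ∇ρ.
  rw [← add_zero (∫ x, _ ∂(dvol (g t))), ← hgreen,
    ← integral_add (integrable_dvol hden hc1) (integrable_dvol hden hc2)]
  refine integral_congr_ae (Filter.Eventually.of_forall fun x => ?_)
  have h1 : timeDeriv (Icc t₀ t₁) (f * ρ) t x = timeDeriv (Icc t₀ t₁) f t x * ρ t x
      + f t x * timeDeriv (Icc t₀ t₁) ρ t x :=
    ((hf.hasDerivWithinAt hJ hJ' ht x).mul (hρ.hasDerivWithinAt hJ hJ' ht x)).derivWithin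
      (uniqueDiffOn_Icc hlt t ht)
  have h2 : gradInner (g t) (f t * ρ t) (φ t) x = _ :=
    gradInner_mul hJ hJ' hg.smooth ht hf hρ hφ x
  have h3 := timeDeriv_of_transport hJ hJ' hg hφ hρ hT ht x
  simp only [h1, h2, h3, Pi.mul_apply]
  ring

end
end RicciTransport

/-! ### First and second derivatives of the entropy and of the potential term. -/

namespace RicciTransport

open Set MeasureTheory

section

variable {n : ℕ} {M : Type*} [TopologicalSpace M] [ChartedSpace (EuclideanSpace ℝ (Fin n)) M]
  [IsManifold (𝓡 n) ∞ M]

local notation "𝔼" => EuclideanSpace ℝ (Fin n)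

omit [IsManifold (𝓡 n) ∞ M] in
theorem ChartSmooth.differentiableAt_localFun {J : Set ℝ} {u : ℝ → M → ℝ}
    (hu : ChartSmooth n u J) {t : ℝ} (ht : t ∈ J) (x : M) :
    DifferentiableAt ℝ (localFun x (u t)) (extChartAt (𝓡 n) x x) :=
  (((hu x).comp (contDiffOn_const.prodMk contDiffOn_id) fun _ hy => ⟨ht, hy⟩ :
    ContDiffOn ℝ ∞ (localFun x (u t)) (extChartAt (𝓡 n) x).target).contDiffAt
      (extChartAt_target_mem_nhds x)).differentiableAt (by simp)

theorem gradInner_log_mul (g : Metric n M) {J : Set ℝ} {ρ : ℝ → M → ℝ} (hρ : ChartSmooth n ρ J)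
    {t : ℝ} (ht : t ∈ J) (hpos : ∀ x, 0 < ρ t x) (f : M → ℝ) (x : M) :
    gradInner g (fun x => Real.log (ρ t x)) f x * ρ t x = gradInner g (ρ t) f x := by
  have hx : localFun x (ρ t) (extChartAt (𝓡 n) x x) = ρ t x :=
    congrArg (ρ t) (extChartAt_to_inv x)
  have h : ∀ i, pd i (localFun x fun x => Real.log (ρ t x)) (extChartAt (𝓡 n) x x)
      = (ρ t x)⁻¹ * pd i (localFun x (ρ t)) (extChartAt (𝓡 n) x x) := fun i => by
    have h1 := (hρ.differentiableAt_localFun ht x).hasFDerivAt.log (by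
      rw [hx]; exact (hpos x).ne')
    rw [hx] at h1
    exact congrArg (fun L : 𝔼 →L[ℝ] ℝ => L (EuclideanSpace.single i 1)) h1.fderiv
  simp only [gradInner, gmLocal, h, Finset.sum_mul]
  refine Finset.sum_congr rfl fun i _ => Finset.sum_congr rfl fun j _ => ?_
  have := (hpos x).ne'
  field_simp

variable [T2Space M] [CompactSpace M] [MeasurableSpace M] [BorelSpace M]
  {t₀ t₁ : ℝ} (hlt : t₀ < t₁) {g : ℝ → Metric n M} (hg : IsRicciFlow g (Icc t₀ t₁))
  {ρ φ : ℝ → M → ℝ} (hρ : ChartSmooth n ρ (Icc t₀ t₁)) (hφ : ChartSmooth n φ (Icc t₀ t₁))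
  {t : ℝ} (ht : t ∈ Icc t₀ t₁)

omit [IsManifold (𝓡 n) ∞ M] [T2Space M] [CompactSpace M] [MeasurableSpace M] [BorelSpace M] in
theorem continuous_entropy_integrand (hρ : ChartSmooth n ρ (Icc t₀ t₁))
    (hpos : ∀ t ∈ Icc t₀ t₁, ∀ x, 0 < ρ t x) (ht : t ∈ Icc t₀ t₁) :
    Continuous fun x => ρ t x * Real.log (ρ t x) :=
  (hρ.mul (hρ.log hpos)).continuous ht

include hlt hg hρ hφ ht

/-- The case f = log ρ: multiplying by ρ turns Df into ρ_t + ⟨∇ρ,∇φ⟩, which the transport equation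
evaluates. -/
theorem hasDerivWithinAt_entropy (hpos : ∀ t ∈ Icc t₀ t₁, ∀ x, 0 < ρ t x)
    (hT : TransportEq g ρ φ (Icc t₀ t₁)) :
    HasDerivWithinAt (fun s => ∫ x, ρ s x * Real.log (ρ s x) ∂(dvol (g s)))
      (∫ x, (scalar (g t) - laplacian (g t) (φ t)) x * ρ t x ∂(dvol (g t))) (Icc t₀ t₁) t := by
  have hJ : Convex ℝ (Icc t₀ t₁) := convex_Icc t₀ t₁
  have hJ' := nonempty_interior_Icc hlt
  have h := hasDerivWithinAt_integral_mul hlt hg (hρ.log hpos) ht hρ hφ hT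
  simp only [mul_comm (Real.log _)] at h
  refine h.congr_deriv (integral_congr_ae (Filter.Eventually.of_forall fun x => ?_))
  have h1 : timeDeriv (Icc t₀ t₁) (fun t x => Real.log (ρ t x)) t x
      = timeDeriv (Icc t₀ t₁) ρ t x / ρ t x :=
    ((hρ.hasDerivWithinAt hJ hJ' ht x).log (hpos t ht x).ne').derivWithin
      (uniqueDiffOn_Icc hlt t ht)
  simp only [add_mul]
  rw [gradInner_log_mul _ hρ ht (hpos t ht), h1, div_mul_cancel₀ _ (hpos t ht x).ne',
    timeDeriv_of_transport hJ hJ' hg hφ hρ hT ht, Pi.sub_apply]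
  ring

variable (hT : TransportEq g ρ φ (Icc t₀ t₁)) (hHJ : HamiltonJacobiEq g φ (Icc t₀ t₁))
include hHJ

-- The pointwise definition in moving charts does not display continuity. The identity
-- `timeDeriv_gradInner_add_scalar` expresses the quantity through functions already known to be
-- smooth.
omit [T2Space M] [CompactSpace M] [MeasurableSpace M] [BorelSpace M] hρ in
theorem continuous_harnack : Continuous fun x =>
    harnack g (Icc t₀ t₁) t x (grad (g t) (φ t) x) := by
  have hJ : Convex ℝ (Icc t₀ t₁) := convex_Icc t₀ t₁
  have hJ' := nonempty_interior_Icc hlt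
  have h1 : ChartSmooth n (fun t => gradInner (g t) (φ t) (φ t) + scalar (g t)) (Icc t₀ t₁) :=
    (hφ.gradInner hJ hJ' hg.smooth hφ).add (chartSmooth_scalar hJ hJ' hg.smooth)
  refine (((h1.timeDeriv hJ hJ').add (h1.gradInner hJ hJ' hg.smooth hφ)).continuous ht).congr ?_
  intro x
  have h := timeDeriv_gradInner_add_scalar hJ hJ' hg hφ hHJ ht x
  simp only [Pi.add_apply]
  linarith

-- Again read off from a pointwise identity, here `timeDeriv_scalar_sub_laplacian`, after removing
-- the Harnack term.
omit [T2Space M] [CompactSpace M] [MeasurableSpace M] [BorelSpace M] hρ in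
theorem continuous_normSqRicciSubHess : Continuous (normSqRicciSubHess (g t) (φ t)) := by
  have hJ : Convex ℝ (Icc t₀ t₁) := convex_Icc t₀ t₁
  have hJ' := nonempty_interior_Icc hlt
  have h1 : ChartSmooth n (fun t => scalar (g t) - laplacian (g t) (φ t)) (Icc t₀ t₁) :=
    (chartSmooth_scalar hJ hJ' hg.smooth).sub (hφ.laplacian hJ hJ' hg.smooth)
  refine ((((h1.timeDeriv hJ hJ').add (h1.gradInner hJ hJ' hg.smooth hφ)).continuous ht).sub
    ((continuous_harnack hlt hg hφ ht hHJ).const_mul (1 / 2))).congr ?_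
  intro x
  have h := timeDeriv_scalar_sub_laplacian hJ hJ' hg hφ hHJ ht x
  simp only [Pi.sub_apply, Pi.add_apply]
  linarith

include hT

/-- The case f = R - Δφ. -/
theorem hasDerivWithinAt_deriv_entropy :
    HasDerivWithinAt (fun s => ∫ x, (scalar (g s) - laplacian (g s) (φ s)) x * ρ s x ∂(dvol (g s)))
      (∫ x, (normSqRicciSubHess (g t) (φ t) x
        + (1 / 2) * harnack g (Icc t₀ t₁) t x (grad (g t) (φ t) x)) * ρ t x ∂(dvol (g t)))
      (Icc t₀ t₁) t := by
  have hJ : Convex ℝ (Icc t₀ t₁) := convex_Icc t₀ t₁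
  have hJ' := nonempty_interior_Icc hlt
  have h1 : ChartSmooth n (fun t => scalar (g t) - laplacian (g t) (φ t)) (Icc t₀ t₁) :=
    (chartSmooth_scalar hJ hJ' hg.smooth).sub (hφ.laplacian hJ hJ' hg.smooth)
  have h := hasDerivWithinAt_integral_mul hlt hg h1 ht hρ hφ hT
  simp only [timeDeriv_scalar_sub_laplacian hJ hJ' hg hφ hHJ ht] at h
  exact h

/-- The case f = φ: by the Hamilton–Jacobi equation, φ_t + |∇φ|² = (|∇φ|² + R)/2. -/
theorem hasDerivWithinAt_potential :
    HasDerivWithinAt (fun s => ∫ x, φ s x * ρ s x ∂(dvol (g s)))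
      ((1 / 2) * ∫ x, (gradInner (g t) (φ t) (φ t) + scalar (g t)) x * ρ t x ∂(dvol (g t)))
      (Icc t₀ t₁) t := by
  have hJ : Convex ℝ (Icc t₀ t₁) := convex_Icc t₀ t₁
  have hJ' := nonempty_interior_Icc hlt
  refine (hasDerivWithinAt_integral_mul hlt hg hφ ht hρ hφ hT).congr_deriv ?_
  rw [← integral_const_mul]
  refine integral_congr_ae (Filter.Eventually.of_forall fun x => ?_)
  simp only [timeDeriv_of_hamiltonJacobi hJ hJ' hg hφ hHJ ht, Pi.add_apply]
  ring

/-- The case f = |∇φ|² + R, where no square appears and only the Harnack term is left. -/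
theorem hasDerivWithinAt_deriv_potential :
    HasDerivWithinAt
      (fun s => (1 / 2) * ∫ x, (gradInner (g s) (φ s) (φ s) + scalar (g s)) x * ρ s x ∂(dvol (g s)))
      (∫ x, (1 / 2) * harnack g (Icc t₀ t₁) t x (grad (g t) (φ t) x) * ρ t x ∂(dvol (g t)))
      (Icc t₀ t₁) t := by
  have hJ : Convex ℝ (Icc t₀ t₁) := convex_Icc t₀ t₁
  have hJ' := nonempty_interior_Icc hlt
  have h1 : ChartSmooth n (fun t => gradInner (g t) (φ t) (φ t) + scalar (g t)) (Icc t₀ t₁) :=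
    (hφ.gradInner hJ hJ' hg.smooth hφ).add (chartSmooth_scalar hJ hJ' hg.smooth)
  refine ((hasDerivWithinAt_integral_mul hlt hg h1 ht hρ hφ hT).const_mul (1 / 2)).congr_deriv ?_
  rw [← integral_const_mul]
  refine integral_congr_ae (Filter.Eventually.of_forall fun x => ?_)
  simp only
  rw [← mul_assoc, timeDeriv_gradInner_add_scalar hJ hJ' hg hφ hHJ ht]

end
end RicciTransport

/-! ### The two second-derivative formulas and convexity. -/

theorem corollary4 {n : ℕ} {M : Type*} [TopologicalSpace M]
    [ChartedSpace (EuclideanSpace ℝ (Fin n)) M] [IsManifold (𝓡 n) ∞ M]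
    [T2Space M] [CompactSpace M] [ConnectedSpace M] [MeasurableSpace M] [BorelSpace M]
    {t₀ t₁ : ℝ} (ht : t₀ < t₁)
    (g : ℝ → RicciTransport.Metric n M)
    (hg : RicciTransport.IsRicciFlow g (Set.Icc t₀ t₁))
    (ρ φ : ℝ → M → ℝ)
    (hρ : RicciTransport.SmoothFunFamily n ρ (Set.Icc t₀ t₁))
    (hφ : RicciTransport.SmoothFunFamily n φ (Set.Icc t₀ t₁))
    (hρ_pos : ∀ t ∈ Set.Icc t₀ t₁, ∀ x, 0 < ρ t x)
    (hρ_one : ∀ t ∈ Set.Icc t₀ t₁, ∫ x, ρ t x ∂(RicciTransport.dvol (g t)) = 1)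
    (h_transport : RicciTransport.TransportEq g ρ φ (Set.Icc t₀ t₁))
    (h_hamilton_jacobi : RicciTransport.HamiltonJacobiEq g φ (Set.Icc t₀ t₁)) :
    -- all the integrals below converge absolutely
    (∀ t ∈ Set.Icc t₀ t₁,
      MeasureTheory.Integrable (fun x => ρ t x * Real.log (ρ t x))
        (RicciTransport.dvol (g t)) ∧
      MeasureTheory.Integrable (fun x => φ t x * ρ t x) (RicciTransport.dvol (g t)) ∧
      MeasureTheory.Integrable
        (fun x => RicciTransport.normSqRicciSubHess (g t) (φ t) x * ρ t x)
        (RicciTransport.dvol (g t)) ∧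
      MeasureTheory.Integrable
        (fun x => RicciTransport.harnack g (Set.Icc t₀ t₁) t x
          (RicciTransport.grad (g t) (φ t) x) * ρ t x)
        (RicciTransport.dvol (g t))) ∧
    RicciTransport.HasSecondDerivOn
      (fun t => ∫ x, ρ t x * Real.log (ρ t x) ∂(RicciTransport.dvol (g t)))
      (fun t => ∫ x, (RicciTransport.normSqRicciSubHess (g t) (φ t) x
          + (1 / 2) * RicciTransport.harnack g (Set.Icc t₀ t₁) t x
              (RicciTransport.grad (g t) (φ t) x)) * ρ t x ∂(RicciTransport.dvol (g t)))
      (Set.Icc t₀ t₁) ∧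
    RicciTransport.HasSecondDerivOn
      (fun t => ∫ x, (ρ t x * Real.log (ρ t x) - φ t x * ρ t x) ∂(RicciTransport.dvol (g t)))
      (fun t => ∫ x, RicciTransport.normSqRicciSubHess (g t) (φ t) x * ρ t x
        ∂(RicciTransport.dvol (g t)))
      (Set.Icc t₀ t₁) ∧
    ConvexOn ℝ (Set.Icc t₀ t₁)
      (fun t => ∫ x, (ρ t x * Real.log (ρ t x) - φ t x * ρ t x)
        ∂(RicciTransport.dvol (g t))) := by
  have hρ' := hρ.chartSmooth
  have hφ' := hφ.chartSmooth
  have hJ : Convex ℝ (Set.Icc t₀ t₁) := convex_Icc t₀ t₁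
  have hJ' := RicciTransport.nonempty_interior_Icc ht
  have hden : ∀ t ∈ Set.Icc t₀ t₁, ∀ a : M,
      ContinuousOn (RicciTransport.density (g t) a) (extChartAt (𝓡 n) a).target := fun t htt =>
    RicciTransport.continuousOn_density hJ hJ' hg.smooth htt
  -- Every integrand is continuous on a compact manifold. Integrability is also what justifies
  -- splitting the integrals of differences and sums below.
  have hint : ∀ t ∈ Set.Icc t₀ t₁,
      MeasureTheory.Integrable (fun x => ρ t x * Real.log (ρ t x))
        (RicciTransport.dvol (g t)) ∧
      MeasureTheory.Integrable (fun x => φ t x * ρ t x) (RicciTransport.dvol (g t)) ∧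
      MeasureTheory.Integrable
        (fun x => RicciTransport.normSqRicciSubHess (g t) (φ t) x * ρ t x)
        (RicciTransport.dvol (g t)) ∧
      MeasureTheory.Integrable
        (fun x => RicciTransport.harnack g (Set.Icc t₀ t₁) t x
          (RicciTransport.grad (g t) (φ t) x) * ρ t x)
        (RicciTransport.dvol (g t)) := fun t htt =>
    have hρc := hρ'.continuous htt
    ⟨RicciTransport.integrable_dvol (hden t htt)
        (RicciTransport.continuous_entropy_integrand hρ' hρ_pos htt),
      RicciTransport.integrable_dvol (hden t htt) ((hφ'.continuous htt).mul hρc),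
      RicciTransport.integrable_dvol (hden t htt)
        ((RicciTransport.continuous_normSqRicciSubHess ht hg hφ' htt h_hamilton_jacobi).mul hρc),
      RicciTransport.integrable_dvol (hden t htt)
        ((RicciTransport.continuous_harnack ht hg hφ' htt h_hamilton_jacobi).mul hρc)⟩
  have hE : ∀ t ∈ Set.Icc t₀ t₁, _ := fun t htt =>
    RicciTransport.hasDerivWithinAt_entropy ht hg hρ' hφ' htt hρ_pos h_transport
  have hE' : ∀ t ∈ Set.Icc t₀ t₁, _ := fun t htt =>
    RicciTransport.hasDerivWithinAt_deriv_entropy ht hg hρ' hφ' htt h_transport h_hamilton_jacobi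
  have hF : ∀ t ∈ Set.Icc t₀ t₁, _ := fun t htt =>
    RicciTransport.hasDerivWithinAt_potential ht hg hρ' hφ' htt h_transport h_hamilton_jacobi
  have hF' : ∀ t ∈ Set.Icc t₀ t₁, _ := fun t htt =>
    RicciTransport.hasDerivWithinAt_deriv_potential ht hg hρ' hφ' htt h_transport
      h_hamilton_jacobi
  have hsub : ∀ t ∈ Set.Icc t₀ t₁,
      ∫ x, (ρ t x * Real.log (ρ t x) - φ t x * ρ t x) ∂(RicciTransport.dvol (g t))
        = (∫ x, ρ t x * Real.log (ρ t x) ∂(RicciTransport.dvol (g t)))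
          - ∫ x, φ t x * ρ t x ∂(RicciTransport.dvol (g t)) := fun t htt =>
    MeasureTheory.integral_sub (hint t htt).1 (hint t htt).2.1
  -- The Harnack contributions of the entropy and of the potential are identical and cancel.
  have hsub' : ∀ t ∈ Set.Icc t₀ t₁,
      (∫ x, (RicciTransport.normSqRicciSubHess (g t) (φ t) x
          + (1 / 2) * RicciTransport.harnack g (Set.Icc t₀ t₁) t x
              (RicciTransport.grad (g t) (φ t) x)) * ρ t x ∂(RicciTransport.dvol (g t)))
        - ∫ x, (1 / 2) * RicciTransport.harnack g (Set.Icc t₀ t₁) t x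
              (RicciTransport.grad (g t) (φ t) x) * ρ t x ∂(RicciTransport.dvol (g t))
      = ∫ x, RicciTransport.normSqRicciSubHess (g t) (φ t) x * ρ t x
          ∂(RicciTransport.dvol (g t)) := fun t htt => by
    have h1 := (hint t htt).2.2.1
    have h2 := (hint t htt).2.2.2.const_mul (1 / 2)
    simp only [add_mul, mul_assoc]
    rw [MeasureTheory.integral_add h1 h2, add_sub_cancel_right]
  have hG : ∀ t ∈ Set.Icc t₀ t₁, _ := fun t htt =>
    ((hE t htt).sub (hF t htt)).congr (fun s hs => hsub s hs) (hsub t htt)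
  have hG' : ∀ t ∈ Set.Icc t₀ t₁, _ := fun t htt =>
    ((hE' t htt).sub (hF' t htt)).congr_deriv (hsub' t htt)
  -- The first derivatives left to unification are ∫ (R - Δφ)ρ and, for the second functional, that
  -- integral minus half of ∫ (|∇φ|² + R)ρ.
  refine ⟨hint, ⟨_, fun t htt => ⟨hE t htt, hE' t htt⟩⟩, ⟨_, fun t htt => ⟨hG t htt, hG' t htt⟩⟩, ?_⟩
  refine convexOn_of_hasDerivWithinAt2_nonneg hJ (fun t htt => (hG t htt).continuousWithinAt)
    (fun t htt => (hG t (interior_subset htt)).mono interior_subset)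
    (fun t htt => (hG' t (interior_subset htt)).mono interior_subset) fun t htt =>
    MeasureTheory.integral_nonneg fun x => ?_
  exact mul_nonneg (RicciTransport.normSqRicciSubHess_nonneg _ _ _)
    (hρ_pos t (interior_subset htt) x).le
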